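/- Let $\mathbb F$ be a field and let $\mathcal D=\{D_t\mid t\in T\}$, $\mathcal E=\{E_s\mid s\in S\}$ be finite collections of finite subsets of $\mathbb F$. A multi-sorted relation over $\mathcal D$ is a list of sorts $(t_1,\dots,t_m)$ (its signature) together with a subset of $D_{t_1}\times\dots\times D_{t_m}$; a multi-sorted constraint language is a set of such relations. Let $\Gamma$ be a multi-sorted constraint language over $\mathcal D$ (possibly infinite) and $\Delta$ one over $\mathcal E$. *Ideal membership.* An instance $\mathcal P=(X,\delta,\mathcal C)$ of $\mathrm{MCSP}(\Gamma)$ consists of a finite set $X$ of variables, sorts $\delta:X\to T$, and finitely many constraints $\langle(x_1,\dots,x_m),R\rangle$ with $R\in\Gamma$ of signature $(\delta(x_1),\dots,\delta(x_m))$. Its ideal $I(\mathcal P)\subseteq\mathbb F[X]$ is the sum of the ideal generated by the domain polynomials $\prod_{a\in D_{\delta(x)}}(x-a)$, $x\in X$, and of the ideals $\bigcap_{\mathbf v\in R}\langle x_1-v_1,\dots,x_m-v_m\rangle$ over all constraints. For $d\ge 0$, $\mathrm{IMP}_d(\Gamma)$ is the problem: given $(f,\mathcal P)$, where $\mathcal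 P$ is an instance of $\mathrm{MCSP}(\Gamma)$ and $f\in\mathbb F[X]$ is given as a sum of terms (coefficient times monomial) of degree at most $d$, decide whether $f\in I(\mathcal P)$. *pp-interpretations.* $\Gamma$ pp-defines a relation $R$ over $\mathcal D$ if $R(y_1,\dots,y_k)=\exists x_1\cdots\exists x_m\,L$, where $L$ is a conjunction of atomic formulas with predicates from $\Gamma$ and the equality relations of the sets $D_t$, every variable has a sort that agrees with the signatures of all atoms in which it occurs, a variable of sort $t$ ranges over $D_t$, and the sorts of $y_1,\dots,y_k$ form the signature of $R$. $\Gamma$ pp-interprets $\Delta$ if $\Delta$ is finite and for every $s\in S$ there are sorts $i_{s,1},\dots,i_{s,\ell_s}\in T$, a set $F_s\subseteq D_{i_{s,1}}\times\dots\times D_{i_{s,\ell_s}}$ and a surjection $\pi_s:F_s\to E_s$ such that $\Gamma$ pp-defines all the relations $F_s$, the preimages under $\pi_s$ of the equality relations on $E_s$, and the preimages $\pi^{-1}(Q)$ of all $Q\in\Delta$; here, for $Q$ of signature $(s_1,\dots,s_k)$, $\pi^{-1}(Q)$ consists of the concatenations of $\mathbf x_1\in F_{s_1},\dots,\mathbf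 x_k\in F_{s_k}$ with $(\pi_{s_1}(\mathbf x_1),\dots,\pi_{s_k}(\mathbf x_k))\in Q$. *Inputs.* Coefficients are elements of a subfield $K\subseteq\mathbb F$ that contains all $D_t$ and $E_s$, represented by words over a finite alphabet so that multiplication by each fixed element of $K$ is computable in polynomial time on representations. Relations of $\Gamma$ and of $\Delta$ are named by distinct words over finite alphabets, and variables are written as indices in unary. **Theorem.** If $\Gamma$ pp-interprets $\Delta$, then $\mathrm{IMP}_d(\Delta)$ is polynomial-time many-one reducible to $\mathrm{IMP}_{O(d)}(\Gamma)$. That is, there is a constant $c$, depending only on $\mathbb F,\mathcal D,\mathcal E,\Gamma,\Delta$, such that for every $d\ge 0$ (and every representation of inputs as above) there is a polynomial-time Turing machine which transforms each instance $(f,\mathcal P)$ of $\mathrm{IMP}_d(\Delta)$ into an instance $(f',\mathcal P')$ of $\mathrm{IMP}_{cd}(\Gamma)$ with $f\in I(\mathcal P)\iff f'\in I(\mathcal P')$. -/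

import Mathlib

/-! # Multi-sorted constraint languages, pp-interpretations and ideal membership problems -/

namespace MSIMP

section Languages

variable {T F : Type}

/-- A multi-sorted relation over the collection of finite domains `D t`, `t : T`:
a signature `(t₁, …, tₘ)` together with a subset of `D t₁ × ⋯ × D tₘ`. -/
structure MRel (D : T → Finset F) where
  arity : ℕ
  sig : Fin arity → T
  tuples : Set (Fin arity → F)
  mem_dom : ∀ a ∈ tuples, ∀ i, a i ∈ D (sig i)

/-- The equality relation on the domain `D t`, with signature `(t, t)`. -/
def eqRel (D : T → Finset F) (t : T) : MRel D where
  arity := 2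
  sig := fun _ => t
  tuples := {a | a 0 ∈ D t ∧ a 0 = a 1}
  mem_dom := by
    rintro a ⟨h0, h1⟩ i
    fin_cases i
    · exact h0
    · exact h1 ▸ h0

variable {D : T → Finset F}

/-- A constraint `⟨s, R⟩` (equivalently an atomic formula `R(s)`) with `R ∈ Γ`, over variables `V`
whose sorts are given by `δ`.  The sorts of the scope must form the signature of `R`. -/
structure Constraint (Γ : Set (MRel D)) {V : Type} (δ : V → T) where
  rel : Γ
  scope : Fin rel.1.arity → V
  sorted : ∀ j, δ (scope j) = rel.1.sig j

/-- The assignment `φ` satisfies the constraint. -/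
def Constraint.Sat {Γ : Set (MRel D)} {V : Type} {δ : V → T} (c : Constraint Γ δ)
    (φ : V → F) : Prop :=
  (fun j => φ (c.scope j)) ∈ c.rel.1.tuples

/-- `Γ` pp-defines the relation `R`: there are finitely many bound variables `x₁, …, xₘ`, sorts `σ`
for them and for the free variables, and a conjunction `L` of well-sorted atomic formulas with
predicates from `Γ` and equality relations, such that `R = ∃ x₁ ⋯ ∃ xₘ L`.  A variable of sort `t`
ranges over `D t`. -/
def PPDefines (Γ : Set (MRel D)) (R : MRel D) : Prop :=
  ∃ (m : ℕ) (σ : Fin m ⊕ Fin R.arity → T)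
    (L : List (Constraint (Γ ∪ Set.range (eqRel D)) σ)),
    (∀ i, σ (Sum.inr i) = R.sig i) ∧
    ∀ a : Fin R.arity → F, a ∈ R.tuples ↔
      (∀ i, a i ∈ D (R.sig i)) ∧
      ∃ b : Fin m → F, (∀ i, b i ∈ D (σ (Sum.inl i))) ∧ ∀ A ∈ L, A.Sat (Sum.elim b a)

/-- The `π`-preimage of a relation `Q` over `E`.  Here `Fr s` is the set
`F_s ⊆ D_{i_{s,1}} × ⋯ × D_{i_{s,ℓ_s}}`, and `π s : F_s → E_s`.  The coordinates of the preimage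
are the pairs `(i, j)`, `j < ℓ_{s_i}`, listed lexicographically. -/
def preimage {S : Type} {E : S → Finset F} (Fr : S → MRel D)
    (π : ∀ s, (Fr s).tuples → E s) (Q : MRel E) : MRel D where
  arity := ∑ i, (Fr (Q.sig i)).arity
  sig := fun p => (Fr (Q.sig (finSigmaFinEquiv.symm p).1)).sig (finSigmaFinEquiv.symm p).2
  tuples := {x | ∃ h : ∀ i, (fun j => x (finSigmaFinEquiv ⟨i, j⟩)) ∈ (Fr (Q.sig i)).tuples,
    (fun i => (π (Q.sig i) ⟨_, h i⟩ : F)) ∈ Q.tuples}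
  mem_dom := by
    rintro x ⟨h, -⟩ p
    have := (Fr (Q.sig (finSigmaFinEquiv.symm p).1)).mem_dom _
      (h (finSigmaFinEquiv.symm p).1) (finSigmaFinEquiv.symm p).2
    simpa using this

/-- `Γ` (over `D`) pp-interprets the finite language `Δ` (over `E`). -/
def PPInterprets {S : Type} {E : S → Finset F} (Γ : Set (MRel D)) (Δ : Set (MRel E)) : Prop :=
  Δ.Finite ∧ ∃ (Fr : S → MRel D) (π : ∀ s, (Fr s).tuples → E s),
    (∀ s, Function.Surjective (π s)) ∧
    (∀ s, PPDefines Γ (Fr s)) ∧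
    (∀ s, PPDefines Γ (preimage Fr π (eqRel E s))) ∧
    (∀ Q ∈ Δ, PPDefines Γ (preimage Fr π Q))

/-- An instance of the multi-sorted constraint satisfaction problem over `Γ`. -/
structure Instance (Γ : Set (MRel D)) where
  /-- the number of variables -/
  n : ℕ
  /-- the sorts of the variables -/
  sort : Fin n → T
  constraints : List (Constraint Γ sort)

variable [Field F]

open MvPolynomial in
/-- The ideal of a constraint `⟨s, R⟩`: the intersection, over the tuples `v ∈ R`, of the ideals
generated by the polynomials `x_{s_j} - v_j`. -/
noncomputable def Constraint.ideal {Γ : Set (MRel D)} {V : Type} {δ : V → T}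
    (c : Constraint Γ δ) : Ideal (MvPolynomial V F) :=
  ⨅ v ∈ c.rel.1.tuples, Ideal.span (Set.range fun j => X (c.scope j) - C (v j))

open MvPolynomial in
/-- The ideal `I(P)` of an instance: the sum of the ideals of its constraints and of the ideal
generated by the domain polynomials `∏_{a ∈ D_{δ(x)}} (x - a)` of all variables `x`. -/
noncomputable def Instance.ideal {Γ : Set (MRel D)} (P : Instance Γ) :
    Ideal (MvPolynomial (Fin P.n) F) :=
  Ideal.span (Set.range fun x => ∏ a ∈ D (P.sort x), (X x - C a)) ⊔
    ⨆ c ∈ P.constraints, c.ideal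

end Languages

/-! ### Representation of inputs by words -/

/-- A representation of the elements of a subfield `scalars` of `F` by words over a finite alphabet
(an element may have several representations).  Multiplication by any fixed scalar can be carried
out in polynomial time on representations; this is so whenever multiplication is
polynomial-time computable, as for the rationals in binary, number fields and finite fields. -/
structure ScalarRepr (F : Type) [Field F] where
  Code : Type
  Sym : Type
  finite_sym : Finite Sym
  word : Code → List Sym
  word_injective : Function.Injective word
  val : Code → F
  scalars : Subfield F
  range_val : Set.range val = scalars
  exists_scale : ∀ k ∈ scalars, ∃ g : Code → Code,
    (∀ a, val (g a) = k * val a) ∧ Nonempty (Turing.TM2ComputableInPolyTime word word g)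

/-- A naming of the relations of a (possibly infinite) language by words over a finite alphabet. -/
structure Naming {T F : Type} {D : T → Finset F} (Γ : Set (MRel D)) where
  Sym : Type
  finite_sym : Finite Sym
  name : Γ → List Sym
  name_injective : Function.Injective name

/-- The symbols in which instances are written; `T` is the set of sorts, `A` the alphabet for names
of relations, and `B` the alphabet for coefficients. -/
inductive Token (T A B : Type) : Type
  | sort (t : T)
  | rel (a : A)
  | coeff (b : B)
  | tick
  | endVar
  | endConstraint
  | endTerm

section IMP

variable {T F : Type} [Field F] {D : T → Finset F}

/-- An instance `(f, P)` of `IMP_d(Γ)`.  The polynomial `f` is given as a sum of terms, each being a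
coefficient together with a monomial of degree at most `d`, written as a list of variables
(with repetitions). -/
structure IMPInstance (K : ScalarRepr F) (Γ : Set (MRel D)) (d : ℕ) where
  csp : Instance Γ
  terms : List (K.Code × List (Fin csp.n))
  degree_le : ∀ t ∈ terms, t.2.length ≤ d

open MvPolynomial in
/-- The input polynomial `f` of an instance `(f, P)`. -/
noncomputable def IMPInstance.poly {K : ScalarRepr F} {Γ : Set (MRel D)} {d : ℕ}
    (I : IMPInstance K Γ d) : MvPolynomial (Fin I.csp.n) F :=
  (I.terms.map fun t => C (K.val t.1) * (t.2.map X).prod).sum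

/-- The question of the ideal membership problem: does `f` lie in `I(P)`? -/
def IMPInstance.Yes {K : ScalarRepr F} {Γ : Set (MRel D)} {d : ℕ}
    (I : IMPInstance K Γ d) : Prop :=
  I.poly ∈ I.csp.ideal

/-- A variable is written as its index in unary. -/
def encodeVar {T A B : Type} {n : ℕ} (x : Fin n) : List (Token T A B) :=
  List.replicate x Token.tick ++ [Token.endVar]

/-- The word for an instance: the sorts of the variables, then the constraints (name of the
relation, then scope), then the terms of the polynomial (coefficient, then monomial). -/
def IMPInstance.encode {K : ScalarRepr F} {Γ : Set (MRel D)} (N : Naming Γ) {d : ℕ}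
    (I : IMPInstance K Γ d) : List (Token T N.Sym K.Sym) :=
  (List.ofFn fun x => Token.sort (I.csp.sort x)) ++
  (I.csp.constraints.flatMap fun c =>
    (N.name c.rel).map Token.rel ++ (List.ofFn c.scope).flatMap encodeVar ++
      [Token.endConstraint]) ++
  (I.terms.flatMap fun t =>
    (K.word t.1).map Token.coeff ++ t.2.flatMap encodeVar ++ [Token.endTerm])

end IMP

/-- Polynomial-time many-one reducibility of the decision problem `P` to the decision problem `Q`,
with instances written as words via `ea` and `eb`. -/
def PolyTimeReducible {α β A B : Type} (ea : α → List A) (eb : β → List B)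
    (P : α → Prop) (Q : β → Prop) : Prop :=
  ∃ g : α → β, Nonempty (Turing.TM2ComputableInPolyTime ea eb g) ∧ ∀ a, P a ↔ Q (g a)

end MSIMP

/-!
# Reductions between ideal membership problems along pp-interpretations

An instance of `IMP_d(Δ)` is transformed as follows.  A variable of sort `s` is replaced by a block
of new variables, of the sorts in the signature of `F_s`, and every relation that should hold
between the blocks, that is `F_s` for every block and the preimage `π⁻¹(Q)` for every constraint
with the relation `Q`, is replaced by its pp-definition over `Γ`, with new variables in place of the
bound ones.  Equalities in these pp-definitions are eliminated by passing to representatives of the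
variables that they identify.  In the polynomial, every variable of sort `s` is replaced by a fixed
polynomial `P s`, evaluated at the block of the variable, that agrees with `π s` on the finite set
`F_s`.  If the polynomials `P s` have degree at most `c`, the new polynomial has degree at most
`c * d`.  The coefficients of `P s` can be chosen in the field that is generated by the domains, and
hence multiplication by them is computable in polynomial time on representations of scalars.

The domain polynomials are squarefree and split, so the ideal of an instance consists of all
polynomials that vanish at its solutions (`Instance.mem_ideal_iff`).  Therefore only solutions have
to be compared.  A solution of the new instance assigns to every block an element of `F_s`, and its
image under the maps `π s` is a solution of the old instance at which the old polynomial has the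
same value; since the maps `π s` are surjective, all solutions of the old instance arise in this way
(`reduce_correct`).

Most of the file shows that the transformation can be carried out by a Turing machine in polynomial
time.  Programs for multi-stack machines are composed from fragments (`Frag`), in which other
machines may be called as subroutines (`pRuns_call`).  This makes the polynomial-time functions
closed under composition, pairing, and iteration along a list with polynomially bounded intermediate
values (`PTime.comp`, `PTime.pair`, `PTime.foldl`), and they contain all functions that are computed
by finite automata with output (`PTime.of_transduce`).  For functions between types of encoded data
(`PT`) the usual operations on lists follow, and the transformation is composed from these
(`PT.reduce`).
-/

namespace MSIMP

open Turing

/-! ### Structured programs for multi-stack machines -/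

section Fragments

variable {K : Type} {Γ : K → Type}

/-- A program fragment over a fixed family of stacks: a `TM2` program with its own finite sets of
labels and of register values.  A run enters at `main` and leaves by halting, with the register
holding `init` at both ends, so that only the contents of the stacks are passed on. -/
structure Frag (K : Type) (Γ : K → Type) where
  Λ : Type
  σ : Type
  finite_Λ : Finite Λ
  finite_σ : Finite σ
  main : Λ
  init : σ
  code : Λ → TM2.Stmt Γ Λ σ

attribute [instance] Frag.finite_Λ Frag.finite_σ

variable [DecidableEq K]

/-- `Steps m n c c'`: the program `m` takes the configuration `c` to `c'` in exactly `n` steps. -/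
inductive Steps {Λ σ : Type} (m : Λ → TM2.Stmt Γ Λ σ) :
    ℕ → TM2.Cfg Γ Λ σ → TM2.Cfg Γ Λ σ → Prop
  | refl (c) : Steps m 0 c c
  | cons {n c d e} : TM2.step m c = some d → Steps m n d e → Steps m (n + 1) c e

theorem Steps.trans {Λ σ : Type} {m : Λ → TM2.Stmt Γ Λ σ} {n k : ℕ} {c d e : TM2.Cfg Γ Λ σ}
    (h : Steps m n c d) (h' : Steps m k d e) : Steps m (n + k) c e := by
  induction h with
  | refl => simpa using h'
  | @cons n _ _ _ hs _ ih => rw [Nat.add_right_comm]; exact .cons hs (ih h')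

theorem steps_iff_iterate {Λ σ : Type} {m : Λ → TM2.Stmt Γ Λ σ} {n : ℕ}
    {c e : TM2.Cfg Γ Λ σ} :
    Steps m n c e ↔ (flip bind (TM2.step m))^[n] (some c) = some e := by
  induction n generalizing c with
  | zero =>
    constructor
    · rintro ⟨⟩; rfl
    · intro h
      simp only [Function.iterate_zero, id_eq, Option.some.injEq] at h
      subst h
      exact .refl _
  | succ n ih =>
    have key : (flip bind (TM2.step m))^[n + 1] (some c)
        = (flip bind (TM2.step m))^[n] (TM2.step m c) := by
      rw [Function.iterate_succ_apply]; rfl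
    rw [key]
    constructor
    · rintro (_ | ⟨hs, h⟩); rw [hs]; exact ih.1 h
    · intro h
      rcases hs : TM2.step m c with _ | d
      · rw [hs] at h
        have : ∀ k, (flip bind (TM2.step m))^[k] (none : Option (TM2.Cfg Γ Λ σ)) = none := by
          intro k
          induction k with
          | zero => rfl
          | succ k ihk => rw [Function.iterate_succ_apply]; exact ihk
        rw [this] at h; cases h
      · rw [hs] at h; exact .cons hs (ih.2 h)

/-- `M.Runs S S' t`: started on the stacks `S`, the fragment `M` halts within `t` steps with the
stacks `S'`. -/
def Frag.Runs (M : Frag K Γ) (S S' : ∀ k, List (Γ k)) (t : ℕ) : Prop :=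
  ∃ n ≤ t, Steps M.code n ⟨some M.main, M.init, S⟩ ⟨none, M.init, S'⟩

theorem Frag.Runs.mono {M : Frag K Γ} {S S' : ∀ k, List (Γ k)} {t t' : ℕ} (h : M.Runs S S' t)
    (ht : t ≤ t') : M.Runs S S' t' :=
  let ⟨n, hn, hs⟩ := h
  ⟨n, hn.trans ht, hs⟩

end Fragments

section Embedding

variable {K K₁ : Type} {Γ : K → Type} {Λ Λ₁ σ σ₁ : Type}

/-- Translation of a statement along an embedding `ε` of the stacks, a map `f` of the labels, with
halting replaced by a jump to `e`, and a lens `(get, set)` for the registers. -/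
def embed (ε : K₁ → K) (f : Λ₁ → Λ) (e : Option Λ) (get : σ → σ₁) (set : σ₁ → σ → σ) :
    TM2.Stmt (fun k => Γ (ε k)) Λ₁ σ₁ → TM2.Stmt Γ Λ σ
  | .push k g q => .push (ε k) (fun v => g (get v)) (embed ε f e get set q)
  | .peek k g q => .peek (ε k) (fun v o => set (g (get v) o) v) (embed ε f e get set q)
  | .pop k g q => .pop (ε k) (fun v o => set (g (get v) o) v) (embed ε f e get set q)
  | .load g q => .load (fun v => set (g (get v)) v) (embed ε f e get set q)
  | .branch g q₁ q₂ =>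
      .branch (fun v => g (get v)) (embed ε f e get set q₁) (embed ε f e get set q₂)
  | .goto l => .goto (fun v => f (l (get v)))
  | .halt => match e with
    | none => .halt
    | some l => .goto fun _ => l

/-- The configuration `c'` of the embedded machine corresponds to `c`: the stacks outside the range
of `ε` are those of `S₀`, and the rest of the register is that of `w`. -/
structure Sim (ε : K₁ → K) (f : Λ₁ → Λ) (e : Option Λ) (set : σ₁ → σ → σ) (w : σ)
    (S₀ : ∀ k, List (Γ k)) (c : TM2.Cfg (fun k => Γ (ε k)) Λ₁ σ₁) (c' : TM2.Cfg Γ Λ σ) : Prop where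
  label : c'.l = c.l.elim e fun l => some (f l)
  var : c'.var = set c.var w
  stk : ∀ k, c'.stk (ε k) = c.stk k
  frame : ∀ k, k ∉ Set.range ε → c'.stk k = S₀ k

variable [DecidableEq K] [DecidableEq K₁] {ε : K₁ → K} {f : Λ₁ → Λ} {e : Option Λ}
  {get : σ → σ₁} {set : σ₁ → σ → σ}

theorem sim_stepAux (hε : Function.Injective ε) (hgs : ∀ a v, get (set a v) = a)
    (hss : ∀ a b v, set a (set b v) = set a v) (w : σ) (S₀ : ∀ k, List (Γ k))
    (q : TM2.Stmt (fun k => Γ (ε k)) Λ₁ σ₁) (v : σ₁) (S : ∀ k, List (Γ (ε k)))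
    (S' : ∀ k, List (Γ k)) (hS : ∀ k, S' (ε k) = S k)
    (hS₀ : ∀ k, k ∉ Set.range ε → S' k = S₀ k) :
    Sim ε f e set w S₀ (TM2.stepAux q v S)
      (TM2.stepAux (embed ε f e get set q) (set v w) S') := by
  have upd : ∀ k (a : List (Γ (ε k))) k', Function.update S' (ε k) a (ε k')
      = Function.update S k a k' := by
    intro k a k'
    have := congr_fun (Function.update_comp_eq_of_injective' S' hε k a) k'
    rw [this]; congr 1; exact funext hS
  have upd₀ : ∀ k (a : List (Γ (ε k))) k', k' ∉ Set.range ε →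
      Function.update S' (ε k) a k' = S₀ k' := by
    intro k a k' hk'
    rw [Function.update_of_ne (fun h => hk' ⟨k, h.symm⟩)]; exact hS₀ _ hk'
  induction q generalizing v S S' with
  | push k g q ih =>
    simp only [embed, TM2.stepAux, hgs, hS]
    exact ih _ _ _ (upd _ _) (upd₀ _ _) (fun k' a k'' => by
      have := congr_fun (Function.update_comp_eq_of_injective'
        (Function.update S' (ε k) (g v :: S k)) hε k' a) k''
      rw [this]; congr 1; exact funext (upd k _))
      (fun k' a k'' hk' => by
        rw [Function.update_of_ne (fun h => hk' ⟨k', h.symm⟩)]; exact upd₀ _ _ _ hk')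
  | peek k g q ih =>
    simp only [embed, TM2.stepAux, hgs, hS, hss]
    exact ih _ _ _ hS hS₀ upd upd₀
  | pop k g q ih =>
    simp only [embed, TM2.stepAux, hgs, hS, hss]
    exact ih _ _ _ (upd _ _) (upd₀ _ _) (fun k' a k'' => by
      have := congr_fun (Function.update_comp_eq_of_injective'
        (Function.update S' (ε k) (S k).tail) hε k' a) k''
      rw [this]; congr 1; exact funext (upd k _))
      (fun k' a k'' hk' => by
        rw [Function.update_of_ne (fun h => hk' ⟨k', h.symm⟩)]; exact upd₀ _ _ _ hk')
  | load g q ih =>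
    simp only [embed, TM2.stepAux, hgs, hss]
    exact ih _ _ _ hS hS₀ upd upd₀
  | branch g q₁ q₂ ih₁ ih₂ =>
    simp only [embed, TM2.stepAux, hgs]
    cases g v
    · exact ih₂ _ _ _ hS hS₀ upd upd₀
    · exact ih₁ _ _ _ hS hS₀ upd upd₀
  | goto l =>
    simp only [embed, TM2.stepAux, hgs]
    exact ⟨rfl, rfl, hS, hS₀⟩
  | halt =>
    rcases e with _ | l
    · exact ⟨rfl, rfl, hS, hS₀⟩
    · exact ⟨rfl, rfl, hS, hS₀⟩

/-- A run of a machine is also a run of its translation, with the same number of steps. -/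
theorem sim_steps (hε : Function.Injective ε) (hgs : ∀ a v, get (set a v) = a)
    (hss : ∀ a b v, set a (set b v) = set a v) {m₁ : Λ₁ → TM2.Stmt (fun k => Γ (ε k)) Λ₁ σ₁}
    {m : Λ → TM2.Stmt Γ Λ σ} (hm : ∀ l, m (f l) = embed ε f e get set (m₁ l))
    {w : σ} {S₀ : ∀ k, List (Γ k)} {n : ℕ} {c d : TM2.Cfg (fun k => Γ (ε k)) Λ₁ σ₁}
    (h : Steps m₁ n c d) {c' : TM2.Cfg Γ Λ σ} (hc : Sim ε f e set w S₀ c c') :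
    ∃ d', Steps m n c' d' ∧ Sim ε f e set w S₀ d d' := by
  induction h generalizing c' with
  | refl => exact ⟨c', .refl _, hc⟩
  | @cons n c d _ hs _ ih =>
    obtain ⟨_ | l, v, S⟩ := c
    · simp at hs
    obtain ⟨l', v', S'⟩ := c'
    obtain ⟨h₁, h₂, h₃, h₄⟩ := hc
    simp only [Option.elim_some] at h₁ h₂ h₃ h₄
    subst h₁ h₂
    simp only [TM2.step, Option.some.injEq] at hs
    subst hs
    obtain ⟨d', hd', hsim⟩ := ih (c' := TM2.stepAux (m (f l)) (set v w) S')
      (by rw [hm]; exact sim_stepAux hε hgs hss w S₀ _ v S S' h₃ h₄)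
    exact ⟨d', .cons rfl hd', hsim⟩

end Embedding

section Combinators

variable {K : Type} {Γ : K → Type} [DecidableEq K]

/-- A fragment over some of the stacks, as a fragment over all of them. -/
def Frag.lift {K₁ : Type} (ε : K₁ → K) (M : Frag K₁ fun k => Γ (ε k)) : Frag K Γ where
  Λ := M.Λ
  σ := M.σ
  finite_Λ := M.finite_Λ
  finite_σ := M.finite_σ
  main := M.main
  init := M.init
  code l := embed ε id none id (fun a _ => a) (M.code l)

theorem Frag.Runs.lift {K₁ : Type} [DecidableEq K₁] {ε : K₁ → K} (hε : Function.Injective ε)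
    {M : Frag K₁ fun k => Γ (ε k)} {S₁ S₁' : ∀ k, List (Γ (ε k))} {t : ℕ} (h : M.Runs S₁ S₁' t)
    {S S' : ∀ k, List (Γ k)} (hS : ∀ k, S (ε k) = S₁ k) (hS' : ∀ k, S' (ε k) = S₁' k)
    (hframe : ∀ k, k ∉ Set.range ε → S' k = S k) : (M.lift ε).Runs S S' t := by
  obtain ⟨n, hn, hs⟩ := h
  obtain ⟨⟨l, v, S''⟩, hd, h₁, h₂, h₃, h₄⟩ := sim_steps (m := (M.lift ε).code) (f := id)
    (e := none) (get := id) (set := fun a _ => a) hε (fun _ _ => rfl) (fun _ _ _ => rfl)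
    (fun _ => rfl) (w := M.init) (S₀ := S) hs
    (c' := ⟨some M.main, M.init, S⟩) ⟨rfl, rfl, hS, fun _ _ => rfl⟩
  simp only at h₁ h₂ h₃ h₄
  subst h₁ h₂
  have : S'' = S' := by
    funext k
    by_cases hk : k ∈ Set.range ε
    · obtain ⟨k, rfl⟩ := hk; rw [h₃, hS']
    · rw [h₄ k hk, hframe k hk]
  subst this
  exact ⟨n, hn, hd⟩

/-- Sequential composition. -/
def Frag.seq (M N : Frag K Γ) : Frag K Γ where
  Λ := M.Λ ⊕ N.Λ
  σ := M.σ × N.σ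
  finite_Λ := inferInstance
  finite_σ := inferInstance
  main := .inl M.main
  init := (M.init, N.init)
  code
    | .inl l => embed (ε := id) .inl (some (.inr N.main)) Prod.fst (fun a v => (a, v.2)) (M.code l)
    | .inr l => embed (ε := id) .inr none Prod.snd (fun a v => (v.1, a)) (N.code l)

theorem Frag.Runs.seq {M N : Frag K Γ} {S S' S'' : ∀ k, List (Γ k)} {t t' : ℕ}
    (h : M.Runs S S' t) (h' : N.Runs S' S'' t') : (M.seq N).Runs S S'' (t + t') := by
  obtain ⟨n, hn, hs⟩ := h
  obtain ⟨n', hn', hs'⟩ := h'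
  obtain ⟨⟨l, v, T⟩, hd, h₁, h₂, h₃, -⟩ := sim_steps (m := (M.seq N).code) (ε := id)
    (f := .inl) (e := some (.inr N.main)) (get := Prod.fst) (set := fun a v => (a, v.2))
    Function.injective_id (fun _ _ => rfl) (fun _ _ _ => rfl)
    (fun _ => rfl) (w := (M.init, N.init)) (S₀ := S) hs
    (c' := ⟨some (.inl M.main), (M.init, N.init), S⟩) ⟨rfl, rfl, fun _ => rfl, fun _ _ => rfl⟩
  obtain ⟨⟨l', v', T'⟩, hd', h₁', h₂', h₃', -⟩ := sim_steps (m := (M.seq N).code) (ε := id)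
    (f := .inr) (e := none) (get := Prod.snd) (set := fun a v => (v.1, a))
    Function.injective_id (fun _ _ => rfl) (fun _ _ _ => rfl)
    (fun _ => rfl) (w := (M.init, N.init)) (S₀ := S) hs'
    (c' := ⟨some (.inr N.main), (M.init, N.init), S'⟩)
    ⟨rfl, rfl, fun _ => rfl, fun k hk => (hk ⟨k, rfl⟩).elim⟩
  simp only [Option.elim_none] at h₁ h₂ h₃ h₁' h₂' h₃'
  obtain rfl : T = S' := funext h₃
  obtain rfl : T' = S'' := funext h₃'
  subst h₁ h₂ h₁' h₂'
  exact ⟨n + n', add_le_add hn hn', hd.trans hd'⟩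

/-- Repeat `M` as long as the stack `k` is not empty. -/
def Frag.whileNE (k : K) (M : Frag K Γ) : Frag K Γ where
  Λ := Option M.Λ
  σ := M.σ × Bool
  finite_Λ := inferInstance
  finite_σ := inferInstance
  main := none
  init := (M.init, false)
  code
    | none => .peek k (fun v o => (v.1, o.isSome)) <| .branch (fun v => v.2)
        (.load (fun v => (v.1, false)) <| .goto fun _ => some M.main) .halt
    | some l => embed (ε := id) some (some none) Prod.fst (fun a v => (a, v.2)) (M.code l)

theorem Frag.Runs.while_nil {k : K} {M : Frag K Γ} {S : ∀ k, List (Γ k)} (h : S k = []) :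
    (M.whileNE k).Runs S S 1 := by
  refine ⟨1, le_rfl, .cons (d := ⟨none, (M.init, false), S⟩) ?_ (.refl _)⟩
  simp [Frag.whileNE, h]

theorem Frag.Runs.while_cons {k : K} {M : Frag K Γ} {S S' S'' : ∀ k, List (Γ k)} {t t' : ℕ}
    (h : S k ≠ []) (hM : M.Runs S S' t) (hW : (M.whileNE k).Runs S' S'' t') :
    (M.whileNE k).Runs S S'' (t + t' + 1) := by
  obtain ⟨n, hn, hs⟩ := hM
  obtain ⟨n', hn', hs'⟩ := hW
  obtain ⟨⟨l, v, T⟩, hd, h₁, h₂, h₃, -⟩ := sim_steps (m := (M.whileNE k).code) (ε := id)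
    (f := some) (e := some none) (get := Prod.fst) (set := fun a v => (a, v.2))
    Function.injective_id (fun _ _ => rfl) (fun _ _ _ => rfl)
    (fun _ => rfl) (w := (M.init, false)) (S₀ := S) hs
    (c' := ⟨some (some M.main), (M.init, false), S⟩) ⟨rfl, rfl, fun _ => rfl, fun _ _ => rfl⟩
  simp only [Option.elim_none] at h₁ h₂ h₃
  obtain rfl : T = S' := funext h₃
  subst h₁ h₂
  refine ⟨n + n' + 1, by omega, .cons (d := ⟨some (some M.main), (M.init, false), S⟩) ?_
    (hd.trans hs')⟩
  obtain ⟨x, l, hx⟩ := List.exists_cons_of_ne_nil h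
  simp [Frag.whileNE, hx]

/-- Push a list of symbols, each with the stack it goes to. -/
def pushAll (ps : List (Σ k, Γ k)) (S : ∀ k, List (Γ k)) : ∀ k, List (Γ k) :=
  ps.foldl (fun S p => Function.update S p.1 (p.2 :: S p.1)) S

/-- The symbols of a list that go to the stack `k`. -/
def select (k : K) (ps : List (Σ k, Γ k)) : List (Γ k) :=
  ps.flatMap fun p => if h : p.1 = k then [h ▸ p.2] else []

theorem pushAll_apply (ps : List (Σ k, Γ k)) (S : ∀ k, List (Γ k)) (k : K) :
    pushAll ps S k = (select k ps).reverse ++ S k := by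
  induction ps generalizing S with
  | nil => simp [pushAll, select]
  | cons p ps ih =>
    obtain ⟨k', x⟩ := p
    change pushAll ps _ k = _
    rw [ih]
    by_cases h : k' = k
    · subst h; simp [select]
    · simp [select, h, Function.update_of_ne (Ne.symm h)]

@[simp] theorem select_nil (k : K) : select k ([] : List (Σ k, Γ k)) = [] := rfl

theorem select_append (k : K) (ps qs : List (Σ k, Γ k)) :
    select k (ps ++ qs) = select k ps ++ select k qs := by simp [select]

theorem select_flatMap {α : Type} (k : K) (l : List α) (f : α → List (Σ k, Γ k)) :
    select k (l.flatMap f) = l.flatMap fun x => select k (f x) := by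
  simp [select, List.flatMap_assoc]

theorem select_map_self {α : Type} (k : K) (l : List α) (f : α → Γ k) :
    select k (l.map fun x => (⟨k, f x⟩ : Σ k, Γ k)) = l.map f := by
  induction l with
  | nil => rfl
  | cons x l ih => simpa [select] using ih

theorem select_map_of_ne {α : Type} {k k' : K} (h : k' ≠ k) (l : List α) (f : α → Γ k') :
    select k (l.map fun x => (⟨k', f x⟩ : Σ k, Γ k)) = [] := by
  simp [select, h, List.flatMap_map]

/-- The statement that pushes the given symbols and goes on with `q`. -/
def pushStmt {Λ σ : Type} (ps : List (Σ k, Γ k)) (q : TM2.Stmt Γ Λ σ) : TM2.Stmt Γ Λ σ :=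
  ps.foldr (fun p q => .push p.1 (fun _ => p.2) q) q

theorem stepAux_pushStmt {Λ σ : Type} (ps : List (Σ k, Γ k)) (q : TM2.Stmt Γ Λ σ) (v : σ)
    (S : ∀ k, List (Γ k)) :
    TM2.stepAux (pushStmt ps q) v S = TM2.stepAux q v (pushAll ps S) := by
  induction ps generalizing S with
  | nil => rfl
  | cons p ps ih => exact ih _

/-- A finite automaton with output that consumes the stack `a` from the top: in the state `q` it
pops a symbol `x`, pushes `out q x` and moves to the state `next q x`.  When the stack is empty, or
in a state with `halted q`, it pushes `fin q` and halts. -/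
def Frag.scan {Q : Type} [Finite Q] (a : K) [Finite (Γ a)] (q₀ : Q) (next : Q → Γ a → Q)
    (out : Q → Γ a → List (Σ k, Γ k)) (halted : Q → Bool) (fin : Q → List (Σ k, Γ k)) :
    Frag K Γ where
  Λ := Q ⊕ Q × Γ a
  σ := Option (Γ a)
  finite_Λ := inferInstance
  finite_σ := inferInstance
  main := .inl q₀
  init := none
  code
    | .inl q => bif halted q then pushStmt (fin q) .halt else
        .pop a (fun _ o => o) <| .branch Option.isSome
          (.goto fun v => v.elim (.inl q) fun x => .inr (q, x)) (pushStmt (fin q) .halt)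
    | .inr (q, x) => .load (fun _ => none) <| pushStmt (out q x) <| .goto fun _ => .inl (next q x)

/-- The symbols pushed by `Frag.scan` on a given content of its stack, and what it leaves of it. -/
def scanResult {A P Q : Type} (next : Q → A → Q) (out : Q → A → List P) (halted : Q → Bool)
    (fin : Q → List P) : Q → List A → List P × List A
  | q, [] => (fin q, [])
  | q, x :: l => bif halted q then (fin q, x :: l) else
      (out q x ++ (scanResult next out halted fin (next q x) l).1,
        (scanResult next out halted fin (next q x) l).2)

theorem pushAll_append (ps qs : List (Σ k, Γ k)) (S : ∀ k, List (Γ k)) :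
    pushAll (ps ++ qs) S = pushAll qs (pushAll ps S) := List.foldl_append

theorem select_eq_nil {a : K} {ps : List (Σ k, Γ k)} (h : ∀ p ∈ ps, p.1 ≠ a) :
    select a ps = [] := by
  simp only [select, List.flatMap_eq_nil_iff]
  intro p hp
  simp [h p hp]

theorem pushAll_update {a : K} {ps : List (Σ k, Γ k)} (h : ∀ p ∈ ps, p.1 ≠ a)
    (S : ∀ k, List (Γ k)) (l : List (Γ a)) :
    pushAll ps (Function.update S a l) = Function.update (pushAll ps S) a l := by
  funext k
  by_cases hk : k = a
  · subst hk; simp [pushAll_apply, select_eq_nil h]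
  · simp [pushAll_apply, Function.update_of_ne hk]

/-- A scan takes at most two steps for every symbol: one to pop it, and one to push the output. -/
theorem Frag.runs_scan {Q : Type} [Finite Q] (a : K) [Finite (Γ a)] (q₀ : Q)
    (next : Q → Γ a → Q) (out : Q → Γ a → List (Σ k, Γ k)) (halted : Q → Bool)
    (fin : Q → List (Σ k, Γ k)) (hout : ∀ q x, ∀ p ∈ out q x, p.1 ≠ a) (S : ∀ k, List (Γ k)) :
    (Frag.scan a q₀ next out halted fin).Runs S
      (pushAll (scanResult next out halted fin q₀ (S a)).1
        (Function.update S a (scanResult next out halted fin q₀ (S a)).2))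
      (2 * (S a).length + 1) := by
  suffices H : ∀ (l : List (Γ a)) (q : Q) (S : ∀ k, List (Γ k)), S a = l →
      ∃ n ≤ 2 * l.length + 1, Steps (Frag.scan a q₀ next out halted fin).code n
        ⟨some (.inl q), none, S⟩ ⟨none, none, (pushAll (scanResult next out halted fin q l).1
        (Function.update S a (scanResult next out halted fin q l).2))⟩ from H _ _ _ rfl
  intro l
  induction l with
  | nil =>
    intro q S hS
    refine ⟨1, by simp, .cons ?_ (.refl _)⟩
    cases hq : halted q <;> simp [Frag.scan, hq, hS, scanResult, stepAux_pushStmt]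
    rw [← hS, Function.update_eq_self]
  | cons x l ih =>
    intro q S hS
    cases hq : halted q
    · obtain ⟨n, hn, hs⟩ := ih (next q x) (pushAll (out q x) (Function.update S a l))
        (by rw [pushAll_apply, select_eq_nil (hout q x)]; simp)
      refine ⟨n + 2, by simp; omega, .cons (d := ⟨some (.inr (q, x)), some x,
        Function.update S a l⟩) ?_ (.cons (d := ⟨some (.inl (next q x)), none,
          pushAll (out q x) (Function.update S a l)⟩) ?_ ?_)⟩
      · simp [Frag.scan, hq, hS]
      · simp [Frag.scan, stepAux_pushStmt]
      · simp only [scanResult, hq, cond_false, pushAll_append]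
        rw [← pushAll_update (hout q x), Function.update_idem] at hs
        exact hs
    · refine ⟨1, by simp, .cons ?_ (.refl _)⟩
      simp [Frag.scan, hq, scanResult, stepAux_pushStmt]
      rw [← hS, Function.update_eq_self]

/-- Empty the stack `a`, pushing `out x` for every symbol `x`. -/
def Frag.drain (a : K) [Finite (Γ a)] (out : Γ a → List (Σ k, Γ k)) : Frag K Γ :=
  .scan a () (fun _ _ => ()) (fun _ => out) (fun _ => false) fun _ => []

theorem Frag.runs_drain (a : K) [Finite (Γ a)] (out : Γ a → List (Σ k, Γ k))
    (hout : ∀ x, ∀ p ∈ out x, p.1 ≠ a) (S : ∀ k, List (Γ k)) :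
    (Frag.drain a out).Runs S (pushAll ((S a).flatMap out) (Function.update S a []))
      (2 * (S a).length + 1) := by
  have h := Frag.runs_scan a () (fun _ _ => ()) (fun _ => out) (fun _ => false) (fun _ => [])
    (fun _ => hout) S
  have key : ∀ l : List (Γ a), scanResult (fun _ _ => ()) (fun _ => out) (fun _ => false)
      (fun _ => []) () l = (l.flatMap out, []) := by
    intro l
    induction l with
    | nil => rfl
    | cons x l ih => simp [scanResult, ih]
  rw [key] at h
  exact h

end Combinators

/-! ### Calling machines as subroutines -/

section Polynomials

/-- Functions bounded by a polynomial with natural coefficients. -/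
@[fun_prop]
def PolyBdd (t : ℕ → ℕ) : Prop := ∃ p : Polynomial ℕ, ∀ n, t n ≤ p.eval n

theorem eval_mono_nat (p : Polynomial ℕ) {m n : ℕ} (h : m ≤ n) : p.eval m ≤ p.eval n := by
  simp only [Polynomial.eval_eq_sum_range]
  gcongr

@[fun_prop]
theorem PolyBdd.eval (p : Polynomial ℕ) : PolyBdd fun n => p.eval n := ⟨p, fun _ => le_rfl⟩

@[fun_prop]
theorem PolyBdd.const (c : ℕ) : PolyBdd fun _ => c := ⟨.C c, by simp⟩

@[fun_prop]
theorem PolyBdd.id : PolyBdd fun n => n := ⟨.X, by simp⟩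

@[fun_prop]
theorem PolyBdd.add {s t : ℕ → ℕ} (hs : PolyBdd s) (ht : PolyBdd t) :
    PolyBdd fun n => s n + t n := by
  obtain ⟨p, hp⟩ := hs
  obtain ⟨q, hq⟩ := ht
  exact ⟨p + q, fun n => by rw [Polynomial.eval_add]; exact add_le_add (hp n) (hq n)⟩

@[fun_prop]
theorem PolyBdd.mul {s t : ℕ → ℕ} (hs : PolyBdd s) (ht : PolyBdd t) :
    PolyBdd fun n => s n * t n := by
  obtain ⟨p, hp⟩ := hs
  obtain ⟨q, hq⟩ := ht
  exact ⟨p * q, fun n => by rw [Polynomial.eval_mul]; exact Nat.mul_le_mul (hp n) (hq n)⟩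

/-- A polynomially bounded function has a monotone polynomial bound. -/
theorem PolyBdd.exists_mono {t : ℕ → ℕ} (ht : PolyBdd t) :
    ∃ t', PolyBdd t' ∧ Monotone t' ∧ ∀ n, t n ≤ t' n :=
  let ⟨p, hp⟩ := ht
  ⟨_, .eval p, fun _ _ h => eval_mono_nat p h, hp⟩

@[fun_prop]
theorem PolyBdd.comp {s t : ℕ → ℕ} (hs : PolyBdd s) (ht : PolyBdd t) :
    PolyBdd fun n => s (t n) := by
  obtain ⟨p, hp⟩ := hs
  obtain ⟨q, hq⟩ := ht
  exact ⟨p.comp q, fun n => by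
    rw [Polynomial.eval_comp]; exact (hp _).trans (eval_mono_nat p (hq n))⟩

end Polynomials

section Machines

/-- A bundled machine as a program fragment. -/
def ofTM (tm : FinTM2) : Frag tm.K tm.Γ where
  Λ := tm.Λ
  σ := tm.σ
  finite_Λ := @Finite.of_fintype _ tm.ΛFin
  finite_σ := @Finite.of_fintype _ tm.σFin
  main := tm.main
  init := tm.initialState
  code := tm.m

theorem initList_eq (tm : FinTM2) (s : List (tm.Γ tm.k₀)) :
    initList tm s = ⟨some tm.main, tm.initialState, Function.update (fun _ => []) tm.k₀ s⟩ := by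
  refine congrArg (TM2.Cfg.mk _ _) (funext fun k => ?_)
  by_cases h : k = tm.k₀
  · subst h; simp
  · simp [h]

theorem haltList_eq (tm : FinTM2) (s : List (tm.Γ tm.k₁)) :
    haltList tm s = ⟨none, tm.initialState, Function.update (fun _ => []) tm.k₁ s⟩ := by
  refine congrArg (TM2.Cfg.mk _ _) (funext fun k => ?_)
  by_cases h : k = tm.k₁
  · subst h; simp
  · simp [h]

theorem runs_of_outputs {tm : FinTM2} {s : List (tm.Γ tm.k₀)} {s' : List (tm.Γ tm.k₁)} {t : ℕ}
    (h : TM2OutputsInTime tm s (some s') t) :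
    (ofTM tm).Runs (Function.update (fun _ => []) tm.k₀ s)
      (Function.update (fun _ => []) tm.k₁ s') t := by
  obtain ⟨⟨n, h⟩, hn⟩ := h
  rw [initList_eq, Option.map_some, haltList_eq] at h
  exact ⟨n, hn, steps_iff_iterate.2 h⟩

/-- The number of push instructions in a statement. -/
def pushCount {K Λ σ : Type} {Γ : K → Type} : TM2.Stmt Γ Λ σ → ℕ
  | .push _ _ q => pushCount q + 1
  | .peek _ _ q => pushCount q
  | .pop _ _ q => pushCount q
  | .load _ q => pushCount q
  | .branch _ q₁ q₂ => pushCount q₁ + pushCount q₂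
  | .goto _ => 0
  | .halt => 0

theorem length_stepAux_le {K Λ σ : Type} {Γ : K → Type} [DecidableEq K] (q : TM2.Stmt Γ Λ σ)
    (v : σ) (S : ∀ k, List (Γ k)) (k : K) :
    ((TM2.stepAux q v S).stk k).length ≤ (S k).length + pushCount q := by
  induction q generalizing v S with
  | push k' g q ih =>
    refine (ih _ _).trans ?_
    simp only [pushCount]
    by_cases h : k = k'
    · subst h; simp; omega
    · rw [Function.update_of_ne h]; omega
  | pop k' g q ih =>
    refine (ih _ _).trans ?_
    simp only [pushCount]
    by_cases h : k = k'
    · subst h; simp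
    · rw [Function.update_of_ne h]
  | peek k' g q ih => exact ih _ _
  | load g q ih => exact ih _ _
  | branch g q₁ q₂ ih₁ ih₂ =>
    simp only [TM2.stepAux, pushCount]
    cases g v
    · exact (ih₂ _ _).trans (by omega)
    · exact (ih₁ _ _).trans (by omega)
  | goto => simp [TM2.stepAux, pushCount]
  | halt => simp [TM2.stepAux, pushCount]

theorem length_steps_le {K Λ σ : Type} {Γ : K → Type} [DecidableEq K]
    {m : Λ → TM2.Stmt Γ Λ σ} {C : ℕ} (hC : ∀ l, pushCount (m l) ≤ C) {n : ℕ}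
    {c d : TM2.Cfg Γ Λ σ} (h : Steps m n c d) (k : K) :
    (d.stk k).length ≤ (c.stk k).length + n * C := by
  induction h with
  | refl => simp
  | @cons n c d e hs _ ih =>
    obtain ⟨_ | l, v, S⟩ := c
    · simp at hs
    simp only [TM2.step, Option.some.injEq] at hs
    subst hs
    have := length_stepAux_le (m l) v S k
    have := hC l
    rw [add_mul]
    simp only [] at ih ⊢
    omega

/-- Every step pushes a bounded number of symbols, so the length of the output is bounded in terms
of the running time. -/
theorem length_output_le (tm : FinTM2) : ∃ C, ∀ (s : List (tm.Γ tm.k₀)) (s' : List (tm.Γ tm.k₁))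
    (t : ℕ), TM2OutputsInTime tm s (some s') t → s'.length ≤ s.length + t * C := by
  have := tm.ΛFin
  refine ⟨∑ l, pushCount (tm.m l), fun s s' t h => ?_⟩
  obtain ⟨n, hn, hs⟩ := runs_of_outputs h
  have := length_steps_le (C := ∑ l, pushCount (tm.m l)) (m := tm.m)
    (fun l => Finset.single_le_sum (f := fun l => pushCount (tm.m l)) (by simp)
      (Finset.mem_univ l)) hs tm.k₁
  simp only [Function.update_self] at this
  have h₁ : (Function.update (β := fun k => List (tm.Γ k)) (fun _ => []) tm.k₀ s tm.k₁).length
      ≤ s.length := by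
    by_cases h : tm.k₁ = tm.k₀
    · generalize tm.k₁ = k at h; subst h; simp
    · rw [Function.update_of_ne h]; simp
  have := Nat.mul_le_mul_right (∑ l, pushCount (tm.m l)) hn
  omega

end Machines

section Calls

variable {Own : Type} {Γ : Own → Type} {ι : Type} (tm : ι → FinTM2)

/-- The stacks of a program that uses the machines `tm i` as subroutines. -/
abbrev AllStacks (Own : Type) (tm : ι → FinTM2) : Type := Own ⊕ Σ i, (tm i).K

/-- The alphabets of the stacks of a program with subroutines. -/
abbrev AllSyms (Γ : Own → Type) (tm : ι → FinTM2) : AllStacks Own tm → Type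
  | .inl k => Γ k
  | .inr p => (tm p.1).Γ p.2

/-- The stacks of the program itself are given, and those of the subroutines are empty. -/
def full (S : ∀ k, List (Γ k)) : ∀ k, List (AllSyms Γ tm k)
  | .inl k => S k
  | .inr _ => []

variable [DecidableEq Own] [DecidableEq ι]

/-- `M` takes the stacks `S` of the program to `S'`, the subroutines being at rest before and
after. -/
def PRuns (M : Frag (AllStacks Own tm) (AllSyms Γ tm)) (S S' : ∀ k, List (Γ k)) (t : ℕ) : Prop :=
  M.Runs (full tm S) (full tm S') t

/-- A fragment that works on the stacks of the program only. -/
abbrev own (M : Frag Own Γ) : Frag (AllStacks Own tm) (AllSyms Γ tm) :=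
  Frag.lift (Γ := AllSyms Γ tm) (Sum.inl : Own → AllStacks Own tm) M

theorem pRuns_own {M : Frag Own Γ} {S S' : ∀ k, List (Γ k)} {t : ℕ} (h : M.Runs S S' t) :
    PRuns tm (own tm M) S S' t := by
  refine h.lift Sum.inl_injective (fun _ => rfl) (fun _ => rfl) ?_
  rintro (k | p) hk
  · exact (hk ⟨k, rfl⟩).elim
  · rfl

/-- Apply the machine `tm i` to the reversed content of the stack `a`, and move the output to the
stack `b`; `ia` and `ob` translate the symbols. -/
def call (i : ι) (a b : Own) [Finite (Γ a)] [Finite ((tm i).Γ (tm i).k₁)]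
    (ia : Γ a → (tm i).Γ (tm i).k₀) (ob : (tm i).Γ (tm i).k₁ → Γ b) :
    Frag (AllStacks Own tm) (AllSyms Γ tm) :=
  (@Frag.drain _ (AllSyms Γ tm) (.inl a) ‹Finite (Γ a)›
    fun x => [⟨.inr ⟨i, (tm i).k₀⟩, ia x⟩]).seq <|
  (Frag.lift (Γ := AllSyms Γ tm) (fun k => .inr ⟨i, k⟩) (ofTM (tm i))).seq <|
  (@Frag.drain _ (AllSyms Γ tm) (.inr ⟨i, (tm i).k₁⟩) ‹Finite ((tm i).Γ (tm i).k₁)›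
    fun y => [⟨.inl b, ob y⟩])

theorem select_cons_self {K : Type} {Γ : K → Type} [DecidableEq K] (k : K) (x : Γ k)
    (ps : List (Σ k, Γ k)) : select k (⟨k, x⟩ :: ps) = x :: select k ps := by
  simp [select]

theorem select_cons_ne {K : Type} {Γ : K → Type} [DecidableEq K] {k k' : K} (h : k' ≠ k)
    (x : Γ k') (ps : List (Σ k, Γ k)) : select k (⟨k', x⟩ :: ps) = select k ps := by
  simp [select, h]

/-- A call takes the running time of the machine, and the time to move its input and output.  The
machine leaves its own stacks empty, so that it can be called again. -/
theorem pRuns_call (i : ι) (a b : Own) (hab : a ≠ b) [Finite (Γ a)]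
    [Finite ((tm i).Γ (tm i).k₁)] (ia : Γ a → (tm i).Γ (tm i).k₀)
    (ob : (tm i).Γ (tm i).k₁ → Γ b) (S : ∀ k, List (Γ k)) {s : List ((tm i).Γ (tm i).k₀)}
    {s' : List ((tm i).Γ (tm i).k₁)} {t : ℕ} (h : TM2OutputsInTime (tm i) s (some s') t)
    (hs : (S a).reverse.map ia = s) :
    PRuns tm (call tm i a b ia ob) S
      (Function.update (Function.update S a []) b ((s'.map ob).reverse ++ S b))
      (2 * s.length + 1 + (t + (2 * s'.length + 1))) := by
  have hinj : Function.Injective (fun k : (tm i).K => (Sum.inr ⟨i, k⟩ : AllStacks Own tm)) := by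
    intro k k' h
    simpa using h
  -- the stacks while the machine is started, and after it has halted
  let S₁ : ∀ k, List (AllSyms Γ tm k) := Function.update (full tm (Function.update S a []))
    (.inr ⟨i, (tm i).k₀⟩) s
  let S₂ : ∀ k, List (AllSyms Γ tm k) := Function.update (full tm (Function.update S a []))
    (.inr ⟨i, (tm i).k₁⟩) s'
  have hlen : s.length = (S a).length := by simp [← hs]
  unfold PRuns call
  refine Frag.Runs.seq (S' := S₁) ?_ (Frag.Runs.seq (S' := S₂) ?_ ?_)
  · have h := @Frag.runs_drain _ (AllSyms Γ tm) _ (.inl a) ‹Finite (Γ a)›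
      (fun x => [⟨.inr ⟨i, (tm i).k₀⟩, ia x⟩]) (by simp) (full tm S)
    rw [hlen]
    change Frag.Runs _ _ _ (2 * (S a).length + 1) at h
    convert h using 1
    funext k
    rw [pushAll_apply, select_flatMap]
    rcases k with k | ⟨j, k⟩
    · rw [List.flatMap_eq_nil_iff.2 (by intro x _; rw [select_cons_ne (by simp)]; rfl)]
      simp only [S₁, ne_eq, reduceCtorEq, not_false_eq_true, Function.update_of_ne, full,
        List.reverse_nil, List.nil_append]
      by_cases hk : k = a
      · subst hk; simp
      · rw [Function.update_of_ne hk, Function.update_of_ne (by simpa using hk)]; rfl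
    · rw [Function.update_of_ne (by simp)]
      by_cases hk : (⟨j, k⟩ : Σ i, (tm i).K) = ⟨i, (tm i).k₀⟩
      · cases hk
        simp only [S₁, Function.update_self, full, List.append_nil]
        rw [← hs]
        simp only [select_cons_self, select_nil]
        rw [← List.map_eq_flatMap, List.map_reverse]
      · simp only [S₁]
        rw [Function.update_of_ne (by simpa using hk),
          List.flatMap_eq_nil_iff.2 (by
            intro x _
            rw [select_cons_ne fun h => hk (Sum.inr_injective h).symm]; rfl)]
        simp [full]
  · refine (runs_of_outputs h).lift hinj ?_ ?_ ?_
    · intro k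
      by_cases hk : k = (tm i).k₀
      · subst hk; simp [S₁]
      · simp only [S₁]
        rw [Function.update_of_ne (by simpa using hk), Function.update_of_ne hk]; rfl
    · intro k
      by_cases hk : k = (tm i).k₁
      · subst hk; simp [S₂]
      · simp only [S₂]
        rw [Function.update_of_ne (by simpa using hk), Function.update_of_ne hk]; rfl
    · intro k hk
      simp only [S₁, S₂]
      rw [Function.update_of_ne (fun h => hk ⟨_, h.symm⟩),
        Function.update_of_ne (fun h => hk ⟨_, h.symm⟩)]
  · have h := @Frag.runs_drain _ (AllSyms Γ tm) _ (.inr ⟨i, (tm i).k₁⟩)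
      ‹Finite ((tm i).Γ (tm i).k₁)› (fun y => [⟨.inl b, ob y⟩]) (by simp) S₂
    have h₂ : S₂ (.inr ⟨i, (tm i).k₁⟩) = s' := by simp [S₂]
    rw [h₂] at h
    convert h using 1
    funext k
    rw [pushAll_apply, select_flatMap]
    rcases k with k | p
    · rw [Function.update_of_ne (by simp)]
      by_cases hk : k = b
      · subst hk
        simp only [full, Function.update_self, select_cons_self, select_nil, S₂, ne_eq,
          reduceCtorEq, not_false_eq_true, Function.update_of_ne, Ne.symm hab]
        rw [← List.map_eq_flatMap]
      · rw [List.flatMap_eq_nil_iff.2 (by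
            intro x _
            rw [select_cons_ne fun h => hk (Sum.inl_injective h).symm]; rfl)]
        simp only [full, ne_eq, hk, not_false_eq_true, Function.update_of_ne, S₂, reduceCtorEq,
          List.reverse_nil, List.nil_append]
    · rw [List.flatMap_eq_nil_iff.2 (by intro x _; rw [select_cons_ne (by simp)]; rfl)]
      by_cases hk : p = ⟨i, (tm i).k₁⟩
      · subst hk; simp [full]
      · rw [Function.update_of_ne (by simpa using hk)]
        simp only [S₂]
        rw [Function.update_of_ne (by simpa using hk)]
        simp [full]

/-- Polynomial-time computability of a function between words. -/
def PTime {α β A B : Type} (ea : α → List A) (eb : β → List B) (f : α → β) : Prop :=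
  Nonempty (TM2ComputableInPolyTime ea eb f)

/-- A fragment with a polynomial time bound that replaces the input on the stack `a` by the output
on the stack `b`, all other stacks being empty before and after, is a polynomial-time machine. -/
theorem PTime.of_runs [Finite Own] [Finite ι] {α β : Type} (a b : Own) [Finite (Γ a)]
    {ea : α → List (Γ a)} {eb : β → List (Γ b)} {f : α → β}
    (M : Frag (AllStacks Own tm) (AllSyms Γ tm)) {t : ℕ → ℕ} (ht : PolyBdd t)
    (hM : ∀ x, PRuns tm M (Function.update (fun _ => []) a (ea x))
      (Function.update (fun _ => []) b (eb (f x))) (t (ea x).length)) : PTime ea eb f := by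
  classical
  obtain ⟨p, hp⟩ := ht
  have hK : ∀ i, Finite (tm i).K := fun i => @Finite.of_fintype _ (tm i).kFin
  let T : FinTM2 :=
    { K := AllStacks Own tm
      kDecidableEq := inferInstance
      kFin := Fintype.ofFinite _
      k₀ := .inl a
      k₁ := .inl b
      Γ := AllSyms Γ tm
      Λ := M.Λ
      main := M.main
      ΛFin := Fintype.ofFinite _
      σ := M.σ
      initialState := M.init
      σFin := Fintype.ofFinite _
      Γk₀Fin := @Fintype.ofFinite (Γ a) _
      m := M.code }
  have hfull : ∀ (k : Own) (l : List (Γ k)), full tm (Function.update (fun _ => []) k l)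
      = Function.update (β := fun k => List (AllSyms Γ tm k)) (fun _ => []) (.inl k) l := by
    intro k l
    funext k'
    rcases k' with k' | p
    · by_cases hk : k' = k
      · subst hk; simp [full]
      · rw [Function.update_of_ne (by simpa using hk)]
        simp [full, Function.update_of_ne hk]
    · simp [full]
  refine ⟨{ tm := T, inputAlphabet := Equiv.refl _, outputAlphabet := Equiv.refl _, time := p,
            outputsFun := fun x => ?_ }⟩
  have := hM x
  unfold PRuns at this
  rw [hfull, hfull] at this
  refine ⟨⟨this.choose, ?_⟩, this.choose_spec.1.trans (hp _)⟩
  have h' := steps_iff_iterate.1 this.choose_spec.2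
  rw [initList_eq]
  simp only [Option.map_some, haltList_eq]
  rw [show List.map (Equiv.refl _).invFun (ea x) = ea x from List.map_id _,
    show List.map (Equiv.refl _).invFun (eb (f x)) = eb (f x) from List.map_id _]
  exact h'

theorem PTime.length_le {α β A B : Type} {ea : α → List A} {eb : β → List B} {f : α → β}
    (h : PTime ea eb f) :
    ∃ t, PolyBdd t ∧ Monotone t ∧ ∀ x, (eb (f x)).length ≤ t (ea x).length := by
  obtain ⟨h⟩ := h
  obtain ⟨C, hC⟩ := length_output_le h.tm
  refine ⟨fun n => n + h.time.eval n * C,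
    .add .id (.mul (.eval _) (.const _)), fun m n hmn => ?_, fun x => ?_⟩
  · have := Nat.mul_le_mul_right C (eval_mono_nat h.time hmn)
    simp only; omega
  · simpa using hC _ _ _ (h.outputsFun x)

end Calls

/-! ### Closure properties of polynomial-time functions -/

/-- Names for the stacks of the programs below: `i` holds the input and `o` the output. -/
inductive Stack : Type
  | i | o | p | q | r | u | v | w
  deriving DecidableEq

instance : Finite Stack :=
  Finite.of_injective (β := Fin 8) (fun s => match s with
    | .i => 0 | .o => 1 | .p => 2 | .q => 3 | .r => 4 | .u => 5 | .v => 6 | .w => 7) (by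
    rintro (_ | _ | _ | _ | _ | _ | _ | _) (_ | _ | _ | _ | _ | _ | _ | _) <;> simp)

section Programs

variable {I O P Q R U V W : Type}

/-- The alphabets of the stacks. -/
abbrev Stack.alph (I O P Q R U V W : Type) : Stack → Type
  | .i => I | .o => O | .p => P | .q => Q | .r => R | .u => U | .v => V | .w => W

/-- The contents of all stacks, one after the other. -/
def Stack.fill (i : List I) (o : List O) (p : List P) (q : List Q) (r : List R) (u : List U)
    (v : List V) (w : List W) : ∀ k, List (Stack.alph I O P Q R U V W k)
  | .i => i | .o => o | .p => p | .q => q | .r => r | .u => u | .v => v | .w => w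

open Stack

instance [Finite I] [Finite O] [Finite P] [Finite Q] [Finite R] [Finite U] [Finite V] [Finite W] :
    ∀ k, Finite (alph I O P Q R U V W k) := by
  rintro (_ | _ | _ | _ | _ | _ | _ | _) <;> assumption

theorem PTime.of_fill [Finite I] {ι : Type} [DecidableEq ι] [Finite ι] {tm : ι → FinTM2}
    {α β : Type} {ea : α → List I} {eb : β → List O} {f : α → β}
    (M : Frag (AllStacks Stack tm) (AllSyms (alph I O P Q R U V W) tm)) {t : ℕ → ℕ}
    (ht : PolyBdd t)
    (hM : ∀ x, PRuns tm M (fill (ea x) [] [] [] [] [] [] []) (fill [] (eb (f x)) [] [] [] [] [] [])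
      (t (ea x).length)) : PTime ea eb f := by
  have : Finite (alph I O P Q R U V W .i) := ‹Finite I›
  refine PTime.of_runs (Γ := alph I O P Q R U V W) tm .i .o M ht fun x => ?_
  convert hM x using 1 <;> funext k <;> cases k <;> simp [fill]

theorem pRuns_drain {Own : Type} [DecidableEq Own] {Γ : Own → Type} {ι : Type} [DecidableEq ι]
    {tm : ι → FinTM2} (a : Own) [Finite (Γ a)] (out : Γ a → List (Σ k, Γ k))
    (hout : ∀ x, ∀ p ∈ out x, p.1 ≠ a) {S S' : ∀ k, List (Γ k)}
    (hS' : ∀ k, S' k = (select k ((S a).flatMap out)).reverse ++ Function.update S a [] k) :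
    PRuns tm (own tm (.drain a out)) S S' (2 * (S a).length + 1) := by
  have h := pRuns_own tm (Frag.runs_drain a out hout S)
  convert h using 1
  funext k
  rw [hS', pushAll_apply]

theorem PRuns.seq {Own : Type} [DecidableEq Own] {Γ : Own → Type} {ι : Type} [DecidableEq ι]
    {tm : ι → FinTM2} {M N : Frag (AllStacks Own tm) (AllSyms Γ tm)} {S S' S'' : ∀ k, List (Γ k)}
    {t t' : ℕ} (h : PRuns tm M S S' t) (h' : PRuns tm N S' S'' t') :
    PRuns tm (M.seq N) S S'' (t + t') := Frag.Runs.seq h h'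

/-- A call of a machine that computes `f`, in terms of the represented words. -/
theorem pRuns_call_of {Own : Type} [DecidableEq Own] {Γ : Own → Type} {ι : Type} [DecidableEq ι]
    {tm : ι → FinTM2} {α β A B : Type} {ea : α → List A} {eb : β → List B} {f : α → β}
    (h : TM2ComputableInPolyTime ea eb f) (i : ι) (hi : tm i = h.tm) (a b : Own) (hab : a ≠ b)
    [Finite (Γ a)] [Finite B] (ia : Γ a → A) (ob : B → Γ b) :
    ∃ M : Frag (AllStacks Own tm) (AllSyms Γ tm), ∀ (S S' : ∀ k, List (Γ k)) (x : α),
      (S a).reverse.map ia = ea x →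
      (∀ k, S' k = Function.update (Function.update S a []) b
        (((eb (f x)).map ob).reverse ++ S b) k) →
      PRuns tm M S S' (2 * (ea x).length + 1 +
        (h.time.eval (ea x).length + (2 * (eb (f x)).length + 1))) := by
  obtain ⟨⟨T, eA, eB⟩, time, hf⟩ := h
  simp only at hi
  subst hi
  have : Finite ((tm i).Γ (tm i).k₁) := Finite.of_equiv _ eB.symm
  refine ⟨call tm i a b (eA.symm ∘ ia) (ob ∘ eB), fun S S' x hS hS' => ?_⟩
  have := pRuns_call tm i a b hab (eA.symm ∘ ia) (ob ∘ eB) S (hf x)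
    (by rw [← hS, List.map_map]; rfl)
  rw [funext hS']
  convert this using 1
  · have : ob ∘ eB ∘ eB.invFun = ob := by
      funext y; simp
    simp only [List.map_map, Function.comp_assoc, this]
  · simp

variable {α β γ A B C : Type}

theorem PTime.comp {ea : α → List A} {eb : β → List B} {ec : γ → List C} [Finite A] [Finite B]
    [Finite C] {g : β → γ} {f : α → β} (hg : PTime eb ec g) (hf : PTime ea eb f) :
    PTime ea ec (g ∘ f) := by
  obtain ⟨tb, htb, -, hlb⟩ := hf.length_le
  obtain ⟨tc, htc, hmc, hlc⟩ := hg.length_le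
  obtain ⟨hg⟩ := hg
  obtain ⟨hf⟩ := hf
  let tm : Bool → FinTM2 := fun b => bif b then hg.tm else hf.tm
  let Γ := alph A C A PUnit C B PUnit PUnit
  obtain ⟨M₁, hM₁⟩ := pRuns_call_of (Γ := Γ) (tm := tm) hf false rfl .p .u (by simp) id id
  obtain ⟨M₂, hM₂⟩ := pRuns_call_of (Γ := Γ) (tm := tm) hg true rfl .u .r (by simp) id id
  refine PTime.of_fill (t := fun n => (2 * n + 1) + ((2 * n + 1 + (hf.time.eval n + (2 * tb n + 1)))
      + ((2 * tb n + 1 + (hg.time.eval (tb n) + (2 * tc (tb n) + 1))) + (2 * tc (tb n) + 1))))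
    (((own tm (Frag.drain (Γ := Γ) .i fun x => [⟨.p, x⟩]))).seq <| M₁.seq <| M₂.seq <|
      own tm (Frag.drain (Γ := Γ) .r fun x => [⟨.o, x⟩])) ?_ fun x => ?_
  · fun_prop
  · have l₁ : (eb (f x)).length ≤ tb (ea x).length := hlb x
    have l₂ : (ec (g (f x))).length ≤ tc (tb (ea x).length) :=
      (hlc _).trans (hmc l₁)
    have l₃ := eval_mono_nat hg.time l₁
    refine Frag.Runs.mono
      (PRuns.seq (S' := fill [] [] (ea x).reverse [] [] [] [] []) (pRuns_drain _ _ ?_ ?_) <|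
      PRuns.seq (S' := fill [] [] [] [] [] (eb (f x)).reverse [] []) (hM₁ _ _ x ?_ ?_) <|
      PRuns.seq (S' := fill [] [] [] [] (ec (g (f x))).reverse [] [] []) (hM₂ _ _ (f x) ?_ ?_) <|
      pRuns_drain _ _ ?_ ?_) ?_
    · simp
    · rintro (_ | _ | _ | _ | _ | _ | _ | _) <;>
        simp [fill, select_flatMap, select_cons_self, select_cons_ne]
    · simp [fill]
    · rintro (_ | _ | _ | _ | _ | _ | _ | _) <;> simp [fill]
    · simp [fill]
    · rintro (_ | _ | _ | _ | _ | _ | _ | _) <;> simp [fill]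
    · simp
    · rintro (_ | _ | _ | _ | _ | _ | _ | _) <;>
        simp [fill, select_flatMap, select_cons_self, select_cons_ne]
    · simp only [fill, List.length_reverse]
      omega

/-- Only the words for the values of the function matter. -/
theorem PTime.congr {β' : Type} {ea : α → List A} {eb : β → List B} {eb' : β' → List B}
    {f : α → β} {f' : α → β'} (h : PTime ea eb f) (hf : ∀ x, eb (f x) = eb' (f' x)) :
    PTime ea eb' f' :=
  let ⟨h⟩ := h
  ⟨⟨h.toTM2ComputableAux, h.time, fun x => hf x ▸ h.outputsFun x⟩⟩

/-- The word for a pair: the words of the components, over the disjoint union of the alphabets. -/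
def pairWord (ea : α → List A) (eb : β → List B) (x : α × β) : List (A ⊕ B) :=
  (ea x.1).map .inl ++ (eb x.2).map .inr

theorem PTime.pair {ea : α → List A} {eb : β → List B} {ec : γ → List C} [Finite A] [Finite B]
    [Finite C] {f : α → β} {g : α → γ} (hf : PTime ea eb f) (hg : PTime ea ec g) :
    PTime ea (pairWord eb ec) fun x => (f x, g x) := by
  obtain ⟨tb, htb, -, hlb⟩ := hf.length_le
  obtain ⟨tc, htc, -, hlc⟩ := hg.length_le
  obtain ⟨hg⟩ := hg
  obtain ⟨hf⟩ := hf
  let tm : Bool → FinTM2 := fun b => bif b then hg.tm else hf.tm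
  let Γ := alph A (B ⊕ C) A A C B PUnit PUnit
  obtain ⟨M₁, hM₁⟩ := pRuns_call_of (Γ := Γ) (tm := tm) hf false rfl .p .u (by simp) id id
  obtain ⟨M₂, hM₂⟩ := pRuns_call_of (Γ := Γ) (tm := tm) hg true rfl .q .r (by simp) id id
  refine PTime.of_fill (t := fun n => (2 * n + 1) + ((2 * n + 1 + (hf.time.eval n + (2 * tb n + 1)))
      + ((2 * n + 1 + (hg.time.eval n + (2 * tc n + 1))) + ((2 * tc n + 1) + (2 * tb n + 1)))))
    (((own tm (Frag.drain (Γ := Γ) .i fun x => [⟨.p, x⟩, ⟨.q, x⟩]))).seq <| M₁.seq <| M₂.seq <|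
      (own tm (Frag.drain (Γ := Γ) .r fun x => [⟨.o, .inr x⟩])).seq <|
      own tm (Frag.drain (Γ := Γ) .u fun x => [⟨.o, .inl x⟩])) (by fun_prop) fun x => ?_
  have l₁ : (eb (f x)).length ≤ tb (ea x).length := hlb x
  have l₂ : (ec (g x)).length ≤ tc (ea x).length := hlc x
  refine Frag.Runs.mono
    (PRuns.seq (S' := fill [] [] (ea x).reverse (ea x).reverse [] [] [] [])
      (pRuns_drain _ _ ?_ ?_) <|
    PRuns.seq (S' := fill [] [] [] (ea x).reverse [] (eb (f x)).reverse [] []) (hM₁ _ _ x ?_ ?_) <|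
    PRuns.seq (S' := fill [] [] [] [] (ec (g x)).reverse (eb (f x)).reverse [] [])
      (hM₂ _ _ x ?_ ?_) <|
    PRuns.seq (S' := fill [] ((ec (g x)).map .inr) [] [] [] (eb (f x)).reverse [] [])
      (pRuns_drain _ _ ?_ ?_) <| pRuns_drain _ _ ?_ ?_) ?_
  · simp
  · rintro (_ | _ | _ | _ | _ | _ | _ | _) <;>
      simp [fill, select_flatMap, select_cons_self, select_cons_ne]
  · simp [fill]
  · rintro (_ | _ | _ | _ | _ | _ | _ | _) <;> simp [fill]
  · simp [fill]
  · rintro (_ | _ | _ | _ | _ | _ | _ | _) <;> simp [fill]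
  · simp
  · rintro (_ | _ | _ | _ | _ | _ | _ | _) <;>
      simp [fill, select_flatMap, select_cons_self, select_cons_ne, ← List.map_eq_flatMap]
  · simp
  · rintro (_ | _ | _ | _ | _ | _ | _ | _) <;>
      simp [fill, select_flatMap, select_cons_self, select_cons_ne, ← List.map_eq_flatMap, pairWord]
  · simp only [fill, List.length_reverse]
    omega

/-- The output of a finite automaton with output on a word. -/
def transduce {S : Type} (next : S → A → S) (out : S → A → List B) (fin : S → List B) :
    S → List A → List B
  | s, [] => fin s
  | s, x :: l => out s x ++ transduce next out fin (next s x) l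

theorem scanResult_eq_transduce {S X : Type} (next : S → A → S) (out : S → A → List B)
    (fin : S → List B) (g : B → X) (s : S) (l : List A) :
    scanResult next (fun s x => (out s x).map g) (fun _ => false) (fun s => (fin s).map g) s l
      = ((transduce next out fin s l).map g, []) := by
  induction l generalizing s with
  | nil => rfl
  | cons x l ih => simp [scanResult, ih, transduce]

theorem pRuns_transduce {Own : Type} [DecidableEq Own] {Γ : Own → Type} {ι : Type} [DecidableEq ι]
    {tm : ι → FinTM2} (a b : Own) (hab : b ≠ a) [Finite (Γ a)] {X : Type} [Finite X]
    (next : X → Γ a → X) (out : X → Γ a → List (Γ b)) (fin : X → List (Γ b)) (x₀ : X) :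
    ∃ M : Frag (AllStacks Own tm) (AllSyms Γ tm), ∀ S S' : ∀ k, List (Γ k),
      (∀ k, S' k = Function.update (Function.update S a []) b
        ((transduce next out fin x₀ (S a)).reverse ++ S b) k) →
      PRuns tm M S S' (2 * (S a).length + 1) := by
  refine ⟨own tm (.scan a x₀ next (fun s x => (out s x).map fun y => ⟨b, y⟩) (fun _ => false)
    fun s => (fin s).map fun y => ⟨b, y⟩), fun S S' hS' => ?_⟩
  have h := pRuns_own tm (Frag.runs_scan a x₀ next
    (fun s x => (out s x).map fun y => (⟨b, y⟩ : Σ k, Γ k)) (fun _ => false)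
    (fun s => (fin s).map fun y => ⟨b, y⟩) (by simp [hab]) S)
  convert h using 1
  funext k
  rw [hS', scanResult_eq_transduce, pushAll_apply]
  by_cases hk : k = b
  · subst hk
    rw [select_map_self]; simp [hab]
  · rw [select_map_of_ne (Ne.symm hk)]; simp [hk]

/-- Finite automata with output run in polynomial time. -/
theorem PTime.of_transduce [Finite A] [Finite B] {X : Type} [Finite X] {ea : α → List A}
    {eb : β → List B} {f : α → β} (next : X → A → X) (out : X → A → List B) (fin : X → List B)
    (x₀ : X) (h : ∀ x, eb (f x) = transduce next out fin x₀ (ea x)) : PTime ea eb f := by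
  obtain ⟨t, ht, hl⟩ : ∃ t, PolyBdd t ∧ ∀ x, (eb (f x)).length ≤ t (ea x).length := by
    obtain ⟨c, hc⟩ : ∃ c, ∀ s x, (out s x).length ≤ c := by
      obtain ⟨c, hc⟩ := (Set.finite_range fun p : X × A => (out p.1 p.2).length).bddAbove
      exact ⟨c, fun s x => hc ⟨(s, x), rfl⟩⟩
    obtain ⟨c', hc'⟩ : ∃ c, ∀ s, (fin s).length ≤ c := by
      obtain ⟨c, hc⟩ := (Set.finite_range fun s : X => (fin s).length).bddAbove
      exact ⟨c, fun s => hc ⟨s, rfl⟩⟩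
    refine ⟨fun n => n * c + c', by fun_prop, fun x => ?_⟩
    rw [h]
    suffices H : ∀ l s, (transduce next out fin s l).length ≤ l.length * c + c' from H _ _
    intro l
    induction l with
    | nil => simpa [transduce] using hc'
    | cons z l ih =>
      intro s
      have := ih (next s z)
      have := hc s z
      simp only [transduce, List.length_append, List.length_cons, add_mul]
      omega
  let tm : Empty → FinTM2 := fun b => b.elim
  let Γ := alph A B PUnit PUnit PUnit B PUnit PUnit
  obtain ⟨M₁, hM₁⟩ := pRuns_transduce (Γ := Γ) (tm := tm) .i .u (by simp) next out fin x₀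
  refine PTime.of_fill (t := fun n => (2 * n + 1) + (2 * t n + 1))
    (M₁.seq <| own tm (Frag.drain (Γ := Γ) .u fun x => [⟨.o, x⟩])) (by fun_prop) fun x => ?_
  have := hl x
  refine Frag.Runs.mono
    (PRuns.seq (S' := fill [] [] [] [] [] (eb (f x)).reverse [] []) (hM₁ _ _ ?_) <|
      pRuns_drain _ _ ?_ ?_) ?_
  · rintro (_ | _ | _ | _ | _ | _ | _ | _) <;> simp [fill, h]
  · simp
  · rintro (_ | _ | _ | _ | _ | _ | _ | _) <;>
      simp [fill, select_flatMap, select_cons_self, select_cons_ne]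
  · simp only [fill, List.length_reverse]
    omega

/-- The variant of `PTime.of_transduce` in which the word is read from right to left. -/
theorem PTime.of_transduce_reverse [Finite A] [Finite B] {X : Type} [Finite X] {ea : α → List A}
    {eb : β → List B} {f : α → β} (next : X → A → X) (out : X → A → List B) (fin : X → List B)
    (x₀ : X) (h : ∀ x, eb (f x) = (transduce next out fin x₀ (ea x).reverse).reverse) :
    PTime ea eb f := by
  let tm : Empty → FinTM2 := fun b => b.elim
  let Γ := alph A B A PUnit PUnit PUnit PUnit PUnit
  obtain ⟨M₁, hM₁⟩ := pRuns_transduce (Γ := Γ) (tm := tm) .p .o (by simp) next out fin x₀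
  refine PTime.of_fill (t := fun n => (2 * n + 1) + (2 * n + 1))
    ((own tm (Frag.drain (Γ := Γ) .i fun x => [⟨.p, x⟩])).seq M₁) (by fun_prop) fun x => ?_
  refine Frag.Runs.mono
    (PRuns.seq (S' := fill [] [] (ea x).reverse [] [] [] [] []) (pRuns_drain _ _ ?_ ?_) <|
      hM₁ _ _ ?_) ?_
  · simp
  · rintro (_ | _ | _ | _ | _ | _ | _ | _) <;>
      simp [fill, select_flatMap, select_cons_self, select_cons_ne]
  · rintro (_ | _ | _ | _ | _ | _ | _ | _) <;> simp [fill, h]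
  · simp only [fill, List.length_reverse, le_refl]

/-- The word for a list: the words of its elements, each followed by the separator `none`. -/
def listWord (ea : α → List A) (l : List α) : List (Option A) :=
  l.flatMap fun x => (ea x).map some ++ [none]

theorem scanResult_listWord {X : Type} (g : A → X) (l : List A) (rest : List (Option A)) :
    scanResult (fun _ x => x.isNone) (fun _ x => x.toList.map g) id (fun _ => []) false
      (l.map some ++ none :: rest) = (l.map g, rest) := by
  induction l with
  | nil => cases rest <;> simp [scanResult]
  | cons x l ih => simp [scanResult, ih]

/-- Iteration of a polynomial-time function along a list, with a parameter: it is polynomial-time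
computable when the words for the intermediate values stay polynomially bounded. -/
theorem PTime.foldl {δ : Type} {ec : γ → List C} {eb : β → List B} {ea : α → List A} [Finite A]
    [Finite B] [Finite C] {step : γ × β × α → β} (h : PTime (pairWord ec (pairWord eb ea)) eb step)
    (c : δ → γ) (b : δ → β) (l : δ → List α) {t : ℕ → ℕ} (ht : PolyBdd t)
    (hbound : ∀ x l', l' <+: l x → (eb (l'.foldl (fun b a => step (c x, b, a)) (b x))).length ≤
      t (pairWord ec (pairWord eb (listWord ea)) (c x, b x, l x)).length) :
    PTime (fun x => pairWord ec (pairWord eb (listWord ea)) (c x, b x, l x)) eb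
      (fun x => (l x).foldl (fun b a => step (c x, b, a)) (b x)) := by
  obtain ⟨h⟩ := h
  let tm : Unit → FinTM2 := fun _ => h.tm
  let Γ := alph (C ⊕ B ⊕ Option A) B (C ⊕ B ⊕ Option A) C C B (C ⊕ B ⊕ A) (Option A)
  obtain ⟨M, hM⟩ := pRuns_call_of (Γ := Γ) (tm := tm) h () rfl .v .u (by simp) id id
  let body : Frag (AllStacks Stack tm) (AllSyms Γ tm) :=
    (own tm (Frag.drain (Γ := Γ) .q fun x => [⟨.v, .inl x⟩, ⟨.r, x⟩])).seq <|
    (own tm (Frag.drain (Γ := Γ) .r fun x => [⟨.q, x⟩])).seq <|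
    (own tm (Frag.drain (Γ := Γ) .o fun x => [⟨.v, .inr (.inl x)⟩])).seq <|
    (own tm (Frag.scan (Γ := Γ) .w false (fun _ x => x.isNone)
      (fun _ x => x.toList.map fun x => ⟨.v, .inr (.inr x)⟩) id (fun _ => []))).seq <|
    M.seq <| own tm (Frag.drain (Γ := Γ) .u fun x => [⟨.o, x⟩])
  have hbody : ∀ (c : γ) (b : β) (a : α) (rest : List (Option A)) (n s : ℕ),
      (eb (step (c, b, a))).length ≤ s → (ec c).length ≤ n → (eb b).length ≤ s →
      (ea a).length + rest.length + 1 ≤ n →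
      PRuns tm body (fill [] (eb b) [] (ec c) [] [] [] ((ea a).map some ++ none :: rest))
        (fill [] (eb (step (c, b, a))) [] (ec c) [] [] [] rest)
        (h.time.eval (2 * n + s) + (12 * n + 8 * s + 10)) := by
    intro c b a rest n s h₁ h₂ h₃ h₄
    refine Frag.Runs.mono (PRuns.seq (S' := fill [] (eb b) [] [] (ec c).reverse []
        ((ec c).map Sum.inl).reverse ((ea a).map some ++ none :: rest)) (pRuns_drain _ _ ?_ ?_) <|
      PRuns.seq (S' := fill [] (eb b) [] (ec c) [] []
        ((ec c).map Sum.inl).reverse ((ea a).map some ++ none :: rest)) (pRuns_drain _ _ ?_ ?_) <|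
      PRuns.seq (S' := fill [] [] [] (ec c) [] []
        ((ec c).map Sum.inl ++ (eb b).map fun x => Sum.inr (Sum.inl x)).reverse
        ((ea a).map some ++ none :: rest)) (pRuns_drain _ _ ?_ ?_) <|
      PRuns.seq (S' := fill [] [] [] (ec c) [] []
        (pairWord ec (pairWord eb ea) (c, b, a)).reverse rest)
        (t := 2 * ((ea a).map some ++ none :: rest).length + 1) (pRuns_own tm ?_)  <|
      PRuns.seq (S' := fill [] [] [] (ec c) [] (eb (step (c, b, a))).reverse [] rest)
        (hM _ _ (c, b, a) ?_ ?_) <|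
      pRuns_drain _ _ ?_ ?_) ?_
    · simp
    · rintro (_ | _ | _ | _ | _ | _ | _ | _) <;>
        simp [fill, select_flatMap, select_cons_self, select_cons_ne, ← List.map_eq_flatMap]
    · simp
    · rintro (_ | _ | _ | _ | _ | _ | _ | _) <;>
        simp [fill, select_flatMap, select_cons_self, select_cons_ne]
    · simp
    · rintro (_ | _ | _ | _ | _ | _ | _ | _) <;>
        simp [fill, select_flatMap, select_cons_self, select_cons_ne, ← List.map_eq_flatMap]
    · have hr := Frag.runs_scan (Γ := Γ) .w false (fun _ x => x.isNone)
        (fun _ x => x.toList.map fun x => ⟨.v, .inr (.inr x)⟩) id (fun _ => []) (by simp)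
        (fill [] [] [] (ec c) [] []
        ((ec c).map Sum.inl ++ (eb b).map fun x => Sum.inr (Sum.inl x)).reverse
        ((ea a).map some ++ none :: rest))
      simp only [fill] at hr
      rw [scanResult_listWord (fun x => (⟨.v, .inr (.inr x)⟩ : Σ k, Γ k))] at hr
      convert hr using 1
      funext k
      rw [pushAll_apply]
      revert k
      rintro (_ | _ | _ | _ | _ | _ | _ | _)
      case v => rw [select_map_self (Γ := Γ) .v]; simp [fill, pairWord, Function.comp_def]
      all_goals rw [select_map_of_ne (by simp)]; simp [fill]
    · simp [fill]
    · rintro (_ | _ | _ | _ | _ | _ | _ | _) <;> simp [fill]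
    · simp
    · rintro (_ | _ | _ | _ | _ | _ | _ | _) <;>
        simp [fill, select_flatMap, select_cons_self, select_cons_ne]
    · have hw : (pairWord ec (pairWord eb ea) (c, b, a)).length ≤ 2 * n + s := by
        simp [pairWord]; omega
      have := eval_mono_nat h.time hw
      simp only [fill, List.length_append, List.length_map, List.length_cons, List.length_reverse]
      omega
  have hloop : ∀ (c : γ) (l : List α) (b : β) (n s : ℕ),
      (∀ l', l' <+: l → (eb (l'.foldl (fun b a => step (c, b, a)) b)).length ≤ s) →
      (ec c).length ≤ n → (listWord ea l).length ≤ n →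
      PRuns tm (Frag.whileNE (Γ := AllSyms Γ tm) (.inl .w) body)
        (fill [] (eb b) [] (ec c) [] [] [] (listWord ea l))
        (fill [] (eb (l.foldl (fun b a => step (c, b, a)) b)) [] (ec c) [] [] [] [])
        ((listWord ea l).length * (h.time.eval (2 * n + s) + (12 * n + 8 * s + 10) + 1) + 1) := by
    intro c l
    induction l with
    | nil => intro b n s _ _ _; exact (Frag.Runs.while_nil rfl).mono (by simp)
    | cons a l ih =>
      intro b n s hs hc hl
      have hw : listWord ea (a :: l) = (ea a).map some ++ none :: listWord ea l := by
        simp [listWord]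
      rw [hw] at hl ⊢
      simp only [List.length_append, List.length_map, List.length_cons] at hl ⊢
      have h₁ := ih (step (c, b, a)) n s
        (fun l' hl' => hs (a :: l') (List.cons_prefix_cons.2 ⟨rfl, hl'⟩)) hc (by omega)
      have h₂ := hbody c b a (listWord ea l) n s
        (hs [a] (List.cons_prefix_cons.2 ⟨rfl, List.nil_prefix⟩)) hc (hs [] List.nil_prefix)
        (by omega)
      refine (Frag.Runs.while_cons (by simp [full, fill]) h₂ h₁).mono ?_
      have : 1 ≤ (ea a).length + 1 := by omega
      have := Nat.mul_le_mul_right (h.time.eval (2 * n + s) + (12 * n + 8 * s + 10) + 1) this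
      rw [show (ea a).length + ((listWord ea l).length + 1) =
        ((ea a).length + 1) + (listWord ea l).length by omega, add_mul]
      omega
  refine PTime.of_fill (t := fun n => (2 * n + 1) + ((2 * n + 1) +
    ((n * (h.time.eval (2 * n + t n) + (12 * n + 8 * t n + 10) + 1) + 1) + (2 * n + 1))))
    ((own tm (Frag.drain (Γ := Γ) .i fun x => [⟨.p, x⟩])).seq <|
    (own tm (Frag.drain (Γ := Γ) .p fun x => match x with
      | .inl x => [⟨.q, x⟩]
      | .inr (.inl x) => [⟨.o, x⟩]
      | .inr (.inr x) => [⟨.w, x⟩])).seq <|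
    (Frag.whileNE (Γ := AllSyms Γ tm) (.inl .w) body).seq <|
    own tm (Frag.drain (Γ := Γ) .q fun x => [])) (by fun_prop) fun x => ?_
  have hl : (listWord ea (l x)).length + (ec (c x)).length ≤
    (pairWord ec (pairWord eb (listWord ea)) (c x, b x, l x)).length := by
    simp [pairWord]; omega
  refine Frag.Runs.mono (PRuns.seq (S' := fill [] []
      (pairWord ec (pairWord eb (listWord ea)) (c x, b x, l x)).reverse [] [] [] [] [])
      (pRuns_drain _ _ ?_ ?_) <|
    PRuns.seq (S' := fill [] (eb (b x)) [] (ec (c x)) [] [] [] (listWord ea (l x)))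
      (pRuns_drain _ _ ?_ ?_) <|
    PRuns.seq (hloop (c x) (l x) (b x) (pairWord ec (pairWord eb (listWord ea))
      (c x, b x, l x)).length _ (hbound x) (by omega) (by omega)) <|
    pRuns_drain _ _ ?_ ?_) ?_
  · simp
  · rintro (_ | _ | _ | _ | _ | _ | _ | _) <;>
      simp [fill, select_flatMap, select_cons_self, select_cons_ne]
  · rintro (x | x | x) <;> simp
  · rintro (_ | _ | _ | _ | _ | _ | _ | _) <;>
      simp [fill, pairWord, ← List.map_reverse, List.flatMap_append, List.flatMap_map,
        select_append, select_flatMap, select_cons_self, select_cons_ne] <;>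
      first
      | rw [← List.map_eq_flatMap, List.map_id']
      | rw [List.flatMap_eq_nil_iff.2 fun _ _ => rfl, List.flatMap_eq_nil_iff.2 fun _ _ => rfl]
        first
        | rfl
        | exact (List.append_nil _).symm
  · simp
  · rintro (_ | _ | _ | _ | _ | _ | _ | _) <;> simp [fill, select_flatMap]
  · simp only [fill, List.length_reverse]
    have := Nat.mul_le_mul_right (h.time.eval (2 * (pairWord ec (pairWord eb (listWord ea))
      (c x, b x, l x)).length + t (pairWord ec (pairWord eb (listWord ea))
      (c x, b x, l x)).length) + (12 * (pairWord ec (pairWord eb (listWord ea))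
      (c x, b x, l x)).length + 8 * t (pairWord ec (pairWord eb (listWord ea))
      (c x, b x, l x)).length + 10) + 1) (Nat.le_of_add_right_le hl)
    omega

end Programs

/-! ### Polynomial-time functions between types of encoded data -/

section Typed

/-- Data written as words over a finite alphabet. -/
class Enc (α : Type) where
  Sym : Type
  finite_sym : Finite Sym
  word : α → List Sym

attribute [instance] Enc.finite_sym

open Enc

/-- A copy of `A` whose elements are written as words of one letter. -/
def Letter (A : Type) : Type := A

instance {A : Type} [Finite A] : Enc (Letter A) := ⟨A, inferInstance, fun a => [a]⟩

instance {α β : Type} [Enc α] [Enc β] : Enc (α × β) :=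
  ⟨Sym α ⊕ Sym β, inferInstance, pairWord word word⟩

instance {α : Type} [Enc α] : Enc (List α) := ⟨Option (Sym α), inferInstance, listWord word⟩

/-- Natural numbers are written in unary. -/
instance : Enc ℕ := ⟨Unit, inferInstance, fun n => List.replicate n ()⟩

variable {α β γ κ : Type} [Enc α] [Enc β] [Enc γ] [Enc κ]

/-- The length of the word for `a`. -/
def size (a : α) : ℕ := (word a).length

theorem word_prod (a : α) (b : β) : word (a, b) = (word a).map .inl ++ (word b).map .inr := rfl

theorem word_list (l : List α) : word l = l.flatMap fun x => (word x).map some ++ [none] := rfl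

@[simp] theorem word_nil : word ([] : List α) = [] := rfl

@[simp] theorem word_cons (a : α) (l : List α) :
    word (a :: l) = (word a).map some ++ none :: word l := by simp [word_list]

theorem word_append (l l' : List α) : word (l ++ l') = word l ++ word l' := by simp [word_list]

theorem word_nat (n : ℕ) : word n = List.replicate n () := rfl

@[simp] theorem size_prod (a : α) (b : β) : size (a, b) = size a + size b := by
  simp [size, word_prod]

@[simp] theorem size_nil : size ([] : List α) = 0 := rfl

@[simp] theorem size_cons (a : α) (l : List α) : size (a :: l) = size a + 1 + size l := by
  simp [size]; omega

@[simp] theorem size_append (l l' : List α) : size (l ++ l') = size l + size l' := by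
  simp [size, word_append]

@[simp] theorem size_nat (n : ℕ) : size n = n := by
  simp [size, word_nat]

theorem size_le_of_mem {a : α} {l : List α} (h : a ∈ l) : size a ≤ size l := by
  induction l with
  | nil => simp at h
  | cons b l ih =>
    rcases List.mem_cons.1 h with rfl | h
    · simp; omega
    · have := ih h; simp; omega

theorem length_le_size (l : List α) : l.length ≤ size l := by
  induction l with
  | nil => simp
  | cons b l ih => simp; omega

theorem size_le_of_prefix {l' l : List α} (h : l' <+: l) : size l' ≤ size l := by
  obtain ⟨r, rfl⟩ := h
  simp

/-- Polynomial-time computable functions between types of encoded data. -/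
@[fun_prop]
def PT (f : α → β) : Prop := PTime word word f

theorem PT.size_le {f : α → β} (h : PT f) :
    ∃ t, PolyBdd t ∧ Monotone t ∧ ∀ x, size (f x) ≤ t (size x) := PTime.length_le h

@[fun_prop]
theorem PT.comp {g : β → γ} {f : α → β} (hg : PT g) (hf : PT f) : PT fun x => g (f x) :=
  PTime.comp hg hf

@[fun_prop]
theorem PT.prodMk {f : α → β} {g : α → γ} (hf : PT f) (hg : PT g) : PT fun x => (f x, g x) :=
  PTime.pair hf hg

/-- Functions that replace every letter by a word, and append a fixed word. -/
theorem PT.of_hom {f : α → β} (h : Sym α → List (Sym β)) (s : List (Sym β))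
    (hf : ∀ x, word (f x) = (word x).flatMap h ++ s) : PT f := by
  refine PTime.of_transduce (X := Unit) (fun _ _ => ()) (fun _ => h) (fun _ => s) () fun x => ?_
  rw [hf]
  induction word x with
  | nil => rfl
  | cons y l ih => simp [transduce, ih]

@[fun_prop]
theorem PT.id : PT fun x : α => x := .of_hom (fun y => [y]) [] (by simp)

@[fun_prop]
theorem PT.const (b : β) : PT fun _ : α => b := .of_hom (fun _ => []) (word b) (by simp)

@[fun_prop]
theorem PT.prod_fst : PT (Prod.fst : α × β → α) :=
  .of_hom (Sum.elim (fun y => [y]) fun _ => []) [] fun x => by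
    rw [← Prod.mk.eta (p := x), word_prod]; simp [List.flatMap_map]

@[fun_prop]
theorem PT.prod_snd : PT (Prod.snd : α × β → β) :=
  .of_hom (Sum.elim (fun _ => []) fun y => [y]) [] fun x => by
    rw [← Prod.mk.eta (p := x), word_prod]; simp [List.flatMap_map]

@[fun_prop]
theorem PT.fst {f : γ → α × β} (hf : PT f) : PT fun x => (f x).1 := PT.prod_fst.comp hf

@[fun_prop]
theorem PT.snd {f : γ → α × β} (hf : PT f) : PT fun x => (f x).2 := PT.prod_snd.comp hf

theorem PT.singleton : PT fun x : α => [x] :=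
  .of_hom (fun y => [some y]) [none] fun x => by simp [List.map_eq_flatMap]

@[fun_prop]
theorem PT.append {f g : γ → List α} (hf : PT f) (hg : PT g) : PT fun x => f x ++ g x :=
  PT.comp (g := fun p : List α × List α => p.1 ++ p.2)
    (.of_hom (Sum.elim (fun y => [y]) fun y => [y]) [] fun x => by
      rw [← Prod.mk.eta (p := x), word_prod, word_append]; simp [List.flatMap_map]) (hf.prodMk hg)

@[fun_prop]
theorem PT.cons {f : γ → α} {g : γ → List α} (hf : PT f) (hg : PT g) : PT fun x => f x :: g x :=
  PT.append (PT.singleton.comp hf) hg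

@[fun_prop]
theorem PT.add {f g : γ → ℕ} (hf : PT f) (hg : PT g) : PT fun x => f x + g x :=
  PT.comp (g := fun p : ℕ × ℕ => p.1 + p.2)
    (.of_hom (Sum.elim (fun y => [y]) fun y => [y]) [] fun x => by
      rw [← Prod.mk.eta (p := x), word_prod]
      simp [List.flatMap_map, word_nat, ← List.replicate_append_replicate,
        -List.map_replicate]) (hf.prodMk hg)

@[fun_prop]
theorem PT.length {f : γ → List α} (hf : PT f) : PT fun x => (f x).length :=
  PT.comp (g := fun l : List α => l.length)
    (.of_hom (fun y => y.elim [()] fun _ => []) [] fun l => by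
      induction l with
      | nil => rfl
      | cons a l ih =>
        simp only [word_nat, List.append_nil] at ih
        simp [word_nat, List.replicate_succ, ih, List.flatMap_map]) hf

/-- `n` as a list of length `n`. -/
theorem PT.replicate_zero {f : γ → ℕ} (hf : PT f) : PT fun x => List.replicate (f x) 0 :=
  PT.comp (g := fun n : ℕ => List.replicate n 0)
    (.of_hom (fun _ => [none]) [] fun n => by
      induction n with
      | zero => rfl
      | succ n ih =>
        rw [List.replicate_succ, word_cons, ih]
        simp [word_nat, List.replicate_succ]) hf

/-- Every function on a finite type is computable by a finite automaton that reads the word for its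
argument and stores it in its state. -/
theorem PT.of_finite [Finite α] (hinj : Function.Injective (word : α → List (Sym α)))
    (f : α → β) : PT f := by
  classical
  obtain ⟨n, hn⟩ := (Set.finite_range fun a : α => (word a).length).bddAbove
  have hn : ∀ a : α, (word a).length ≤ n := fun a => hn ⟨a, rfl⟩
  have : Finite {l : List (Sym α) // l.length ≤ n} := (List.finite_length_le _ n).to_subtype
  refine PTime.of_transduce (X := {l : List (Sym α) // l.length ≤ n})
    (fun s x => if h : (s.1 ++ [x]).length ≤ n then ⟨s.1 ++ [x], h⟩ else s) (fun _ _ => [])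
    (fun s => if h : ∃ a : α, word a = s.1 then word (f h.choose) else []) ⟨[], by simp⟩
    fun a => ?_
  have key : ∀ (l : List (Sym α)) (s : {l : List (Sym α) // l.length ≤ n}), s.1 ++ l = word a →
      transduce (fun s x => if h : (s.1 ++ [x]).length ≤ n then ⟨s.1 ++ [x], h⟩ else s)
      (fun _ _ => []) (fun s : {l : List (Sym α) // l.length ≤ n} =>
        if h : ∃ a : α, word a = s.1 then word (f h.choose) else []) s l = word (f a) := by
    intro l
    induction l with
    | nil =>
      intro s hs
      have h : ∃ a : α, word a = s.1 := ⟨a, by simpa using hs.symm⟩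
      simp only [transduce, dif_pos h]
      rw [hinj (h.choose_spec.trans (by simpa using hs))]
    | cons x l ih =>
      intro s hs
      have h : (s.1 ++ [x]).length ≤ n := by
        have := hn a
        rw [← hs] at this
        simp at this ⊢; omega
      rw [transduce, dif_pos h]
      exact ih _ (by simpa using hs)
  exact (key _ _ rfl).symm

/-- Splitting off the first element of a list. -/
theorem PT.take_drop_one : PT fun l : List α => (l.take 1, l.drop 1) := by
  refine PTime.of_transduce (X := Bool) (fun s x => s || x.isNone)
    (fun s x => [bif s then .inr x else .inl x]) (fun _ => []) false fun l => ?_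
  have h₁ : ∀ l : List (Option (Sym α)), transduce (fun s (x : Option (Sym α)) => s || x.isNone)
      (fun s x => [bif s then (.inr x : _ ⊕ Option (Sym α)) else .inl x]) (fun _ => []) true l
      = l.map .inr := by
    intro l
    induction l with
    | nil => rfl
    | cons x l ih => simpa [transduce] using ih
  have h₂ : ∀ (w : List (Sym α)) (l : List (Option (Sym α))),
      transduce (fun s (x : Option (Sym α)) => s || x.isNone)
      (fun s x => [bif s then (.inr x : _ ⊕ Option (Sym α)) else .inl x]) (fun _ => []) false
      (w.map some ++ none :: l) = (w.map some ++ [none]).map .inl ++ l.map .inr := by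
    intro w l
    induction w with
    | nil => simp [transduce, h₁]
    | cons x w ih => simpa [transduce] using ih
  rcases l with _ | ⟨a, l⟩
  · simp [word_prod, transduce]
  · rw [word_cons]
    refine Eq.trans ?_ (h₂ _ _).symm
    simp [word_prod]

@[fun_prop]
theorem PT.tail {f : γ → List α} (hf : PT f) : PT fun x => (f x).tail := by
  simpa using (PT.take_drop_one.comp hf).snd

/-- Iteration along a list, the intermediate values being polynomially bounded. -/
theorem PT.foldl {l : γ → List α} {b : γ → β} {step : γ → β → α → β} (hl : PT l) (hb : PT b)
    (hs : PT fun p : γ × β × α => step p.1 p.2.1 p.2.2)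
    (hbound : ∃ t, PolyBdd t ∧ ∀ c l', l' <+: l c → size (l'.foldl (step c) (b c)) ≤ t (size c)) :
    PT fun c => (l c).foldl (step c) (b c) := by
  obtain ⟨t, ht, hbound⟩ := hbound
  obtain ⟨t', ht', hm, htt⟩ := ht.exists_mono
  have h := PTime.foldl (ec := word) (eb := word) (ea := word) hs (fun c : γ => c) b l ht'
    fun x l' hl' => (hbound x l' hl').trans <| (htt _).trans <| hm <| by simp [size, pairWord]
  exact PTime.comp (f := fun x => x) h (PTime.congr ((PT.id (α := γ)).prodMk (hb.prodMk hl))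
    fun _ => rfl)

/-- Case distinction on the first element of a list. -/
theorem PT.list_cases {l : γ → List α} {f : γ → β} {g : γ → α → List α → β} (hl : PT l)
    (hf : PT f) (hg : PT fun p : γ × α × List α => g p.1 p.2.1 p.2.2) :
    PT fun c => match l c with
      | [] => f c
      | a :: l' => g c a l' := by
  have h := PT.foldl (l := fun c => (l c).take 1) (b := f)
    (step := fun c _ a => g c a (l c).tail) ((PT.take_drop_one.comp hl).fst) hf
    (PT.comp (f := fun p : γ × β × α => (p.1, p.2.2, (l p.1).tail)) hg (by fun_prop)) ?_
  · convert h using 2 with c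
    rcases l c with _ | ⟨a, l'⟩ <;> rfl
  · obtain ⟨t, ht, -, h₁⟩ := hf.size_le
    obtain ⟨s, hs, hm, h₂⟩ := hg.size_le
    obtain ⟨u, hu, -, h₃⟩ := hl.size_le
    refine ⟨fun n => t n + s (n + u n), by fun_prop, fun c l' hl' => ?_⟩
    have h₃ := h₃ c
    rcases hc : l c with _ | ⟨a, r⟩
    · rw [hc] at hl'
      obtain rfl : l' = [] := by simpa using hl'
      exact (h₁ c).trans (Nat.le_add_right _ _)
    · rw [hc] at hl' h₃
      rcases List.prefix_cons_iff.1 hl' with rfl | ⟨l'', rfl, h''⟩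
      · exact (h₁ c).trans (Nat.le_add_right _ _)
      · obtain rfl : l'' = [] := by simpa using h''
        refine ((h₂ (c, a, r)).trans (hm ?_)).trans (Nat.le_add_left _ _)
        simp at h₃ ⊢; omega

/-- Case distinction on an element of a finite type. -/
theorem PT.fin_cases [Finite α] (hinj : Function.Injective (word : α → List (Sym α)))
    {g : γ → α} (hg : PT g) {f : α → γ → β} (hf : ∀ a, PT (f a)) : PT fun c => f (g c) c := by
  classical
  rcases isEmpty_or_nonempty α with hα | ⟨⟨a₀⟩⟩
  · have : IsEmpty γ := g.isEmpty
    exact .of_finite (fun x => this.elim x) _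
  have key : ∀ l : List α, PT fun c => if g c ∈ l then f (g c) c else f a₀ c := by
    intro l
    induction l with
    | nil => simpa using hf a₀
    | cons a l ih =>
      have h : PT fun x : α => if x = a then [0] else [] := .of_finite hinj _
      have := PT.list_cases (h.comp hg) ih
        (g := fun c _ _ => f a c)
        (PT.comp (f := fun p : γ × ℕ × List ℕ => p.1) (hf a) (by fun_prop))
      convert this using 2 with c
      by_cases hc : g c = a
      · simp [hc]
      · simp [hc]
  obtain ⟨s⟩ := nonempty_fintype α
  simpa using key Finset.univ.toList

/-- The concatenation of the outputs `out b a` for the elements `a` of a list, where the parameter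
`b` is updated by `step` after every element. -/
def scanList {α β κ : Type} (step : β → α → β) (out : β → α → List κ) : β → List α → List κ
  | _, [] => []
  | b, a :: l => out b a ++ scanList step out (step b a) l

theorem scanList_eq_foldl {α β κ : Type} (step : β → α → β) (out : β → α → List κ) (b : β)
    (l : List α) (r : List κ) :
    (l.foldl (fun (p : β × List κ) a => (step p.1 a, p.2 ++ out p.1 a)) (b, r)) =
      (l.foldl step b, r ++ scanList step out b l) := by
  induction l generalizing b r with
  | nil => simp [scanList]
  | cons a l ih => simp [scanList, ih]

/-- Scanning a list, when the values of the parameter are polynomially bounded. -/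
theorem PT.scanList {l : γ → List α} {b : γ → β} {step : γ → β → α → β}
    {out : γ → β → α → List κ} (hl : PT l) (hb : PT b)
    (hs : PT fun p : γ × β × α => step p.1 p.2.1 p.2.2)
    (ho : PT fun p : γ × β × α => out p.1 p.2.1 p.2.2)
    (hbound : ∃ t, PolyBdd t ∧ ∀ c l', l' <+: l c → size (l'.foldl (step c) (b c)) ≤ t (size c)) :
    PT fun c => scanList (step c) (out c) (b c) (l c) := by
  have h := PT.foldl (l := l) (b := fun c => (b c, ([] : List κ)))
    (step := fun c p a => (step c p.1 a, p.2 ++ out c p.1 a)) hl (by fun_prop)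
    (.prodMk (PT.comp (f := fun p : γ × (β × List κ) × α => (p.1, p.2.1.1, p.2.2)) hs (by fun_prop))
      (.append (by fun_prop)
      (PT.comp (f := fun p : γ × (β × List κ) × α => (p.1, p.2.1.1, p.2.2)) ho (by fun_prop)))) ?_
  · simp only [scanList_eq_foldl] at h
    simpa using h.snd
  · obtain ⟨t, ht, hbound⟩ := hbound
    obtain ⟨s, hs, hm, h₂⟩ := ho.size_le
    obtain ⟨u, hu, -, h₃⟩ := hl.size_le
    refine ⟨fun n => t n + u n * s (n + t n + u n), by fun_prop, fun c l' hl' => ?_⟩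
    rw [scanList_eq_foldl]
    simp only [List.nil_append, size_prod]
    refine add_le_add (hbound c l' hl') ?_
    have hl₁ : size l' ≤ u (size c) := (size_le_of_prefix hl').trans (h₃ c)
    suffices H : ∀ l₁ l₂, l₁ ++ l₂ = l' →
        size (MSIMP.scanList (step c) (out c) (l₁.foldl (step c) (b c)) l₂) ≤
          l₂.length * s (size c + t (size c) + u (size c)) from
      (H [] l' rfl).trans (Nat.mul_le_mul_right _ ((length_le_size l').trans hl₁))
    intro l₁ l₂
    induction l₂ generalizing l₁ with
    | nil => simp [MSIMP.scanList]
    | cons a l₂ ih =>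
      intro h'
      have h₄ := ih (l₁ ++ [a]) (by simpa using h')
      rw [List.foldl_append] at h₄
      simp only [List.foldl_cons, List.foldl_nil] at h₄
      have h₅ := h₂ (c, l₁.foldl (step c) (b c), a)
      have h₆ : size (c, l₁.foldl (step c) (b c), a) ≤ size c + t (size c) + u (size c) := by
        have := hbound c l₁ (.trans ⟨_, h'⟩ hl')
        have : size a ≤ size l' := size_le_of_mem (by simp [← h'])
        simp only [size_prod]
        omega
      have := h₅.trans (hm h₆)
      simp only [MSIMP.scanList, size_append, List.length_cons, add_mul]
      simp only at this
      omega

theorem PT.flatMap {l : γ → List α} {f : γ → α → List κ} (hl : PT l)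
    (hf : PT fun p : γ × α => f p.1 p.2) : PT fun c => (l c).flatMap (f c) := by
  have h := PT.scanList (β := ℕ) (l := l) (b := fun _ => 0) (step := fun _ b _ => b)
    (out := fun c _ a => f c a) hl (by fun_prop) (by fun_prop)
    (PT.comp (f := fun p : γ × ℕ × α => (p.1, p.2.2)) hf (by fun_prop))
    ⟨fun _ => 0, by fun_prop, fun c l' _ => by induction l' <;> simp_all⟩
  convert h using 2 with c
  induction l c with
  | nil => rfl
  | cons a l ih => simp [MSIMP.scanList, ih]

theorem PT.map {l : γ → List α} {f : γ → α → κ} (hl : PT l)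
    (hf : PT fun p : γ × α => f p.1 p.2) : PT fun c => (l c).map (f c) := by
  have h := PT.flatMap (f := fun c a => [f c a]) hl (PT.singleton.comp hf)
  simpa [← List.map_eq_flatMap] using h

@[fun_prop]
theorem PT.drop {l : γ → List α} {n : γ → ℕ} (hl : PT l) (hn : PT n) :
    PT fun c => (l c).drop (n c) := by
  have key : ∀ (r : List ℕ) (l : List α), r.foldl (fun l _ => l.tail) l = l.drop r.length := by
    intro r
    induction r with
    | nil => simp
    | cons _ r ih => intro l; rw [List.foldl_cons, ih]; cases l <;> simp
  have h := PT.foldl (l := fun c => List.replicate (n c) 0) (b := l) (step := fun _ l _ => l.tail)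
    (.replicate_zero hn) hl (by fun_prop) ?_
  · simp only [key] at h
    simpa using h
  · obtain ⟨t, ht, -, h₁⟩ := hl.size_le
    refine ⟨t, ht, fun c l' _ => ?_⟩
    rw [key]
    have h₂ := congrArg size (List.take_append_drop l'.length (l c))
    rw [size_append] at h₂
    have := h₁ c
    omega

@[fun_prop]
theorem PT.getD {l : γ → List α} {n : γ → ℕ} {d : γ → α} (hl : PT l) (hn : PT n) (hd : PT d) :
    PT fun c => (l c).getD (n c) (d c) := by
  have h := PT.list_cases (hl.drop hn) hd (g := fun _ a _ => a) (by fun_prop)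
  convert h using 2 with c
  rw [List.getD_eq_getElem?_getD, ← List.head?_drop]
  rcases (l c).drop (n c) with _ | ⟨a, r⟩ <;> rfl

/-- Numbers are compared by means of lists of these lengths: `m = n` if nothing is left of either
list when as many elements are dropped as the other one has. -/
theorem PT.ite_eq {m n : γ → ℕ} {f g : γ → β} (hm : PT m) (hn : PT n) (hf : PT f) (hg : PT g) :
    PT fun c => if m c = n c then f c else g c := by
  have h := PT.list_cases (((PT.replicate_zero hm).drop hn).append
    ((PT.replicate_zero hn).drop hm)) hf (g := fun c _ _ => g c) (by fun_prop)
  convert h using 2 with c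
  split_ifs with hc
  · simp [hc]
  · have : (List.replicate (m c) 0).drop (n c) ++ (List.replicate (n c) 0).drop (m c) ≠ [] := by
      simp; omega
    obtain ⟨x, r, hx⟩ := List.exists_cons_of_ne_nil this
    rw [hx]

/-- A list of fixed length whose elements are computed separately. -/
theorem PT.list_map_fixed {ι : Type} (l : List ι) {f : ι → γ → β} (hf : ∀ i ∈ l, PT (f i)) :
    PT fun c => l.map fun i => f i c := by
  induction l with
  | nil => exact .const _
  | cons i l ih =>
    rw [List.forall_mem_cons] at hf
    exact .cons hf.1 (ih hf.2)

end Typed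

/-! ### Membership in the ideal of an instance -/

section Ideals

open MvPolynomial

variable {T F : Type} {D : T → Finset F}

theorem MRel.finite_tuples (R : MRel D) : R.tuples.Finite :=
  (Set.Finite.pi fun i => (D (R.sig i)).finite_toSet).subset fun a ha i _ => R.mem_dom a ha i

variable [Field F]

/-- The Lagrange polynomial of `a` in the variable `x`: on `S` it is the indicator function
of `a`. -/
noncomputable def lagrangeVar {V : Type} (S : Finset F) (a : F) (x : V) : MvPolynomial V F := by
  classical
  exact ∏ b ∈ S.erase a, C (a - b)⁻¹ * (X x - C b)

theorem eval_lagrangeVar_of_ne {V : Type} {S : Finset F} {a : F} {x : V} {φ : V → F}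
    (h : φ x ∈ S) (hne : φ x ≠ a) : eval φ (lagrangeVar S a x) = 0 := by
  classical
  rw [lagrangeVar, map_prod]
  exact Finset.prod_eq_zero (i := φ x) (by simp [h, hne]) (by simp)

theorem mk_lagrangeVar {V : Type} (S : Finset F) {a : F} {x : V} {I : Ideal (MvPolynomial V F)}
    (h : X x - C a ∈ I) : Ideal.Quotient.mk I (lagrangeVar S a x) = 1 := by
  classical
  rw [lagrangeVar, map_prod]
  refine Finset.prod_eq_one fun b hb => ?_
  have hab : a - b ≠ 0 := sub_ne_zero.2 (Finset.ne_of_mem_erase hb).symm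
  have h' := (Ideal.Quotient.mk_eq_mk_iff_sub_mem _ _).2 h
  rw [map_mul, map_sub, h', ← map_sub, ← map_mul, ← C_sub, ← C_mul, inv_mul_cancel₀ hab, C_1,
    map_one]

/-- The ideal of a constraint contains a polynomial that takes the value `1` at all assignments
that violate the constraint. -/
theorem Constraint.exists_mem_ideal {Γ : Set (MRel D)} {V : Type} {δ : V → T}
    (c : Constraint Γ δ) : ∃ χ ∈ c.ideal, ∀ φ : V → F, (∀ x, φ x ∈ D (δ x)) → ¬c.Sat φ →
      eval φ χ = 1 := by
  classical
  refine ⟨∏ v ∈ c.rel.1.finite_tuples.toFinset,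
    (1 - ∏ j, lagrangeVar (D (c.rel.1.sig j)) (v j) (c.scope j)), ?_, fun φ hφ hc => ?_⟩
  · simp only [Constraint.ideal, Ideal.mem_iInf]
    intro v hv
    refine Ideal.mem_of_dvd _ (Finset.dvd_prod_of_mem _ ((Set.Finite.mem_toFinset _).2 hv)) ?_
    rw [← Ideal.Quotient.mk_eq_mk_iff_sub_mem, map_one, map_prod]
    exact (Finset.prod_eq_one fun j _ =>
      mk_lagrangeVar _ (Ideal.subset_span (Set.mem_range_self j))).symm
  · rw [map_prod]
    refine Finset.prod_eq_one fun v hv => ?_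
    rw [Set.Finite.mem_toFinset] at hv
    obtain ⟨j, hj⟩ : ∃ j, φ (c.scope j) ≠ v j := by
      by_contra! h
      exact hc (by rw [Constraint.Sat, funext h]; exact hv)
    rw [map_sub, map_one, map_prod, Finset.prod_eq_zero (Finset.mem_univ j), sub_zero]
    exact eval_lagrangeVar_of_ne (c.sorted j ▸ hφ (c.scope j)) hj

/-- By the combinatorial Nullstellensatz, a polynomial that vanishes on a grid lies in the ideal of
the domain polynomials. -/
theorem mem_span_domainPolys {n : ℕ} (S : Fin n → Finset F) (f : MvPolynomial (Fin n) F)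
    (hf : ∀ φ : Fin n → F, (∀ x, φ x ∈ S x) → eval φ f = 0) :
    f ∈ Ideal.span (Set.range fun x => ∏ a ∈ S x, (X x - C a)) := by
  by_cases hne : ∀ x, (S x).Nonempty
  · obtain ⟨h, -, hh⟩ := combinatorial_nullstellensatz_exists_linearCombination S hne f hf
    rw [hh, Finsupp.linearCombination_apply]
    exact Ideal.sum_mem _ fun x _ => Ideal.mul_mem_left _ _ (Ideal.subset_span ⟨x, rfl⟩)
  · -- a variable with empty domain has the domain polynomial `1`
    push Not at hne
    obtain ⟨x, hx⟩ := hne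
    have h₁ : (1 : MvPolynomial (Fin n) F) ∈
        Ideal.span (Set.range fun x => ∏ a ∈ S x, (X x - C a)) :=
      Ideal.subset_span ⟨x, by simp [hx]⟩
    rw [(Ideal.eq_top_iff_one _).2 h₁]
    trivial

/-- Since the domain polynomials are split and squarefree, the ideal of an instance consists of all
polynomials that vanish on its solutions. -/
theorem Instance.mem_ideal_iff {Γ : Set (MRel D)} (P : Instance Γ)
    (f : MvPolynomial (Fin P.n) F) :
    f ∈ P.ideal ↔ ∀ φ : Fin P.n → F, (∀ x, φ x ∈ D (P.sort x)) →
      (∀ c ∈ P.constraints, c.Sat φ) → eval φ f = 0 := by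
  classical
  constructor
  · intro hf φ hφ hc
    have hle : P.ideal ≤ RingHom.ker (eval φ) := by
      refine sup_le (Ideal.span_le.2 ?_) (iSup₂_le fun c hcP => ?_)
      · rintro _ ⟨x, rfl⟩
        simp only [SetLike.mem_coe, RingHom.mem_ker, map_prod]
        exact Finset.prod_eq_zero (hφ x) (by simp)
      · refine (iInf₂_le (f := fun v (_ : v ∈ c.rel.1.tuples) =>
          Ideal.span (Set.range fun j => (X (c.scope j) - C (v j) : MvPolynomial (Fin P.n) F)))
          _ (hc c hcP)).trans (Ideal.span_le.2 ?_)
        rintro _ ⟨j, rfl⟩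
        simp [RingHom.mem_ker]
    exact hle hf
  · intro hf
    choose! χ hχ hχ₁ using fun c : Constraint Γ P.sort => c.exists_mem_ideal
    let g : MvPolynomial (Fin P.n) F := (P.constraints.map fun c => 1 - χ c).prod
    have hg : Ideal.Quotient.mk P.ideal g = 1 := by
      rw [map_list_prod, List.map_map]
      refine List.prod_eq_one fun y hy => ?_
      obtain ⟨c, hc, rfl⟩ := List.mem_map.1 hy
      have : χ c ∈ P.ideal :=
        (le_sup_of_le_right (le_iSup₂_of_le c hc le_rfl) : c.ideal ≤ P.ideal) (hχ c)
      simp [Ideal.Quotient.eq_zero_iff_mem.2 this]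
    have hfg : f * g ∈ P.ideal := by
      refine (le_sup_left : _ ≤ P.ideal) (mem_span_domainPolys _ _ fun φ hφ => ?_)
      rw [map_mul]
      by_cases hc : ∀ c ∈ P.constraints, c.Sat φ
      · rw [hf φ hφ hc, zero_mul]
      · push Not at hc
        obtain ⟨c, hc, hns⟩ := hc
        rw [map_list_prod, List.prod_eq_zero, mul_zero]
        exact List.mem_map.2 ⟨1 - χ c, List.mem_map.2 ⟨c, hc, rfl⟩, by simp [hχ₁ c φ hφ hns]⟩
    rw [← Ideal.Quotient.eq_zero_iff_mem] at hfg ⊢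
    rwa [map_mul, hg, mul_one] at hfg

end Ideals

/-! ### Interpolation -/

section Interpolation

variable {F ι : Type} [Field F]

/-- The value at `y` of a polynomial that is given as a list of terms. -/
def evalTerms (P : List (F × List ι)) (y : ι → F) : F :=
  (P.map fun t => t.1 * (t.2.map y).prod).sum

/-- `f` is given by a list of terms with coefficients in `k`. -/
def IsPolyFun (k : Subfield F) (f : (ι → F) → F) : Prop :=
  ∃ P : List (F × List ι), (∀ t ∈ P, t.1 ∈ k) ∧ ∀ y, evalTerms P y = f y

theorem IsPolyFun.const {k : Subfield F} {a : F} (ha : a ∈ k) :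
    IsPolyFun k fun _ : ι → F => a :=
  ⟨[(a, [])], by simpa using ha, by simp [evalTerms]⟩

theorem IsPolyFun.var (k : Subfield F) (j : ι) : IsPolyFun k fun y : ι → F => y j :=
  ⟨[(1, [j])], by simp, by simp [evalTerms]⟩

theorem IsPolyFun.add {k : Subfield F} {f g : (ι → F) → F} (hf : IsPolyFun k f)
    (hg : IsPolyFun k g) : IsPolyFun k fun y => f y + g y := by
  obtain ⟨P, hP, hf⟩ := hf
  obtain ⟨Q, hQ, hg⟩ := hg
  refine ⟨P ++ Q, fun t ht => ?_, fun y => ?_⟩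
  · rcases List.mem_append.1 ht with h | h
    exacts [hP t h, hQ t h]
  · simp [evalTerms, ← hf, ← hg]

theorem IsPolyFun.mul {k : Subfield F} {f g : (ι → F) → F} (hf : IsPolyFun k f)
    (hg : IsPolyFun k g) : IsPolyFun k fun y => f y * g y := by
  obtain ⟨P, hP, hf⟩ := hf
  obtain ⟨Q, hQ, hg⟩ := hg
  refine ⟨P.flatMap fun t => Q.map fun u => (t.1 * u.1, t.2 ++ u.2), fun t ht => ?_, fun y => ?_⟩
  · simp only [List.mem_flatMap, List.mem_map] at ht
    obtain ⟨t, ht, u, hu, rfl⟩ := ht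
    exact k.mul_mem (hP t ht) (hQ u hu)
  · simp only [← hf, ← hg]
    clear hP hf
    induction P with
    | nil => simp [evalTerms]
    | cons t P ih =>
      have h : evalTerms (Q.map fun u => (t.1 * u.1, t.2 ++ u.2)) y
          = t.1 * (t.2.map y).prod * evalTerms Q y := by
        simp only [evalTerms, List.map_map, ← List.sum_map_mul_left]
        congr 1
        refine List.map_congr_left fun u _ => ?_
        simp; ring
      rw [List.flatMap_cons]
      simp only [evalTerms, List.map_append, List.sum_append, List.map_cons, List.sum_cons,
        add_mul] at h ih ⊢
      rw [h, ih]

theorem IsPolyFun.sum {k : Subfield F} {α : Type} (s : Finset α) {f : α → (ι → F) → F}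
    (hf : ∀ a ∈ s, IsPolyFun k (f a)) : IsPolyFun k fun y => ∑ a ∈ s, f a y := by
  classical
  induction s using Finset.induction_on with
  | empty => simpa using IsPolyFun.const k.zero_mem
  | insert a s ha ih =>
    simp only [Finset.sum_insert ha]
    exact (hf a (by simp)).add (ih fun b hb => hf b (by simp [hb]))

theorem IsPolyFun.prod {k : Subfield F} {α : Type} (s : Finset α) {f : α → (ι → F) → F}
    (hf : ∀ a ∈ s, IsPolyFun k (f a)) : IsPolyFun k fun y => ∏ a ∈ s, f a y := by
  classical
  induction s using Finset.induction_on with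
  | empty => simpa using IsPolyFun.const k.one_mem
  | insert a s ha ih =>
    simp only [Finset.prod_insert ha]
    exact (hf a (by simp)).mul (ih fun b hb => hf b (by simp [hb]))

/-- Every function on a finite set of points over `k` with values in `k` is given by a
polynomial. -/
theorem exists_interpolation {k : Subfield F} {V : Set (ι → F)} (hV : V.Finite)
    (hVk : ∀ v ∈ V, ∀ j, v j ∈ k) (g : (ι → F) → F) (hg : ∀ v ∈ V, g v ∈ k) :
    ∃ P : List (F × List ι), (∀ t ∈ P, t.1 ∈ k) ∧ ∀ v ∈ V, evalTerms P v = g v := by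
  classical
  -- for `v ≠ w`, a polynomial that is `1` at `v` and `0` at `w`
  have sep : ∀ v w : ι → F, v ∈ V → w ∈ V → v ≠ w →
      ∃ f : (ι → F) → F, IsPolyFun k f ∧ f v = 1 ∧ f w = 0 := by
    intro v w hv hw h
    obtain ⟨i, hi⟩ := Function.ne_iff.1 h
    refine ⟨fun y => (v i - w i)⁻¹ * (y i + -(w i)), .mul (.const ?_) (.add (.var k i) (.const ?_)),
      ?_, by simp⟩
    · exact k.inv_mem (k.sub_mem (hVk v hv i) (hVk w hw i))
    · exact k.neg_mem (hVk w hw i)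
    · simp only
      rw [← sub_eq_add_neg, inv_mul_cancel₀ (sub_ne_zero.2 hi)]
  choose! s hs hs₁ hs₀ using sep
  have hpoly : IsPolyFun k fun y => ∑ v ∈ hV.toFinset,
      g v * ∏ w ∈ hV.toFinset.erase v, s v w y := by
    refine .sum _ fun v hv => .mul (.const (hg v (by simpa using hv))) (.prod _ fun w hw => ?_)
    simp only [Finset.mem_erase, Set.Finite.mem_toFinset] at hv hw
    exact hs v w hv hw.2 hw.1.symm
  obtain ⟨P, hP, hPf⟩ := hpoly
  refine ⟨P, hP, fun v hv => ?_⟩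
  rw [hPf]
  simp only
  rw [Finset.sum_eq_single v]
  · rw [Finset.prod_eq_one, mul_one]
    intro w hw
    simp only [Finset.mem_erase, Set.Finite.mem_toFinset] at hw
    exact hs₁ v w hv hw.2 hw.1.symm
  · intro u hu huv
    simp only [Set.Finite.mem_toFinset] at hu
    rw [Finset.prod_eq_zero (i := v), mul_zero]
    · simpa [huv.symm] using hv
    · exact hs₀ u v hu hv huv
  · intro h
    exact (h (by simpa using hv)).elim

end Interpolation

/-! ### Instances as lists -/

section Raw

variable {T F : Type} {D : T → Finset F}

/-- An instance in terms of lists: the sorts of the variables, the constraints (relation and scope),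
and the terms of the polynomial (coefficient and monomial).  Variables are natural numbers. -/
abbrev RawInstance (T R C : Type) : Type := List T × List (R × List ℕ) × List (C × List ℕ)

/-- The assignment `φ` takes every variable to a value in its domain. -/
def InDom (D : T → Finset F) (sorts : List T) (φ : ℕ → F) : Prop :=
  ∀ x t, sorts[x]? = some t → φ x ∈ D t

/-- The values of `φ` on the list `l` of variables form a tuple of the relation `R`. -/
def MRel.Holds (R : MRel D) (φ : ℕ → F) (l : List ℕ) : Prop :=
  (fun j : Fin R.arity => φ (l.getD j 0)) ∈ R.tuples

/-- The variables in the list `l` have the sorts of the signature of `R`. -/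
def MRel.Fits (R : MRel D) (sorts : List T) (l : List ℕ) : Prop :=
  l.length = R.arity ∧ ∀ j : Fin R.arity, sorts[l.getD j 0]? = some (R.sig j)

variable {Γ : Set (MRel D)}

/-- Well-formed lists: the scopes of the constraints have the right sorts, and the monomials have
degree at most `d`. -/
structure RawInstance.Valid {C : Type} (d : ℕ) (r : RawInstance T Γ C) : Prop where
  fits : ∀ c ∈ r.2.1, c.1.1.Fits r.1 c.2
  degree_le : ∀ t ∈ r.2.2, t.2.length ≤ d
  lt : ∀ t ∈ r.2.2, ∀ x ∈ t.2, x < r.1.length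

variable [Field F]

/-- The value at `φ` of the polynomial given by a list of terms. -/
def termsValue {C : Type} (val : C → F) (l : List (C × List ℕ)) (φ : ℕ → F) : F :=
  (l.map fun t => val t.1 * (t.2.map φ).prod).sum

/-- The polynomial vanishes at all solutions of the instance. -/
def RawInstance.Yes {C : Type} (val : C → F) (r : RawInstance T Γ C) : Prop :=
  ∀ φ : ℕ → F, InDom D r.1 φ → (∀ c ∈ r.2.1, c.1.1.Holds φ c.2) → termsValue val r.2.2 φ = 0

variable {K : ScalarRepr F} {d : ℕ}

/-- The lists that make up an instance. -/
def IMPInstance.raw (I : IMPInstance K Γ d) : RawInstance T Γ K.Code :=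
  (List.ofFn I.csp.sort,
    I.csp.constraints.map fun c => (c.rel, (List.ofFn c.scope).map Fin.val),
    I.terms.map fun t => (t.1, t.2.map Fin.val))

theorem getD_map_val {n k : ℕ} (f : Fin k → Fin n) (j : Fin k) :
    ((List.ofFn f).map Fin.val).getD j 0 = f j := by
  simp [List.getD_eq_getElem?_getD]

theorem IMPInstance.valid_raw (I : IMPInstance K Γ d) : I.raw.Valid d where
  fits := by
    simp only [IMPInstance.raw, List.mem_map]
    rintro _ ⟨c, -, rfl⟩
    refine ⟨by simp, fun j => ?_⟩
    simp only [getD_map_val, ← c.sorted]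
    simp
  degree_le := by
    simp only [IMPInstance.raw, List.mem_map]
    rintro _ ⟨t, ht, rfl⟩
    simpa using I.degree_le t ht
  lt := by
    simp only [IMPInstance.raw, List.mem_map]
    rintro _ ⟨t, ht, rfl⟩ _ hx
    obtain ⟨x, -, rfl⟩ := List.mem_map.1 hx
    simp

/-- Well-formed lists make up an instance. -/
theorem exists_raw_eq {r : RawInstance T Γ K.Code} (hr : r.Valid d) :
    ∃ I : IMPInstance K Γ d, I.raw = r := by
  obtain ⟨sorts, cons, terms⟩ := r
  obtain ⟨h₁, h₂, h₃⟩ := hr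
  simp only at h₁ h₂ h₃
  have hcons : ∃ cs : List (Constraint Γ fun x : Fin sorts.length => sorts[x]),
      cs.map (fun c => (c.rel, (List.ofFn c.scope).map Fin.val)) = cons := by
    clear h₂ h₃
    induction cons with
    | nil => exact ⟨[], rfl⟩
    | cons c cons ih =>
      obtain ⟨cs, rfl⟩ := ih fun c hc => h₁ c (List.mem_cons_of_mem _ hc)
      obtain ⟨hlen, hs⟩ := h₁ c (by simp)
      have hlt : ∀ j : Fin c.1.1.arity, c.2.getD j 0 < sorts.length := fun j =>
        (List.getElem?_eq_some_iff.1 (hs j)).1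
      refine ⟨⟨c.1, fun j => ⟨c.2.getD j 0, hlt j⟩, fun j => ?_⟩ :: cs, ?_⟩
      · exact (List.getElem?_eq_some_iff.1 (hs j)).2
      · simp only [List.map_cons, List.map_ofFn]
        congr 1
        refine Prod.ext rfl (List.ext_getElem (by simp [hlen]) fun i hi hi' => ?_)
        simp [List.getD_eq_getElem?_getD, hi']
  have hterms : ∃ ts : List (K.Code × List (Fin sorts.length)),
      ts.map (fun t => (t.1, t.2.map Fin.val)) = terms := by
    refine ⟨terms.attach.map fun t => (t.1.1, t.1.2.attach.map fun x =>
      ⟨x.1, h₃ t.1 t.2 x.1 x.2⟩), ?_⟩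
    rw [List.map_map]
    conv_rhs => rw [← List.attach_map_subtype_val terms]
    refine List.map_congr_left fun t _ => ?_
    simp [Function.comp_def]
  obtain ⟨cs, rfl⟩ := hcons
  obtain ⟨ts, rfl⟩ := hterms
  refine ⟨⟨⟨sorts.length, fun x => sorts[x], cs⟩, ts, fun t ht => ?_⟩, ?_⟩
  · simpa using h₂ _ (List.mem_map_of_mem (f := fun t => (t.1, t.2.map Fin.val)) ht)
  · simp [IMPInstance.raw]

/-- Ideal membership in terms of lists: it means that the polynomial vanishes at all solutions. -/
theorem IMPInstance.yes_iff_raw (I : IMPInstance K Γ d) : I.Yes ↔ I.raw.Yes K.val := by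
  have hsat : ∀ (φ : ℕ → F) (c : Constraint Γ I.csp.sort),
      c.Sat (fun x => φ x) ↔ c.rel.1.Holds φ ((List.ofFn c.scope).map Fin.val) := by
    intro φ c
    simp only [Constraint.Sat, MRel.Holds, getD_map_val]
  have hval : ∀ φ : ℕ → F, MvPolynomial.eval (fun x : Fin I.csp.n => φ x) I.poly
      = termsValue K.val I.raw.2.2 φ := by
    intro φ
    simp only [IMPInstance.poly, map_list_sum, List.map_map, termsValue, IMPInstance.raw]
    congr 1
    refine List.map_congr_left fun t _ => ?_
    simp [map_list_prod, Function.comp_def]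
  rw [IMPInstance.Yes, Instance.mem_ideal_iff]
  constructor
  · intro h φ hφ hc
    rw [← hval]
    refine h _ (fun x => hφ x _ (by simp [IMPInstance.raw])) fun c hcP => ?_
    rw [hsat]
    exact hc _ (List.mem_map_of_mem (f := fun c : Constraint Γ I.csp.sort =>
      (c.rel, (List.ofFn c.scope).map Fin.val)) hcP)
  · intro h φ hφ hc
    let ψ : ℕ → F := fun x => if hx : x < I.csp.n then φ ⟨x, hx⟩ else 0
    have hψ : φ = fun x : Fin I.csp.n => ψ x := by funext x; simp [ψ]
    rw [hψ, hval]
    refine h ψ (fun x t hx => ?_) fun c hcP => ?_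
    · simp only [IMPInstance.raw, List.getElem?_ofFn, Option.dite_none_right_eq_some,
        Option.some.injEq] at hx
      obtain ⟨hx, rfl⟩ := hx
      simpa [ψ, hx] using hφ ⟨x, hx⟩
    · obtain ⟨c', hc', rfl⟩ := List.mem_map.1 hcP
      exact (hsat ψ c').1 (hψ ▸ hc c' hc')

end Raw

/-! ### Primitive positive definitions as gadgets -/

section Gadgets

/-- The data of a pp-definition: the sorts of the bound variables, the atomic formulas with a
relation from the language, and the equalities.  The variable `inl i` is the bound variable of index
`i`, and `inr p` is the free variable of index `p`. -/
structure Gadget (T R : Type) where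
  bound : List T
  atoms : List (R × List (ℕ ⊕ ℕ))
  eqs : List ((ℕ ⊕ ℕ) × (ℕ ⊕ ℕ))

variable {T F : Type} {D : T → Finset F} {Γ : Set (MRel D)}

/-- In a gadget for `R`, the variable `v` has the sort `t`. -/
def Gadget.HasSort {R' : Type} (g : Gadget T R') (R : MRel D) (v : ℕ ⊕ ℕ) (t : T) : Prop :=
  match v with
  | .inl i => g.bound[i]? = some t
  | .inr p => ∃ h : p < R.arity, R.sig ⟨p, h⟩ = t

/-- The gadget is well-sorted and defines the relation `R`. -/
structure Gadget.Defines (g : Gadget T Γ) (R : MRel D) : Prop where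
  atoms_length : ∀ a ∈ g.atoms, a.2.length = a.1.1.arity
  atoms_sort : ∀ a ∈ g.atoms, ∀ j : Fin a.1.1.arity,
    g.HasSort R (a.2.getD j (.inl 0)) (a.1.1.sig j)
  eqs_sort : ∀ e ∈ g.eqs, ∃ t, g.HasSort R e.1 t ∧ g.HasSort R e.2 t
  mem_iff : ∀ a : ℕ → F, (fun p : Fin R.arity => a p) ∈ R.tuples ↔
    (∀ p : Fin R.arity, a p ∈ D (R.sig p)) ∧ ∃ b : ℕ → F, InDom D g.bound b ∧
      (∀ A ∈ g.atoms, (fun j : Fin A.1.1.arity => Sum.elim b a (A.2.getD j (.inl 0))) ∈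
        A.1.1.tuples) ∧
      ∀ e ∈ g.eqs, Sum.elim b a e.1 = Sum.elim b a e.2

/-- Splitting a conjunction of atomic formulas into equalities and atoms of the language. -/
theorem exists_split_atoms {m k : ℕ} {σ : Fin m ⊕ Fin k → T}
    (L : List (Constraint (Γ ∪ Set.range (eqRel D)) σ)) :
    ∃ (atoms : List (Γ × List (Fin m ⊕ Fin k))) (eqs : List ((Fin m ⊕ Fin k) × (Fin m ⊕ Fin k))),
      (∀ A ∈ atoms, ∃ h : A.2.length = A.1.1.arity,
        ∀ j : Fin A.1.1.arity, σ (A.2[j.1]'(j.2.trans_eq h.symm)) = A.1.1.sig j) ∧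
      (∀ e ∈ eqs, σ e.1 = σ e.2) ∧
      ∀ v : Fin m ⊕ Fin k → F, (∀ x, v x ∈ D (σ x)) → ((∀ c ∈ L, c.Sat v) ↔
        (∀ A ∈ atoms, ∃ h : A.2.length = A.1.1.arity,
          (fun j : Fin A.1.1.arity => v (A.2[j.1]'(j.2.trans_eq h.symm))) ∈ A.1.1.tuples) ∧
        ∀ e ∈ eqs, v e.1 = v e.2) := by
  induction L with
  | nil => exact ⟨[], [], by simp, by simp, by simp⟩
  | cons c L ih =>
    obtain ⟨atoms, eqs, h₁, h₂, h₃⟩ := ih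
    obtain ⟨⟨R, hR⟩, scope, sorted⟩ := c
    rcases hR with hR | ⟨t, rfl⟩
    · refine ⟨(⟨R, hR⟩, List.ofFn scope) :: atoms, eqs, ?_, h₂, fun v hv => ?_⟩
      · rintro A (_ | ⟨_, hA⟩)
        · exact ⟨by simp, fun j => by simpa using sorted j⟩
        · exact h₁ A hA
      · rw [List.forall_mem_cons, h₃ v hv, List.forall_mem_cons, and_assoc]
        refine and_congr_left fun _ => ?_
        simp [Constraint.Sat]
    · refine ⟨atoms, (scope (0 : Fin 2), scope (1 : Fin 2)) :: eqs, h₁, ?_, fun v hv => ?_⟩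
      · rintro e (_ | ⟨_, he⟩)
        · exact (sorted (0 : Fin 2)).trans (sorted (1 : Fin 2)).symm
        · exact h₂ e he
      · rw [List.forall_mem_cons, h₃ v hv, List.forall_mem_cons]
        have hd : v (scope (0 : Fin 2)) ∈ D t := by
          have := hv (scope (0 : Fin 2))
          rwa [show σ (scope (0 : Fin 2)) = t from sorted (0 : Fin 2)] at this
        rw [and_left_comm]
        refine and_congr_right fun _ => and_congr_left fun _ => ?_
        exact ⟨fun h => h.2, fun h => ⟨hd, h⟩⟩

theorem PPDefines.exists_gadget [Zero F] {R : MRel D} (h : PPDefines Γ R) :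
    ∃ g : Gadget T Γ, g.Defines R := by
  obtain ⟨m, σ, L, hσ, hR⟩ := h
  obtain ⟨atoms, eqs, h₁, h₂, h₃⟩ := exists_split_atoms L
  let emb : Fin m ⊕ Fin R.arity → ℕ ⊕ ℕ := Sum.map Fin.val Fin.val
  let g : Gadget T Γ := ⟨List.ofFn fun i => σ (.inl i), atoms.map fun A => (A.1, A.2.map emb),
    eqs.map fun e => (emb e.1, emb e.2)⟩
  have hsort : ∀ x, g.HasSort R (emb x) (σ x) := by
    rintro (i | p)
    · simp [Gadget.HasSort, emb, g]
    · simp [Gadget.HasSort, emb, hσ]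
  have hget : ∀ (A : Γ × List (Fin m ⊕ Fin R.arity)) (h : A.2.length = A.1.1.arity)
      (j : Fin A.1.1.arity),
      (A.2.map emb).getD j (.inl 0) = emb (A.2[j.1]'(j.2.trans_eq h.symm)) := by
    intro A h j
    have : j.1 < A.2.length := j.2.trans_eq h.symm
    simp [List.getD_eq_getElem?_getD, this]
  refine ⟨g, ?_, ?_, ?_, fun a => ?_⟩
  · intro A hA
    obtain ⟨A', hA', rfl⟩ := List.mem_map.1 hA
    simpa using (h₁ A' hA').1
  · intro A hA j
    obtain ⟨A', hA', rfl⟩ := List.mem_map.1 hA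
    obtain ⟨hl, hs⟩ := h₁ A' hA'
    simp only [hget A' hl, ← hs]
    exact hsort _
  · intro e he
    obtain ⟨e', he', rfl⟩ := List.mem_map.1 he
    exact ⟨σ e'.1, hsort _, h₂ e' he' ▸ hsort _⟩
  · rw [hR]
    refine and_congr_right fun ha => ?_
    have key : ∀ (b : Fin m → F) (b' : ℕ → F), (∀ i : Fin m, b' i = b i) →
        (∀ i, b i ∈ D (σ (.inl i))) →
        ((∀ A ∈ L, A.Sat (Sum.elim b fun p : Fin R.arity => a p)) ↔
        (∀ A ∈ g.atoms, (fun j : Fin A.1.1.arity => Sum.elim b' a (A.2.getD j (.inl 0))) ∈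
        A.1.1.tuples) ∧ ∀ e ∈ g.eqs, Sum.elim b' a e.1 = Sum.elim b' a e.2) := by
      intro b b' hb hbD
      have hv : ∀ x, Sum.elim b' a (emb x) = Sum.elim b (fun p : Fin R.arity => a p) x := by
        rintro (i | p)
        · simp [emb, hb]
        · simp [emb]
      rw [h₃ _ (by
        rintro (i | p)
        · exact hbD i
        · simpa [hσ] using ha p)]
      refine and_congr ?_ ?_
      · simp only [g, List.forall_mem_map]
        refine forall₂_congr fun A hA => ?_
        obtain ⟨hl, -⟩ := h₁ A hA
        simp only [hget A hl, hv, hl, exists_true_left]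
      · simp only [g, List.forall_mem_map, hv]
    constructor
    · rintro ⟨b, hb, hL⟩
      refine ⟨fun i => if h : i < m then b ⟨i, h⟩ else 0, ?_, (key b _ (by simp) hb).1 hL⟩
      intro i t hi
      simp only [g, List.getElem?_ofFn, Option.dite_none_right_eq_some, Option.some.injEq] at hi
      obtain ⟨hi, rfl⟩ := hi
      simpa [hi] using hb ⟨i, hi⟩
    · rintro ⟨b, hb, hL⟩
      have hb' : ∀ i : Fin m, b i ∈ D (σ (.inl i)) := fun i => hb i _ (by simp [g])
      exact ⟨fun i => b i, hb', (key (fun i => b i) b (fun _ => rfl) hb').2 hL⟩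

end Gadgets

/-! ### Instantiating gadgets -/

section Instantiation

variable {T F G : Type} {D : T → Finset F} {Γ : Set (MRel D)}

/-- The variable of the target instance for a variable of a gadget, when the bound variables are
numbered from `b` on and the free variables are `args`. -/
def ref (b : ℕ) (args : List ℕ) : ℕ ⊕ ℕ → ℕ := Sum.elim (fun i => b + i) fun p => args.getD p 0

/-- The atoms of a list of gadgets with arguments, with new bound variables from `b` on. -/
def atomsFrom {R : Type} (gad : G → Gadget T R) :
    ℕ → List (G × List ℕ) → List (R × List ℕ) :=
  scanList (fun b g => b + (gad g.1).bound.length)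
    fun b g => (gad g.1).atoms.map fun A => (A.1, A.2.map (ref b g.2))

/-- The equalities of a list of gadgets with arguments, with new bound variables from `b` on. -/
def eqsFrom {R : Type} (gad : G → Gadget T R) : ℕ → List (G × List ℕ) → List (ℕ × ℕ) :=
  scanList (fun b g => b + (gad g.1).bound.length)
    fun b g => (gad g.1).eqs.map fun e => (ref b g.2 e.1, ref b g.2 e.2)

theorem MRel.Fits.append {R : MRel D} {sorts : List T} {l : List ℕ} (h : R.Fits sorts l)
    (sorts' : List T) : R.Fits (sorts ++ sorts') l :=
  ⟨h.1, fun j => by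
    have := h.2 j
    rw [List.getElem?_append_left (List.getElem?_eq_some_iff.1 this).1, this]⟩

theorem MRel.Fits.lt {R : MRel D} {sorts : List T} {l : List ℕ} (h : R.Fits sorts l)
    (j : Fin R.arity) : l.getD j 0 < sorts.length := (List.getElem?_eq_some_iff.1 (h.2 j)).1

theorem MRel.Fits.holds_congr {R : MRel D} {sorts : List T} {l : List ℕ} (h : R.Fits sorts l)
    {φ ψ : ℕ → F} (hφ : ∀ i < sorts.length, φ i = ψ i) : R.Holds φ l ↔ R.Holds ψ l := by
  simp only [MRel.Holds, fun j : Fin R.arity => hφ _ (h.lt j)]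

theorem InDom.append {s s' : List T} {φ : ℕ → F} (h : InDom D s φ)
    (h' : InDom D s' fun i => φ (s.length + i)) : InDom D (s ++ s') φ := by
  intro x t hx
  by_cases hlt : x < s.length
  · exact h x t (by rwa [List.getElem?_append_left hlt] at hx)
  · rw [List.getElem?_append_right (by omega)] at hx
    simpa [Nat.add_sub_cancel' (by omega : s.length ≤ x)] using h' _ _ hx

theorem InDom.of_append_left {s s' : List T} {φ : ℕ → F} (h : InDom D (s ++ s') φ) :
    InDom D s φ := fun x t hx => h x t (by
  rw [List.getElem?_append_left (List.getElem?_eq_some_iff.1 hx).1, hx])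

theorem InDom.of_append_right {s s' : List T} {φ : ℕ → F} (h : InDom D (s ++ s') φ) :
    InDom D s' fun i => φ (s.length + i) := fun x t hx => h _ t (by
  rw [List.getElem?_append_right (by omega)]; simpa using hx)

theorem InDom.congr {s : List T} {φ ψ : ℕ → F} (h : InDom D s φ)
    (hφ : ∀ i < s.length, ψ i = φ i) : InDom D s ψ := fun x t hx => by
  rw [hφ x (List.getElem?_eq_some_iff.1 hx).1]; exact h x t hx

variable {g : Gadget T Γ} {R : MRel D} {sorts : List T} {args : List ℕ}

theorem getElem?_ref (hargs : R.Fits sorts args) {v : ℕ ⊕ ℕ} {t : T} (hv : g.HasSort R v t) :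
    (sorts ++ g.bound)[ref sorts.length args v]? = some t := by
  rcases v with i | p
  · simp only [ref, Sum.elim_inl]
    rw [List.getElem?_append_right (by omega)]
    simpa [Gadget.HasSort] using hv
  · obtain ⟨hp, rfl⟩ := hv
    exact (hargs.append _).2 ⟨p, hp⟩

theorem getD_map_ref {A : Γ × List (ℕ ⊕ ℕ)} (hA : A.2.length = A.1.1.arity) (f : ℕ ⊕ ℕ → ℕ)
    (j : Fin A.1.1.arity) : (A.2.map f).getD j 0 = f (A.2.getD j (.inl 0)) := by
  have : j.1 < A.2.length := j.2.trans_eq hA.symm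
  simp [List.getD_eq_getElem?_getD, this]

theorem Gadget.Defines.fits_atoms (hg : g.Defines R) (hargs : R.Fits sorts args)
    {A : Γ × List (ℕ ⊕ ℕ)} (hA : A ∈ g.atoms) :
    A.1.1.Fits (sorts ++ g.bound) (A.2.map (ref sorts.length args)) :=
  ⟨by simpa using hg.atoms_length A hA, fun j => by
    rw [getD_map_ref (hg.atoms_length A hA)]
    exact getElem?_ref hargs (hg.atoms_sort A hA j)⟩

theorem ref_comp (φ : ℕ → F) (b : ℕ) (args : List ℕ) (v : ℕ ⊕ ℕ) :
    φ (ref b args v) = Sum.elim (fun i => φ (b + i)) (fun p => φ (args.getD p 0)) v := by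
  cases v <;> rfl

/-- Solutions of an instantiated gadget satisfy the relation that it defines. -/
theorem Gadget.Defines.holds (hg : g.Defines R) (hargs : R.Fits sorts args) {φ : ℕ → F}
    (hφ : InDom D (sorts ++ g.bound) φ)
    (hatoms : ∀ A ∈ g.atoms, A.1.1.Holds φ (A.2.map (ref sorts.length args)))
    (heqs : ∀ e ∈ g.eqs, φ (ref sorts.length args e.1) = φ (ref sorts.length args e.2)) :
    R.Holds φ args := by
  refine (hg.mem_iff fun p => φ (args.getD p 0)).2 ⟨fun p => hφ.of_append_left _ _ (hargs.2 p),
    fun i => φ (sorts.length + i), hφ.of_append_right, fun A hA => ?_, fun e he => ?_⟩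
  · have := hatoms A hA
    simpa only [MRel.Holds, getD_map_ref (hg.atoms_length A hA), ref_comp] using this
  · simpa only [ref_comp] using heqs e he

/-- An assignment that satisfies the relation extends to the bound variables of its gadget. -/
theorem Gadget.Defines.exists_extension (hg : g.Defines R) (hargs : R.Fits sorts args)
    {φ : ℕ → F} (hφ : InDom D sorts φ) (h : R.Holds φ args) :
    ∃ ψ : ℕ → F, (∀ i < sorts.length, ψ i = φ i) ∧ InDom D (sorts ++ g.bound) ψ ∧
      (∀ A ∈ g.atoms, A.1.1.Holds ψ (A.2.map (ref sorts.length args))) ∧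
      ∀ e ∈ g.eqs, ψ (ref sorts.length args e.1) = ψ (ref sorts.length args e.2) := by
  obtain ⟨-, b, hb, hatoms, heqs⟩ := (hg.mem_iff fun p => φ (args.getD p 0)).1 h
  let ψ : ℕ → F := fun i => if i < sorts.length then φ i else b (i - sorts.length)
  have hψ₁ : ∀ i < sorts.length, ψ i = φ i := fun i hi => if_pos hi
  have hψ₂ : ∀ i, ψ (sorts.length + i) = b i := fun i => by simp [ψ]
  have hψ : ∀ v t, g.HasSort R v t → ψ (ref sorts.length args v) =
      Sum.elim b (fun p => φ (args.getD p 0)) v := by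
    rintro (i | p) t hv
    · exact hψ₂ i
    · exact hψ₁ _ (hargs.lt ⟨p, hv.choose⟩)
  refine ⟨ψ, hψ₁, (hφ.congr hψ₁).append (hb.congr fun i _ => hψ₂ i), fun A hA => ?_,
    fun e he => ?_⟩
  · have := hatoms A hA
    simp only [MRel.Holds, getD_map_ref (hg.atoms_length A hA)]
    simpa only [fun j : Fin A.1.1.arity => hψ _ _ (hg.atoms_sort A hA j)] using this
  · obtain ⟨t, h₁, h₂⟩ := hg.eqs_sort e he
    rw [hψ _ _ h₁, hψ _ _ h₂]
    exact heqs e he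

variable {gad : G → Gadget T Γ} {rel : G → MRel D}

/-- Instantiated gadgets have well-sorted atoms.  Every gadget of the list numbers its bound
variables after all the variables that are in use before it. -/
theorem fits_atomsFrom (hgad : ∀ g, (gad g).Defines (rel g)) (gl : List (G × List ℕ))
    (sorts : List T) (hfit : ∀ g ∈ gl, (rel g.1).Fits sorts g.2) :
    ∀ c ∈ atomsFrom gad sorts.length gl,
      c.1.1.Fits (sorts ++ gl.flatMap fun g => (gad g.1).bound) c.2 := by
  induction gl generalizing sorts with
  | nil => simp [atomsFrom, scanList]
  | cons g gl ih =>
    intro c hc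
    simp only [atomsFrom, scanList, List.mem_append, List.mem_map] at hc
    rw [List.flatMap_cons, ← List.append_assoc]
    rcases hc with ⟨A, hA, rfl⟩ | hc
    · exact ((hgad g.1).fits_atoms (hfit g (by simp)) hA).append _
    · refine ih (sorts ++ (gad g.1).bound)
        (fun g' hg' => (hfit g' (List.mem_cons_of_mem _ hg')).append _) c ?_
      rwa [List.length_append]

theorem sort_eqsFrom (hgad : ∀ g, (gad g).Defines (rel g)) (gl : List (G × List ℕ))
    (sorts : List T) (hfit : ∀ g ∈ gl, (rel g.1).Fits sorts g.2) :
    ∀ e ∈ eqsFrom gad sorts.length gl, ∃ t,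
      (sorts ++ gl.flatMap fun g => (gad g.1).bound)[e.1]? = some t ∧
      (sorts ++ gl.flatMap fun g => (gad g.1).bound)[e.2]? = some t := by
  induction gl generalizing sorts with
  | nil => simp [eqsFrom, scanList]
  | cons g gl ih =>
    intro e he
    simp only [eqsFrom, scanList, List.mem_append, List.mem_map] at he
    rw [List.flatMap_cons, ← List.append_assoc]
    rcases he with ⟨e, he, rfl⟩ | he
    · obtain ⟨t, h₁, h₂⟩ := (hgad g.1).eqs_sort e he
      have h₁ := getElem?_ref (hfit g (by simp)) h₁
      have h₂ := getElem?_ref (hfit g (by simp)) h₂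
      refine ⟨t, ?_, ?_⟩
      · rw [List.getElem?_append_left (List.getElem?_eq_some_iff.1 h₁).1, h₁]
      · rw [List.getElem?_append_left (List.getElem?_eq_some_iff.1 h₂).1, h₂]
    · refine ih (sorts ++ (gad g.1).bound)
        (fun g' hg' => (hfit g' (List.mem_cons_of_mem _ hg')).append _) e ?_
      rwa [List.length_append]

/-- Solutions of a list of instantiated gadgets satisfy all the relations that they define. -/
theorem holds_of_atomsFrom (hgad : ∀ g, (gad g).Defines (rel g)) (gl : List (G × List ℕ))
    (sorts : List T) (hfit : ∀ g ∈ gl, (rel g.1).Fits sorts g.2) {φ : ℕ → F}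
    (hφ : InDom D (sorts ++ gl.flatMap fun g => (gad g.1).bound) φ)
    (hatoms : ∀ c ∈ atomsFrom gad sorts.length gl, c.1.1.Holds φ c.2)
    (heqs : ∀ e ∈ eqsFrom gad sorts.length gl, φ e.1 = φ e.2) :
    ∀ g ∈ gl, (rel g.1).Holds φ g.2 := by
  induction gl generalizing sorts with
  | nil => simp
  | cons g gl ih =>
    simp only [atomsFrom, eqsFrom, scanList, List.forall_mem_append, List.forall_mem_map]
      at hatoms heqs
    rw [List.flatMap_cons, ← List.append_assoc] at hφ
    rw [List.forall_mem_cons]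
    refine ⟨(hgad g.1).holds (hfit g (by simp)) hφ.of_append_left hatoms.1 heqs.1,
      ih (sorts ++ (gad g.1).bound)
        (fun g' hg' => (hfit g' (List.mem_cons_of_mem _ hg')).append _) hφ ?_ ?_⟩
    · rw [List.length_append]; exact hatoms.2
    · rw [List.length_append]; exact heqs.2

/-- An assignment that satisfies the relations of a list of gadgets extends to the bound variables
of all of them. -/
theorem exists_extension_atomsFrom (hgad : ∀ g, (gad g).Defines (rel g))
    (gl : List (G × List ℕ)) (sorts : List T) (hfit : ∀ g ∈ gl, (rel g.1).Fits sorts g.2)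
    {φ : ℕ → F} (hφ : InDom D sorts φ) (h : ∀ g ∈ gl, (rel g.1).Holds φ g.2) :
    ∃ ψ : ℕ → F, (∀ i < sorts.length, ψ i = φ i) ∧
      InDom D (sorts ++ gl.flatMap fun g => (gad g.1).bound) ψ ∧
      (∀ c ∈ atomsFrom gad sorts.length gl, c.1.1.Holds ψ c.2) ∧
      ∀ e ∈ eqsFrom gad sorts.length gl, ψ e.1 = ψ e.2 := by
  induction gl generalizing sorts φ with
  | nil => exact ⟨φ, by simp, by simpa using hφ, by simp [atomsFrom, scanList],
      by simp [eqsFrom, scanList]⟩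
  | cons g gl ih =>
    rw [List.forall_mem_cons] at hfit h
    obtain ⟨φ₁, h₁, h₂, h₃, h₄⟩ := (hgad g.1).exists_extension hfit.1 hφ h.1
    obtain ⟨ψ, h₁', h₂', h₃', h₄'⟩ := ih (sorts ++ (gad g.1).bound)
      (fun g' hg' => (hfit.2 g' hg').append _) h₂
      fun g' hg' => ((hfit.2 g' hg').holds_congr h₁).2 (h.2 g' hg')
    rw [List.length_append] at h₁' h₃' h₄'
    refine ⟨ψ, fun i hi => (h₁' i (by omega)).trans (h₁ i hi), ?_, ?_, ?_⟩
    · rwa [List.flatMap_cons, ← List.append_assoc]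
    · simp only [atomsFrom, scanList, List.forall_mem_append, List.forall_mem_map]
      refine ⟨fun A hA => ?_, h₃'⟩
      rw [((hgad g.1).fits_atoms hfit.1 hA).holds_congr (by simpa using h₁')]
      exact h₃ A hA
    · simp only [eqsFrom, scanList, List.forall_mem_append, List.forall_mem_map]
      refine ⟨fun e he => ?_, h₄'⟩
      obtain ⟨t, ht₁, ht₂⟩ := (hgad g.1).eqs_sort e he
      have ht₁ := (List.getElem?_eq_some_iff.1 (getElem?_ref hfit.1 ht₁)).1
      have ht₂ := (List.getElem?_eq_some_iff.1 (getElem?_ref hfit.1 ht₂)).1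
      rw [List.length_append] at ht₁ ht₂
      rw [h₁' _ ht₁, h₁' _ ht₂]
      exact h₄ e he

end Instantiation

/-! ### Eliminating equalities -/

section Equalities

/-- A table of representatives for the equivalence relation on `{0, …, n - 1}` that is generated by
the given pairs: for every pair, the class of its second component is renamed to that of the
first. -/
def reps (n : ℕ) (eqs : List (ℕ × ℕ)) : List ℕ :=
  eqs.foldl (fun tab e => tab.map fun r => if r = tab.getD e.2 0 then tab.getD e.1 0 else r)
    (List.range n)

theorem reps_concat (n : ℕ) (eqs : List (ℕ × ℕ)) (e : ℕ × ℕ) :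
    reps n (eqs ++ [e]) = (reps n eqs).map fun r =>
      if r = (reps n eqs).getD e.2 0 then (reps n eqs).getD e.1 0 else r := by
  simp [reps]

theorem length_reps (n : ℕ) (eqs : List (ℕ × ℕ)) : (reps n eqs).length = n := by
  induction eqs using List.reverseRecOn with
  | nil => simp [reps]
  | append_singleton eqs e ih => rw [reps_concat, List.length_map, ih]

theorem getD_reps_concat {n : ℕ} (eqs : List (ℕ × ℕ)) (e : ℕ × ℕ) {u : ℕ} (hu : u < n) :
    (reps n (eqs ++ [e])).getD u 0 =
      if (reps n eqs).getD u 0 = (reps n eqs).getD e.2 0 then (reps n eqs).getD e.1 0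
      else (reps n eqs).getD u 0 := by
  have : u < (reps n eqs).length := by rwa [length_reps]
  rw [reps_concat]
  simp [List.getD_eq_getElem?_getD, this]

/-- A function that respects the given pairs does not change when a variable is replaced by its
representative. -/
theorem apply_reps {X : Type} {n : ℕ} {eqs : List (ℕ × ℕ)} (hn : ∀ e ∈ eqs, e.1 < n ∧ e.2 < n)
    {f : ℕ → X} (hf : ∀ e ∈ eqs, f e.1 = f e.2) {u : ℕ} (hu : u < n) :
    f ((reps n eqs).getD u 0) = f u := by
  induction eqs using List.reverseRecOn generalizing u with
  | nil => simp [reps, hu]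
  | append_singleton eqs e ih =>
    simp only [List.forall_mem_append, List.forall_mem_singleton] at hn hf
    have ih := @ih hn.1 hf.1
    rw [getD_reps_concat eqs e hu]
    split_ifs with h
    · rw [ih hn.2.1, hf.2, ← ih hn.2.2, ← h, ih hu]
    · exact ih hu

/-- The two components of every pair have the same representative. -/
theorem reps_eq {n : ℕ} {eqs : List (ℕ × ℕ)} (hn : ∀ e ∈ eqs, e.1 < n ∧ e.2 < n) :
    ∀ e ∈ eqs, (reps n eqs).getD e.1 0 = (reps n eqs).getD e.2 0 := by
  induction eqs using List.reverseRecOn with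
  | nil => simp
  | append_singleton eqs e ih =>
    simp only [List.forall_mem_append, List.forall_mem_singleton] at hn ⊢
    refine ⟨fun e' he' => ?_, ?_⟩
    · rw [getD_reps_concat _ _ (hn.1 e' he').1, getD_reps_concat _ _ (hn.1 e' he').2,
        ih hn.1 e' he']
    · rw [getD_reps_concat _ _ hn.2.1, getD_reps_concat _ _ hn.2.2]
      simp

/-- Renaming all variables by a table. -/
def renameRaw {T R C : Type} (tab : List ℕ) (r : RawInstance T R C) : RawInstance T R C :=
  (r.1, r.2.1.map fun c => (c.1, c.2.map fun u => tab.getD u 0),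
    r.2.2.map fun t => (t.1, t.2.map fun u => tab.getD u 0))

variable {T F C : Type} {D : T → Finset F} {Γ : Set (MRel D)} {d : ℕ}
  {r : RawInstance T Γ C} {eqs : List (ℕ × ℕ)}

theorem RawInstance.Valid.rename (hr : r.Valid d)
    (heqs : ∀ e ∈ eqs, ∃ t, r.1[e.1]? = some t ∧ r.1[e.2]? = some t) :
    (renameRaw (reps r.1.length eqs) r : RawInstance T Γ C).Valid d := by
  have hn : ∀ e ∈ eqs, e.1 < r.1.length ∧ e.2 < r.1.length := fun e he =>
    let ⟨_, h₁, h₂⟩ := heqs e he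
    ⟨(List.getElem?_eq_some_iff.1 h₁).1, (List.getElem?_eq_some_iff.1 h₂).1⟩
  have hsort : ∀ u < r.1.length, r.1[(reps r.1.length eqs).getD u 0]? = r.1[u]? := fun u hu =>
    apply_reps (f := fun u => r.1[u]?) hn (fun e he =>
      let ⟨_, h₁, h₂⟩ := heqs e he
      h₁.trans h₂.symm) hu
  constructor
  · simp only [renameRaw, List.forall_mem_map]
    intro c hc
    have hfit := hr.fits c hc
    refine ⟨by simpa using hfit.1, fun j => ?_⟩
    have : j.1 < c.2.length := j.2.trans_eq hfit.1.symm
    have h₂ : (c.2.map fun u => (reps r.1.length eqs).getD u 0).getD j 0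
        = (reps r.1.length eqs).getD (c.2.getD j 0) 0 := by
      simp [List.getD_eq_getElem?_getD, this]
    rw [h₂, hsort _ (hfit.lt j)]
    exact hfit.2 j
  · simp only [renameRaw, List.forall_mem_map, List.length_map]
    exact hr.degree_le
  · simp only [renameRaw, List.forall_mem_map]
    intro t ht u hu
    have hlt := hr.lt t ht u hu
    have := hsort u hlt
    rw [List.getElem?_eq_getElem hlt] at this
    exact (List.getElem?_eq_some_iff.1 this).1

/-- Replacing variables by representatives amounts to adding the equalities as constraints. -/
theorem RawInstance.Valid.yes_rename_iff [Field F] {val : C → F} (hr : r.Valid d)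
    (heqs : ∀ e ∈ eqs, ∃ t, r.1[e.1]? = some t ∧ r.1[e.2]? = some t) :
    (renameRaw (reps r.1.length eqs) r : RawInstance T Γ C).Yes val ↔
      ∀ φ : ℕ → F, InDom D r.1 φ → (∀ c ∈ r.2.1, c.1.1.Holds φ c.2) →
        (∀ e ∈ eqs, φ e.1 = φ e.2) → termsValue val r.2.2 φ = 0 := by
  have hn : ∀ e ∈ eqs, e.1 < r.1.length ∧ e.2 < r.1.length := fun e he =>
    let ⟨_, h₁, h₂⟩ := heqs e he
    ⟨(List.getElem?_eq_some_iff.1 h₁).1, (List.getElem?_eq_some_iff.1 h₂).1⟩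
  have hsort : ∀ u < r.1.length, r.1[(reps r.1.length eqs).getD u 0]? = r.1[u]? := fun u hu =>
    apply_reps (f := fun u => r.1[u]?) hn (fun e he =>
      let ⟨_, h₁, h₂⟩ := heqs e he
      h₁.trans h₂.symm) hu
  -- an assignment `φ` of the renamed instance corresponds to the assignment `φ ∘ representative`
  have hholds : ∀ (φ : ℕ → F), ∀ c ∈ r.2.1,
      c.1.1.Holds φ (c.2.map fun u => (reps r.1.length eqs).getD u 0) ↔
      c.1.1.Holds (fun u => φ ((reps r.1.length eqs).getD u 0)) c.2 := by
    intro φ c hc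
    have : ∀ j : Fin c.1.1.arity, (c.2.map fun u => (reps r.1.length eqs).getD u 0).getD j 0
        = (reps r.1.length eqs).getD (c.2.getD j 0) 0 := by
      intro j
      have : j.1 < c.2.length := j.2.trans_eq (hr.fits c hc).1.symm
      simp [List.getD_eq_getElem?_getD, this]
    simp only [MRel.Holds, this]
  have hval : ∀ φ : ℕ → F, termsValue val (renameRaw (reps r.1.length eqs) r).2.2 φ =
      termsValue val r.2.2 fun u => φ ((reps r.1.length eqs).getD u 0) := by
    intro φ
    simp [termsValue, renameRaw, Function.comp_def]
  have hvcongr : ∀ φ ψ : ℕ → F, (∀ u < r.1.length, φ u = ψ u) →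
      termsValue val r.2.2 φ = termsValue val r.2.2 ψ := by
    intro φ ψ h
    simp only [termsValue]
    congr 1
    refine List.map_congr_left fun t ht => ?_
    rw [List.map_congr_left fun u hu => h u (hr.lt t ht u hu)]
  simp only [RawInstance.Yes, hval]
  constructor
  · intro h φ hφ hc he
    have hφ' : ∀ u < r.1.length, φ ((reps r.1.length eqs).getD u 0) = φ u :=
      fun u hu => apply_reps hn he hu
    rw [← hvcongr _ _ hφ']
    refine h φ hφ ?_
    simp only [renameRaw, List.forall_mem_map]
    intro c hcr
    rw [hholds φ c hcr, (hr.fits c hcr).holds_congr hφ']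
    exact hc c hcr
  · intro h φ hφ hc
    refine h _ (fun u t hu => ?_) (fun c hcr => ?_) fun e he => by rw [reps_eq hn e he]
    · refine hφ _ t ?_
      change r.1[_]? = _
      rw [hsort u (List.getElem?_eq_some_iff.1 hu).1, hu]
    · rw [← hholds φ c hcr]
      exact hc _ (List.mem_map_of_mem (f := fun c : Γ × List ℕ =>
        (c.1, c.2.map fun u => (reps r.1.length eqs).getD u 0)) hcr)

end Equalities

/-! ### The reduction on lists -/

section Reduction

/-- The list of the variables `b, …, b + ℓ - 1`. -/
def block (b ℓ : ℕ) : List ℕ := (List.range ℓ).map (b + ·)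

theorem length_block (b ℓ : ℕ) : (block b ℓ).length = ℓ := by simp [block]

theorem getD_block {b ℓ i : ℕ} (h : i < ℓ) : (block b ℓ).getD i 0 = b + i := by
  simp [block, List.getD_eq_getElem?_getD, h]

section Definitions

variable {S T F G R C : Type}

/-- The blocks of target variables that represent the source variables: a variable of sort `s` is
represented by `|blk s|` new variables, of the sorts `blk s`. -/
def envFrom (blk : S → List T) : ℕ → List S → List (S × List ℕ) :=
  scanList (fun b s => b + (blk s).length) fun b s => [(s, block b (blk s).length)]

/-- The relations that have to hold in the target instance: every block lies in its relation
`F_s`, and for every constraint the blocks of its scope lie in the preimage of its relation. -/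
def gadgetList (env : List (S × List ℕ)) (cons : List (R × List ℕ)) :
    List ((S ⊕ R) × List ℕ) :=
  (env.map fun e => (.inl e.1, e.2)) ++
    cons.map fun c => (.inr c.1, c.2.flatMap fun x => (env.map Prod.snd).getD x [])

/-- One step in substituting polynomials for the variables of a term.  A triple `(k, xs, ys)` stands
for the product of the coefficient `k`, the source variables `xs` and the target variables `ys`;
the first source variable is replaced by the polynomial `P s`, evaluated at its block. -/
def expand (P : S → List (F × List ℕ)) (scale : F → C → C) (env : List (S × List ℕ))
    (τ : C × List ℕ × List ℕ) : List (C × List ℕ × List ℕ) :=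
  match τ.2.1 with
  | [] => [τ]
  | x :: xs => match env.drop x with
    | [] => []
    | e :: _ => (P e.1).map fun t =>
        (scale t.1 τ.1, xs, τ.2.2 ++ t.2.map fun i => e.2.getD i 0)

/-- Substitution of polynomials for the variables in terms of degree at most `d`. -/
def substTerms (P : S → List (F × List ℕ)) (scale : F → C → C) (d : ℕ)
    (env : List (S × List ℕ)) (terms : List (C × List ℕ)) : List (C × List ℕ) :=
  ((fun l => l.flatMap (expand P scale env))^[d] (terms.map fun t => (t.1, t.2, []))).map
    fun τ => (τ.1, τ.2.2)

/-- The target instance before the elimination of equalities, for given blocks `env`. -/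
def reduceWith (blk : S → List T) (gad : S ⊕ R → Gadget T G) (P : S → List (F × List ℕ))
    (scale : F → C → C) (d : ℕ) (env : List (S × List ℕ)) (r : RawInstance S R C) :
    RawInstance T G C :=
  (r.1.flatMap blk ++ (gadgetList env r.2.1).flatMap fun g => (gad g.1).bound,
    atomsFrom gad (r.1.flatMap blk).length (gadgetList env r.2.1),
    substTerms P scale d env r.2.2)

/-- The equalities that the target instance has to satisfy in addition, for given blocks `env`. -/
def reduceEqs (blk : S → List T) (gad : S ⊕ R → Gadget T G) (env : List (S × List ℕ))
    (r : RawInstance S R C) : List (ℕ × ℕ) :=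
  eqsFrom gad (r.1.flatMap blk).length (gadgetList env r.2.1)

/-- The reduction. -/
def reduce (blk : S → List T) (gad : S ⊕ R → Gadget T G) (P : S → List (F × List ℕ))
    (scale : F → C → C) (d : ℕ) (r : RawInstance S R C) : RawInstance T G C :=
  let r' := reduceWith blk gad P scale d (envFrom blk 0 r.1) r
  renameRaw (reps r'.1.length (reduceEqs blk gad (envFrom blk 0 r.1) r)) r'

end Definitions

variable {S T F : Type} {D : T → Finset F} {E : S → Finset F}

/-- The sorts in the signature of a relation, as a list. -/
def MRel.sorts (R : MRel D) : List T := List.ofFn R.sig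

@[simp] theorem MRel.length_sorts (R : MRel D) : R.sorts.length = R.arity := by simp [MRel.sorts]

theorem MRel.fits_block (R : MRel D) (pre : List T) :
    R.Fits (pre ++ R.sorts) (block pre.length R.arity) := by
  refine ⟨length_block _ _, fun j => ?_⟩
  rw [getD_block j.2, List.getElem?_append_right (by omega)]
  simp [MRel.sorts]

variable {Fr : S → MRel D} {π : ∀ s, (Fr s).tuples → E s}

theorem map_fst_envFrom {blk : S → List T} (b : ℕ) (sorts : List S) :
    (envFrom blk b sorts).map Prod.fst = sorts := by
  induction sorts generalizing b with
  | nil => rfl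
  | cons s sorts ih =>
    have := ih (b + (blk s).length)
    simp_all [envFrom, scanList]

theorem fits_envFrom (sorts : List S) (pre : List T) :
    ∀ e ∈ envFrom (fun s => (Fr s).sorts) pre.length sorts,
      (Fr e.1).Fits (pre ++ sorts.flatMap fun s => (Fr s).sorts) e.2 := by
  induction sorts generalizing pre with
  | nil => simp [envFrom, scanList]
  | cons s sorts ih =>
    intro e he
    rw [List.flatMap_cons, ← List.append_assoc]
    simp only [envFrom, scanList, List.mem_append, List.mem_singleton] at he
    rcases he with rfl | he
    · rw [MRel.length_sorts]
      exact ((Fr s).fits_block pre).append _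
    · refine ih (pre ++ (Fr s).sorts) e ?_
      rwa [List.length_append]

/-- The assignment `φ'` of the blocks represents the assignment `φ` of the source variables. -/
def Linked (π : ∀ s, (Fr s).tuples → E s) (φ φ' : ℕ → F) (env : List (S × List ℕ)) : Prop :=
  ∀ (x : ℕ) (e : S × List ℕ), env[x]? = some e →
    ∃ a : (Fr e.1).tuples, (∀ j, φ' (e.2.getD j.1 0) = a.1 j) ∧ (π e.1 a : F) = φ x

/-- Blocks that lie in the relations `F_s` represent an assignment of the source variables, by way
of the maps `π s`. -/
theorem exists_linked_of_holds [Zero F] {φ' : ℕ → F} {env : List (S × List ℕ)}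
    (h : ∀ e ∈ env, (Fr e.1).Holds φ' e.2) : ∃ φ, Linked π φ φ' env := by
  classical
  refine ⟨fun x => if hx : x < env.length then
    (π env[x].1 ⟨_, h env[x] (List.getElem_mem hx)⟩ : F) else 0, fun x e he => ?_⟩
  obtain ⟨hx, rfl⟩ := List.getElem?_eq_some_iff.1 he
  exact ⟨⟨_, h _ (List.getElem_mem hx)⟩, fun j => rfl, by simp [hx]⟩

theorem Linked.holds {φ φ' : ℕ → F} {env : List (S × List ℕ)} (h : Linked π φ φ' env) :
    ∀ e ∈ env, (Fr e.1).Holds φ' e.2 := by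
  intro e he
  obtain ⟨x, hx⟩ := List.mem_iff_getElem?.1 he
  obtain ⟨a, ha, -⟩ := h x e hx
  simp only [MRel.Holds, ha]
  exact a.2

theorem Linked.inDom {φ φ' : ℕ → F} {env : List (S × List ℕ)} (h : Linked π φ φ' env) :
    InDom E (env.map Prod.fst) φ := by
  intro x s hx
  simp only [List.getElem?_map, Option.map_eq_some_iff] at hx
  obtain ⟨e, he, rfl⟩ := hx
  obtain ⟨a, -, ha⟩ := h x e he
  exact ha ▸ (π e.1 a).2

theorem Linked.congr {φ φ' ψ' : ℕ → F} {env : List (S × List ℕ)} (h : Linked π φ φ' env)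
    {sorts : List T} (hfit : ∀ e ∈ env, (Fr e.1).Fits sorts e.2)
    (hψ : ∀ i < sorts.length, ψ' i = φ' i) : Linked π φ ψ' env := by
  intro x e he
  obtain ⟨a, ha, ha'⟩ := h x e he
  refine ⟨a, fun j => ?_, ha'⟩
  rw [hψ _ ((hfit e (List.mem_of_getElem? he)).lt j), ha]

/-- As the maps `π s` are surjective, every assignment of the source variables is represented by an
assignment of the blocks. -/
theorem exists_linked [Zero F] (hπ : ∀ s, Function.Surjective (π s)) (sorts : List S)
    (pre : List T) {φ φ₀ : ℕ → F} (hφ : InDom E sorts φ) (hφ₀ : InDom D pre φ₀) :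
    ∃ φ', (∀ i < pre.length, φ' i = φ₀ i) ∧
      InDom D (pre ++ sorts.flatMap fun s => (Fr s).sorts) φ' ∧
      Linked π φ φ' (envFrom (fun s => (Fr s).sorts) pre.length sorts) := by
  induction sorts generalizing pre φ φ₀ with
  | nil => exact ⟨φ₀, by simp, by simpa using hφ₀, by simp [Linked, envFrom, scanList]⟩
  | cons s sorts ih =>
    obtain ⟨a, ha⟩ := hπ s ⟨φ 0, hφ 0 s (by simp)⟩
    let φ₁ : ℕ → F := fun i => if i < pre.length then φ₀ i else
      if h : i - pre.length < (Fr s).arity then a.1 ⟨_, h⟩ else 0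
    have h₁ : ∀ i < pre.length, φ₁ i = φ₀ i := fun i hi => if_pos hi
    have h₂ : ∀ j : Fin (Fr s).arity, φ₁ (pre.length + j) = a.1 j := fun j => by simp [φ₁]
    have hφ₁ : InDom D (pre ++ (Fr s).sorts) φ₁ := by
      refine (hφ₀.congr h₁).append fun j t hj => ?_
      simp only [MRel.sorts, List.getElem?_ofFn, Option.dite_none_right_eq_some,
        Option.some.injEq] at hj
      obtain ⟨hj, rfl⟩ := hj
      exact (congrArg (· ∈ D _) (h₂ ⟨j, hj⟩)).mpr ((Fr s).mem_dom _ a.2 ⟨j, hj⟩)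
    obtain ⟨φ', h₃, h₄, h₅⟩ := ih (pre ++ (Fr s).sorts) (φ := fun x => φ (x + 1))
      (fun x t hx => hφ (x + 1) t (by simpa using hx)) hφ₁
    rw [List.length_append, MRel.length_sorts] at h₃ h₅
    refine ⟨φ', fun i hi => (h₃ i (by omega)).trans (h₁ i hi), ?_, ?_⟩
    · rwa [List.flatMap_cons, ← List.append_assoc]
    · intro x e he
      simp only [envFrom, scanList, List.singleton_append, MRel.length_sorts] at he h₅
      rcases x with _ | x
      · simp only [List.getElem?_cons_zero, Option.some.injEq] at he
        subst he
        refine ⟨a, fun j => ?_, by rw [ha]⟩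
        simp only [getD_block j.2]
        rw [h₃ _ (by omega), h₂]
      · exact h₅ x e (by simpa using he)

/-! ### Preimages of relations -/

theorem getElem?_flatten {X : Type} (Ls : List (List X)) (i j : ℕ) (hi : i < Ls.length)
    (hj : j < Ls[i].length) :
    Ls.flatten[((Ls.take i).map List.length).sum + j]? = Ls[i][j]? := by
  induction Ls generalizing i with
  | nil => simp at hi
  | cons L Ls ih =>
    rcases i with _ | i
    · simp only [List.getElem_cons_zero] at hj
      simp [List.getElem?_append_left hj]
    · simp only [List.getElem_cons_succ] at hj
      simp only [List.flatten_cons, List.take_succ_cons, List.map_cons, List.sum_cons,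
        List.getElem_cons_succ]
      rw [← ih i (by simpa using hi) hj, List.getElem?_append_right (by omega)]
      congr 1
      omega

/-- In the concatenation of lists of lengths `n i`, the entry of index `(i, j)` in the lexicographic
order is the `j`-th entry of the `i`-th list. -/
theorem getD_flatMap_finSigmaFinEquiv {k : ℕ} {n : Fin k → ℕ} {sc : List ℕ} {g : ℕ → List ℕ}
    (hk : sc.length = k) (hg : ∀ i : Fin k, (g (sc.getD i 0)).length = n i) (i : Fin k)
    (j : Fin (n i)) :
    (sc.flatMap g).getD (finSigmaFinEquiv ⟨i, j⟩ : Fin _) 0 = (g (sc.getD i 0)).getD j 0 := by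
  have hmap : ∀ (i : ℕ) (hi : i < sc.length), sc.getD i 0 = sc[i] := fun i hi => by
    simp [List.getD_eq_getElem?_getD, hi]
  have hi : i.1 < (sc.map g).length := by simp [hk]
  have hLi : (sc.map g)[i.1] = g (sc.getD i 0) := by
    rw [List.getElem_map, hmap]
  have hsum : (((sc.map g).take i).map List.length).sum
      = ∑ i' : Fin i.1, n (Fin.castLE i.2.le i') := by
    rw [← List.sum_ofFn]
    congr 1
    refine List.ext_getElem (by simp [hk, i.2.le]) fun m h₁ h₂ => ?_
    simp only [List.length_ofFn] at h₂
    have := hg ⟨m, h₂.trans i.2⟩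
    simp only [hmap m (hk ▸ h₂.trans i.2)] at this
    simp [this]
  have hj : j.1 < (sc.map g)[i.1].length := by rw [hLi, hg]; exact j.2
  have := getElem?_flatten (sc.map g) i j hi hj
  rw [hsum, hLi] at this
  rw [List.getD_eq_getElem?_getD, List.getD_eq_getElem?_getD (l := g _), finSigmaFinEquiv_apply,
    List.flatMap_def, this]

variable {Q : MRel E} {env : List (S × List ℕ)} {sc : List ℕ}

theorem exists_env_of_fits (hQ : Q.Fits (env.map Prod.fst) sc) (i : Fin Q.arity) :
    ∃ l, env[sc.getD i 0]? = some (Q.sig i, l) ∧ (env.map Prod.snd).getD (sc.getD i 0) [] = l := by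
  have := hQ.2 i
  simp only [List.getElem?_map, Option.map_eq_some_iff] at this
  obtain ⟨⟨s, l⟩, he, rfl⟩ := this
  exact ⟨l, he, by rw [List.getD_eq_getElem?_getD, List.getElem?_map, he]; rfl⟩

theorem length_env_of_fits {sorts : List T} (henv : ∀ e ∈ env, (Fr e.1).Fits sorts e.2)
    (hQ : Q.Fits (env.map Prod.fst) sc) (i : Fin Q.arity) :
    ((env.map Prod.snd).getD (sc.getD i 0) []).length = (Fr (Q.sig i)).arity := by
  obtain ⟨l, he, hl⟩ := exists_env_of_fits hQ i
  rw [hl]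
  exact (henv _ (List.mem_of_getElem? he)).1

theorem fits_preimage {sorts : List T} (henv : ∀ e ∈ env, (Fr e.1).Fits sorts e.2)
    (hQ : Q.Fits (env.map Prod.fst) sc) :
    (preimage Fr π Q).Fits sorts (sc.flatMap fun x => (env.map Prod.snd).getD x []) := by
  have hlen := length_env_of_fits henv hQ
  constructor
  · rw [List.length_flatMap]
    change _ = ∑ i, (Fr (Q.sig i)).arity
    rw [← List.sum_ofFn]
    congr 1
    refine List.ext_getElem (by simp [hQ.1]) fun m h₁ h₂ => ?_
    simp only [List.length_ofFn] at h₂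
    have := hlen ⟨m, h₂⟩
    simp only [List.length_map] at h₁
    simpa [List.getD_eq_getElem?_getD, h₁] using this
  · intro p
    obtain ⟨⟨i, j⟩, rfl⟩ := finSigmaFinEquiv.surjective p
    rw [getD_flatMap_finSigmaFinEquiv hQ.1 hlen]
    obtain ⟨l, he, hl⟩ := exists_env_of_fits hQ i
    rw [hl, (henv _ (List.mem_of_getElem? he)).2 j]
    exact congrArg (fun p : (i : Fin Q.arity) × Fin (Fr (Q.sig i)).arity =>
      some ((Fr (Q.sig p.1)).sig p.2)) (Equiv.symm_apply_apply finSigmaFinEquiv ⟨i, j⟩).symm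

/-- The concatenated blocks of a scope lie in the preimage of a relation if and only if the
represented values lie in the relation. -/
theorem Linked.holds_preimage_iff {φ φ' : ℕ → F} (h : Linked π φ φ' env) {sorts : List T}
    (henv : ∀ e ∈ env, (Fr e.1).Fits sorts e.2) (hQ : Q.Fits (env.map Prod.fst) sc) :
    (preimage Fr π Q).Holds φ' (sc.flatMap fun x => (env.map Prod.snd).getD x []) ↔
      Q.Holds φ sc := by
  have hlen := length_env_of_fits henv hQ
  have key : ∀ i : Fin Q.arity, ∃ a : (Fr (Q.sig i)).tuples,
      (∀ j : Fin (Fr (Q.sig i)).arity, φ' ((sc.flatMap fun x =>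
        (env.map Prod.snd).getD x []).getD (finSigmaFinEquiv
          (n := fun i => (Fr (Q.sig i)).arity) ⟨i, j⟩ : Fin _) 0) = a.1 j) ∧
      (π (Q.sig i) a : F) = φ (sc.getD i 0) := by
    intro i
    obtain ⟨l, he, hl⟩ := exists_env_of_fits hQ i
    obtain ⟨a, ha, ha'⟩ := h _ _ he
    refine ⟨a, fun j => ?_, ha'⟩
    rw [getD_flatMap_finSigmaFinEquiv hQ.1 hlen, hl, ha]
  choose a ha ha' using key
  have hmem : ∀ i, (fun j : Fin (Fr (Q.sig i)).arity => φ' ((sc.flatMap fun x =>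
        (env.map Prod.snd).getD x []).getD (finSigmaFinEquiv
          (n := fun i => (Fr (Q.sig i)).arity) ⟨i, j⟩ : Fin _) 0))
      ∈ (Fr (Q.sig i)).tuples := fun i => by
    rw [funext (ha i)]; exact (a i).2
  have hπa : (fun i => (π (Q.sig i) ⟨_, hmem i⟩ : F)) = fun i : Fin Q.arity => φ (sc.getD i 0) := by
    funext i
    rw [← ha' i]
    congr 2
    exact Subtype.ext (funext (ha i))
  refine ⟨fun ⟨_, h'⟩ => ?_, fun h' => ⟨hmem, ?_⟩⟩
  · rw [MRel.Holds, ← hπa]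
    exact h'
  · rw [hπa]
    exact h'

end Reduction

/-! ### Substitution of polynomials -/

section Substitution

variable {S T F C : Type} [Field F] {D : T → Finset F} {E : S → Finset F}
  {Fr : S → MRel D} {π : ∀ s, (Fr s).tuples → E s}

/-- The polynomials `P s` have degree at most `c` and coefficients in `k`, and interpolate the maps
`π s`. -/
structure Interpolates (π : ∀ s, (Fr s).tuples → E s) (P : S → List (F × List ℕ))
    (k : Subfield F) (c : ℕ) : Prop where
  coeff_mem : ∀ s, ∀ t ∈ P s, t.1 ∈ k
  degree_le : ∀ s, ∀ t ∈ P s, t.2.length ≤ c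
  lt : ∀ s, ∀ t ∈ P s, ∀ i ∈ t.2, i < (Fr s).arity
  eval_eq : ∀ s (a : (Fr s).tuples) (b : ℕ → F), (∀ j, b j.1 = a.1 j) →
    evalTerms (P s) b = π s a

/-- Interpolating polynomials exist, as the relations `F_s` are finite. -/
theorem exists_interpolates [Finite S] (k : Subfield F) (hD : ∀ t, ∀ a ∈ D t, a ∈ k)
    (hE : ∀ s, ∀ a ∈ E s, a ∈ k) : ∃ P c, Interpolates π P k c := by
  classical
  have : ∀ s, ∃ P : List (F × List (Fin (Fr s).arity)), (∀ t ∈ P, t.1 ∈ k) ∧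
      ∀ a : (Fr s).tuples, evalTerms P a.1 = π s a := by
    intro s
    obtain ⟨P, hP, hPe⟩ := exists_interpolation (k := k) (Fr s).finite_tuples
      (fun v hv j => hD _ _ ((Fr s).mem_dom v hv j))
      (fun v => if h : v ∈ (Fr s).tuples then (π s ⟨v, h⟩ : F) else 0)
      (fun v hv => by simpa only [hv, dite_true] using hE s _ (π s ⟨v, hv⟩).2)
    exact ⟨P, hP, fun a => by rw [hPe _ a.2, dif_pos a.2]⟩
  choose P hP hPe using this
  obtain ⟨c, hc⟩ : BddAbove (⋃ s, {n | ∃ t ∈ P s, t.2.length = n}) :=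
    (Set.finite_iUnion fun s => ((P s).finite_toSet.image fun t => t.2.length).subset (by
      rintro _ ⟨t, ht, rfl⟩
      exact ⟨t, ht, rfl⟩)).bddAbove
  refine ⟨fun s => (P s).map fun t => (t.1, t.2.map Fin.val), c, ?_, ?_, ?_, ?_⟩
  · simpa only [List.forall_mem_map] using hP
  · simp only [List.forall_mem_map, List.length_map]
    exact fun s t ht => hc (Set.mem_iUnion.2 ⟨s, t, ht, rfl⟩)
  · simp only [List.forall_mem_map]
    exact fun s t _ i _ => i.2
  · intro s a b hb
    rw [← hPe, evalTerms, evalTerms, List.map_map]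
    congr 1
    refine List.map_congr_left fun t _ => ?_
    simp [Function.comp_def, hb]

/-- The value of a triple `(k, xs, ys)` under assignments of the source and target variables. -/
def tripleValue (val : C → F) (φ φ' : ℕ → F) (τ : C × List ℕ × List ℕ) : F :=
  val τ.1 * (τ.2.1.map φ).prod * (τ.2.2.map φ').prod

/-- Bounds on a triple `(k, xs, ys)`: there are `n` source variables and `N` target variables, and
the degree is at most `B` when every source variable counts for `c`. -/
structure TripleBound (n N c B : ℕ) (τ : C × List ℕ × List ℕ) : Prop where
  lt_source : ∀ x ∈ τ.2.1, x < n
  lt_target : ∀ y ∈ τ.2.2, y < N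
  degree_le : τ.2.2.length + c * τ.2.1.length ≤ B

variable {P : S → List (F × List ℕ)} {k : Subfield F} {c : ℕ} {scale : F → C → C} {val : C → F}
  {env : List (S × List ℕ)} {sorts : List T}

/-- Every step of the substitution removes a source variable and adds at most `c` target variables.
-/
theorem TripleBound.of_mem_expand (hP : Interpolates π P k c)
    (henv : ∀ e ∈ env, (Fr e.1).Fits sorts e.2) {B : ℕ} {τ τ' : C × List ℕ × List ℕ}
    (hτ : TripleBound env.length sorts.length c B τ) (hτ' : τ' ∈ expand P scale env τ) :
    TripleBound env.length sorts.length c B τ' ∧ τ'.2.1.length ≤ τ.2.1.length - 1 := by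
  obtain ⟨a, xs, ys⟩ := τ
  obtain ⟨h₁, h₂, h₃⟩ := hτ
  rcases xs with _ | ⟨x, xs⟩
  · simp only [expand, List.mem_singleton] at hτ'
    subst hτ'
    exact ⟨⟨h₁, h₂, h₃⟩, by simp⟩
  · rw [List.forall_mem_cons] at h₁
    have hdrop := List.drop_eq_getElem_cons h₁.1
    simp only [expand, hdrop, List.mem_map] at hτ'
    obtain ⟨t, ht, rfl⟩ := hτ'
    have hdeg := hP.degree_le _ t ht
    refine ⟨⟨h₁.2, ?_, ?_⟩, by simp⟩
    · simp only [List.forall_mem_append, List.forall_mem_map]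
      exact ⟨h₂, fun i hi => (henv _ (List.getElem_mem h₁.1)).lt ⟨i, hP.lt _ t ht i hi⟩⟩
    · simp only [List.length_append, List.length_map, List.length_cons, mul_add] at h₃ ⊢
      omega

/-- The value does not change when a source variable is replaced by its interpolating polynomial, as
the block represents the value of the variable. -/
theorem sum_expand (hP : Interpolates π P k c)
    (hscale : ∀ a ∈ k, ∀ x, val (scale a x) = a * val x) {φ φ' : ℕ → F} (h : Linked π φ φ' env)
    {τ : C × List ℕ × List ℕ} (hτ : ∀ x ∈ τ.2.1, x < env.length) :
    ((expand P scale env τ).map (tripleValue val φ φ')).sum = tripleValue val φ φ' τ := by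
  obtain ⟨a, xs, ys⟩ := τ
  rcases xs with _ | ⟨x, xs⟩
  · simp [expand]
  · rw [List.forall_mem_cons] at hτ
    have hdrop := List.drop_eq_getElem_cons hτ.1
    obtain ⟨v, hv, hv'⟩ := h x env[x] (List.getElem?_eq_getElem hτ.1)
    have heval := hP.eval_eq _ v (fun i => φ' (env[x].2.getD i 0)) hv
    rw [hv', evalTerms] at heval
    simp only [expand, hdrop, List.map_map, tripleValue, List.map_cons, List.prod_cons]
    rw [← heval, mul_comm (List.sum _), ← mul_assoc, mul_right_comm, ← List.sum_map_mul_left]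
    congr 1
    refine List.map_congr_left fun t ht => ?_
    simp only [Function.comp_def, tripleValue, hscale _ (hP.coeff_mem _ t ht), List.map_append,
      List.map_map,
      List.prod_append]
    ring

theorem iterate_expand (hP : Interpolates π P k c)
    (henv : ∀ e ∈ env, (Fr e.1).Fits sorts e.2) {B : ℕ} (m : ℕ) {l : List (C × List ℕ × List ℕ)}
    (hl : ∀ τ ∈ l, TripleBound env.length sorts.length c B τ ∧ τ.2.1.length ≤ m) :
    (∀ τ ∈ (fun l => l.flatMap (expand P scale env))^[m] l,
      TripleBound env.length sorts.length c B τ ∧ τ.2.1 = []) ∧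
    ((∀ a ∈ k, ∀ x, val (scale a x) = a * val x) → ∀ φ φ' : ℕ → F, Linked π φ φ' env →
      (((fun l => l.flatMap (expand P scale env))^[m] l).map (tripleValue val φ φ')).sum
        = (l.map (tripleValue val φ φ')).sum) := by
  induction m generalizing l with
  | zero => exact ⟨fun τ hτ => ⟨(hl τ hτ).1, by simpa using (hl τ hτ).2⟩, fun _ _ _ _ => rfl⟩
  | succ m ih =>
    rw [Function.iterate_succ_apply]
    obtain ⟨ih₁, ih₂⟩ := @ih (l.flatMap (expand P scale env)) (by
      intro τ' hτ'
      obtain ⟨τ, hτ, hτ'⟩ := List.mem_flatMap.1 hτ'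
      have := (hl τ hτ).1.of_mem_expand hP henv hτ'
      exact ⟨this.1, this.2.trans (by have := (hl τ hτ).2; omega)⟩)
    refine ⟨ih₁, fun hscale φ φ' h => (ih₂ hscale φ φ' h).trans ?_⟩
    rw [List.map_flatMap, List.flatMap_def, List.sum_flatten, List.map_map]
    congr 1
    exact List.map_congr_left fun τ hτ => sum_expand hP hscale h (hl τ hτ).1.lt_source

variable {terms : List (C × List ℕ)} {d : ℕ}

theorem mem_substTerms (hP : Interpolates π P k c) (henv : ∀ e ∈ env, (Fr e.1).Fits sorts e.2)
    (hd : ∀ t ∈ terms, t.2.length ≤ d) (hlt : ∀ t ∈ terms, ∀ x ∈ t.2, x < env.length) :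
    ∀ t ∈ substTerms P scale d env terms, t.2.length ≤ c * d ∧ ∀ y ∈ t.2, y < sorts.length := by
  have := (iterate_expand (scale := scale) (val := fun _ => (0 : F)) hP henv (B := c * d) d
    (l := terms.map fun t => (t.1, t.2, [])) (by
      simp only [List.forall_mem_map]
      exact fun t ht => ⟨⟨hlt t ht, by simp, by simpa using Nat.mul_le_mul_left c (hd t ht)⟩,
        hd t ht⟩)).1
  simp only [substTerms, List.forall_mem_map]
  exact fun τ hτ => ⟨le_of_add_le_left (this τ hτ).1.degree_le, (this τ hτ).1.lt_target⟩

/-- The polynomials before and after the substitution agree on assignments that represent each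
other. -/
theorem termsValue_substTerms (hP : Interpolates π P k c)
    (henv : ∀ e ∈ env, (Fr e.1).Fits sorts e.2)
    (hscale : ∀ a ∈ k, ∀ x, val (scale a x) = a * val x)
    (hd : ∀ t ∈ terms, t.2.length ≤ d) (hlt : ∀ t ∈ terms, ∀ x ∈ t.2, x < env.length)
    {φ φ' : ℕ → F} (h : Linked π φ φ' env) :
    termsValue val (substTerms P scale d env terms) φ' = termsValue val terms φ := by
  obtain ⟨h₁, h₂⟩ := iterate_expand (scale := scale) (val := val) hP henv (B := c * d) d
    (l := terms.map fun t => (t.1, t.2, [])) (by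
      simp only [List.forall_mem_map]
      exact fun t ht => ⟨⟨hlt t ht, by simp, by simpa using Nat.mul_le_mul_left c (hd t ht)⟩,
        hd t ht⟩)
  have := h₂ hscale φ φ' h
  rw [List.map_map] at this
  rw [termsValue, termsValue, substTerms, List.map_map]
  refine Eq.trans ?_ (this.trans ?_)
  · congr 1
    refine List.map_congr_left fun τ hτ => ?_
    simp [tripleValue, (h₁ τ hτ).2]
  · congr 1
    refine List.map_congr_left fun t _ => ?_
    simp [tripleValue]

end Substitution

/-! ### Correctness of the reduction -/

section Correctness

variable {S T F : Type} {D : T → Finset F} {E : S → Finset F}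
  {Fr : S → MRel D} {π : ∀ s, (Fr s).tuples → E s} {Γ : Set (MRel D)} {Δ : Set (MRel E)}

/-- The relation for each index of a gadget: the relations `F_s`, and the preimages of the relations
of `Δ`. -/
def gadgetRel (Δ : Set (MRel E)) (π : ∀ s, (Fr s).tuples → E s) : S ⊕ Δ → MRel D :=
  Sum.elim Fr fun Q => preimage Fr π Q.1

theorem fits_gadgetList {env : List (S × List ℕ)} {sorts : List T}
    (henv : ∀ e ∈ env, (Fr e.1).Fits sorts e.2) {cons : List (Δ × List ℕ)}
    (hcons : ∀ c ∈ cons, c.1.1.Fits (env.map Prod.fst) c.2) :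
    ∀ g ∈ gadgetList env cons, (gadgetRel Δ π g.1).Fits sorts g.2 := by
  simp only [gadgetList, List.forall_mem_append, List.forall_mem_map]
  exact ⟨henv, fun c hc => fits_preimage henv (hcons c hc)⟩

theorem forall_holds_gadgetList_iff {env : List (S × List ℕ)} {sorts : List T}
    (henv : ∀ e ∈ env, (Fr e.1).Fits sorts e.2) {cons : List (Δ × List ℕ)}
    (hcons : ∀ c ∈ cons, c.1.1.Fits (env.map Prod.fst) c.2) {φ φ' : ℕ → F}
    (h : Linked π φ φ' env) :
    (∀ g ∈ gadgetList env cons, (gadgetRel Δ π g.1).Holds φ' g.2) ↔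
      ∀ c ∈ cons, c.1.1.Holds φ c.2 := by
  simp only [gadgetList, List.forall_mem_append, List.forall_mem_map]
  refine Iff.trans (and_iff_right h.holds) (forall₂_congr fun c hc => ?_)
  exact h.holds_preimage_iff henv (hcons c hc)

/-- The reduction yields well-formed instances, and preserves the answer. -/
theorem reduce_correct [Field F] {C : Type} {gad : S ⊕ Δ → Gadget T Γ}
    {P : S → List (F × List ℕ)} {k : Subfield F} {c d : ℕ} {scale : F → C → C} {val : C → F}
    {r : RawInstance S Δ C} (hπ : ∀ s, Function.Surjective (π s))
    (hgad : ∀ g, (gad g).Defines (gadgetRel Δ π g)) (hP : Interpolates π P k c)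
    (hscale : ∀ a ∈ k, ∀ x, val (scale a x) = a * val x) (hr : r.Valid d) :
    (reduce (fun s => (Fr s).sorts) gad P scale d r).Valid (c * d) ∧
      ((reduce (fun s => (Fr s).sorts) gad P scale d r).Yes val ↔ r.Yes val) := by
  set blk : S → List T := fun s => (Fr s).sorts with hblk
  set env := envFrom blk 0 r.1 with henv_def
  set r' := reduceWith blk gad P scale d env r with hr'_def
  set eqs := reduceEqs blk gad env r with heqs_def
  have hfst : env.map Prod.fst = r.1 := map_fst_envFrom 0 r.1
  have hlen : env.length = r.1.length := by rw [← hfst, List.length_map]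
  have henv : ∀ e ∈ env, (Fr e.1).Fits (r.1.flatMap blk) e.2 := fits_envFrom r.1 []
  have hcons : ∀ c ∈ r.2.1, c.1.1.Fits (env.map Prod.fst) c.2 := hfst.symm ▸ hr.fits
  have hfit := fits_gadgetList (π := π) henv hcons
  have hlt : ∀ t ∈ r.2.2, ∀ x ∈ t.2, x < env.length := hlen.symm ▸ hr.lt
  have heqs := sort_eqsFrom hgad _ _ hfit
  have hterms := mem_substTerms (scale := scale) hP henv hr.degree_le hlt
  have hvalid : r'.Valid (c * d) := by
    refine ⟨fits_atomsFrom hgad _ _ hfit, fun t ht => (hterms t ht).1, fun t ht y hy => ?_⟩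
    exact ((hterms t ht).2 y hy).trans_le (by simp [r', reduceWith])
  have hred : reduce blk gad P scale d r = renameRaw (reps r'.1.length eqs) r' := rfl
  rw [hred]
  refine ⟨hvalid.rename heqs, (hvalid.yes_rename_iff heqs).trans ⟨fun h φ hφ hc => ?_,
    fun h φ' hφ' hatoms he => ?_⟩⟩
  · obtain ⟨φ₁, -, hφ₁, hlink⟩ := exists_linked hπ r.1 [] (φ₀ := fun _ => 0) hφ (by simp [InDom])
    obtain ⟨φ', hφ', hdom, hatoms, he⟩ := exists_extension_atomsFrom hgad _ _ hfit hφ₁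
      ((forall_holds_gadgetList_iff henv hcons hlink).2 hc)
    rw [← termsValue_substTerms hP henv hscale hr.degree_le hlt (hlink.congr henv hφ')]
    exact h φ' hdom hatoms he
  · have hall := holds_of_atomsFrom hgad _ _ hfit hφ' hatoms he
    obtain ⟨φ, hlink⟩ := exists_linked_of_holds (π := π) (φ' := φ') (env := env) fun e hmem =>
      hall (.inl e.1, e.2) (List.mem_append_left _ (List.mem_map_of_mem
        (f := fun e : S × List ℕ => ((.inl e.1 : S ⊕ Δ), e.2)) hmem))
    have := termsValue_substTerms hP henv hscale hr.degree_le hlt hlink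
    refine this.trans (h φ (hfst ▸ hlink.inDom) ?_)
    exact (forall_holds_gadgetList_iff henv hcons hlink).1 hall

end Correctness

open Enc

/-! ### The reduction is computable in polynomial time -/

section Typed

variable {α β γ κ : Type} [Enc α] [Enc β] [Enc γ] [Enc κ]

instance {A B : Type} [Finite A] [Finite B] : Enc (A ⊕ B) := ⟨A ⊕ B, inferInstance, fun a => [a]⟩

theorem word_sum_injective {A B : Type} [Finite A] [Finite B] :
    Function.Injective (word : A ⊕ B → List (Sym (A ⊕ B))) := fun a b h => by
  have : [a] = [b] := h
  simpa using this

theorem word_letter_injective {A : Type} [Finite A] :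
    Function.Injective (word : Letter A → List (Sym (Letter A))) := fun a b h => by
  have : [a] = [b] := h
  simpa using this

theorem foldl_add_le {α : Type} {w : α → ℕ} {W : ℕ} (hW : ∀ a, w a ≤ W) (b : ℕ) (l : List α) :
    l.foldl (fun b a => b + w a) b ≤ b + W * l.length := by
  induction l generalizing b with
  | nil => simp
  | cons a l ih =>
    refine (ih _).trans ?_
    have := hW a
    simp only [List.length_cons, mul_add]
    omega

/-- Scanning a list with a counter that grows by a bounded amount in every step. -/
theorem PT.scanCounter {l : γ → List α} {b : γ → ℕ} {w : α → ℕ} {out : γ → ℕ → α → List κ}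
    (hl : PT l) (hb : PT b) (hw : PT w) (hW : ∃ W, ∀ a, w a ≤ W)
    (ho : PT fun p : γ × ℕ × α => out p.1 p.2.1 p.2.2) :
    PT fun c => MSIMP.scanList (fun b a => b + w a) (out c) (b c) (l c) := by
  refine PT.scanList (step := fun _ b a => b + w a) hl hb (by fun_prop) ho ?_
  obtain ⟨W, hW⟩ := hW
  obtain ⟨t, ht, -, h₁⟩ := hb.size_le
  obtain ⟨u, hu, -, h₂⟩ := hl.size_le
  refine ⟨fun n => t n + W * u n, by fun_prop, fun c l' hl' => ?_⟩
  have h₃ : l'.length ≤ u (size c) := hl'.length_le.trans ((length_le_size _).trans (h₂ c))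
  have := foldl_add_le hW (b c) l'
  have h₁ := h₁ c
  simp only [size_nat] at h₁ ⊢
  exact this.trans (add_le_add h₁ (Nat.mul_le_mul_left _ h₃))

theorem scanList_succ {α : Type} (b : ℕ) (l : List α) :
    scanList (fun b _ => b + 1) (fun b _ => [b]) b l = List.range' b l.length := by
  induction l generalizing b with
  | nil => rfl
  | cons a l ih => simp [scanList, ih, List.range'_succ]

theorem PT.range {n : γ → ℕ} (hn : PT n) : PT fun c => List.range (n c) := by
  have h := PT.scanCounter (l := fun c => List.replicate (n c) 0) (b := fun _ => 0)
    (w := fun _ => 1) (out := fun _ b _ => [b]) (.replicate_zero hn) (.const 0) (.const 1)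
    ⟨1, fun _ => le_rfl⟩ (PT.singleton.comp (f := fun p : γ × ℕ × ℕ => p.2.1) (by fun_prop))
  simpa only [scanList_succ, List.length_replicate, ← List.range_eq_range'] using h

/-- All entries of the tables of representatives are small, which bounds the size of the tables. -/
theorem le_of_mem_reps {n : ℕ} {eqs : List (ℕ × ℕ)} : ∀ u ∈ reps n eqs, u ≤ n := by
  induction eqs using List.reverseRecOn with
  | nil => simpa [reps] using fun u hu => le_of_lt hu
  | append_singleton eqs e ih =>
    rw [reps_concat, List.forall_mem_map]
    intro u hu
    split_ifs
    · rw [List.getD_eq_getElem?_getD]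
      rcases h : (reps n eqs)[e.1]? with _ | v
      · simp
      · exact ih v (List.mem_of_getElem? h)
    · exact ih u hu

theorem size_le_of_forall_le {l : List ℕ} {n : ℕ} (h : ∀ u ∈ l, u ≤ n) :
    size l ≤ l.length * (n + 1) := by
  induction l with
  | nil => simp
  | cons u l ih =>
    rw [List.forall_mem_cons] at h
    have := ih h.2
    simp only [size_cons, size_nat, List.length_cons, add_mul]
    omega

theorem PT.reps {n : γ → ℕ} {eqs : γ → List (ℕ × ℕ)} (hn : PT n) (heqs : PT eqs) :
    PT fun c => MSIMP.reps (n c) (eqs c) := by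
  refine PT.foldl (b := fun c => List.range (n c))
    (step := fun _ tab (e : ℕ × ℕ) => tab.map fun r =>
      if r = tab.getD e.2 0 then tab.getD e.1 0 else r) heqs (.range hn) ?_ ?_
  · exact PT.map (l := fun p : γ × List ℕ × ℕ × ℕ => p.2.1)
      (f := fun p r => if r = p.2.1.getD p.2.2.2 0 then p.2.1.getD p.2.2.1 0 else r)
      (by fun_prop) (.ite_eq (by fun_prop) (by fun_prop) (by fun_prop) (by fun_prop))
  · obtain ⟨t, ht, -, h⟩ := hn.size_le
    refine ⟨fun m => t m * (t m + 1), by fun_prop, fun c l' _ => ?_⟩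
    have h := h c
    rw [size_nat] at h
    have := size_le_of_forall_le (le_of_mem_reps (n := n c) (eqs := l'))
    rw [length_reps] at this
    exact this.trans (Nat.mul_le_mul h (by omega))

section Gadgets

variable {S R T G : Type} [Finite S] [Finite R] {gad : S ⊕ R → Gadget T G}

theorem PT.ref {b : γ → ℕ} {args : γ → List ℕ} (hb : PT b) (hargs : PT args) (v : ℕ ⊕ ℕ) :
    PT fun c => MSIMP.ref (b c) (args c) v := by
  rcases v with i | p
  · exact .add hb (.const i)
  · exact .getD hargs (.const p) (.const 0)

/-- Instantiating a list of gadgets with a counter for the new variables.  There are finitely many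
gadgets, so that it suffices to deal with each of them. -/
theorem PT.scanGadgets {b : γ → ℕ} {gl : γ → List ((S ⊕ R) × List ℕ)}
    {out : (S ⊕ R) → ℕ → List ℕ → List κ} (hb : PT b) (hgl : PT gl)
    (hout : ∀ g, PT fun p : ℕ × List ℕ => out g p.1 p.2) :
    PT fun c => MSIMP.scanList (fun b g => b + (gad g.1).bound.length) (fun b g => out g.1 b g.2)
      (b c) (gl c) := by
  refine PT.scanCounter (w := fun g : (S ⊕ R) × List ℕ => (gad g.1).bound.length)
    (out := fun _ b g => out g.1 b g.2) hgl hb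
    (PT.comp (g := fun g => (gad g).bound.length) (.of_finite word_sum_injective _)
      (f := fun g : (S ⊕ R) × List ℕ => g.1) (by fun_prop)) (by
      obtain ⟨W, hW⟩ := (Set.finite_range fun g => (gad g).bound.length).bddAbove
      exact ⟨W, fun g => hW ⟨g.1, rfl⟩⟩) ?_
  exact PT.fin_cases word_sum_injective (g := fun p : γ × ℕ × (S ⊕ R) × List ℕ => p.2.2.1)
    (f := fun g p => out g p.2.1 p.2.2.2) (by fun_prop)
    fun g => PT.comp (f := fun p : γ × ℕ × (S ⊕ R) × List ℕ => (p.2.1, p.2.2.2)) (hout g)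
      (by fun_prop)

theorem PT.atomsFrom [Enc G] {b : γ → ℕ} {gl : γ → List ((S ⊕ R) × List ℕ)} (hb : PT b)
    (hgl : PT gl) :
    PT fun c => MSIMP.atomsFrom gad (b c) (gl c) :=
  PT.scanGadgets (gad := gad)
    (out := fun g b args => (gad g).atoms.map fun (A : G × List (ℕ ⊕ ℕ)) =>
      (A.1, A.2.map (MSIMP.ref b args)))
    hb hgl fun g => PT.list_map_fixed _
      (f := fun (A : G × List (ℕ ⊕ ℕ)) (p : ℕ × List ℕ) => (A.1, A.2.map (MSIMP.ref p.1 p.2)))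
      fun A _ =>
        .prodMk (.const _) (PT.list_map_fixed _
          (f := fun v (p : ℕ × List ℕ) => MSIMP.ref p.1 p.2 v) fun v _ => .ref (by fun_prop)
            (by fun_prop) v)

theorem PT.eqsFrom {b : γ → ℕ} {gl : γ → List ((S ⊕ R) × List ℕ)} (hb : PT b) (hgl : PT gl) :
    PT fun c => MSIMP.eqsFrom gad (b c) (gl c) :=
  PT.scanGadgets (gad := gad)
    (out := fun g b args => (gad g).eqs.map fun (e : (ℕ ⊕ ℕ) × (ℕ ⊕ ℕ)) =>
      (MSIMP.ref b args e.1, MSIMP.ref b args e.2))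
    hb hgl fun g => PT.list_map_fixed _
      (f := fun (e : (ℕ ⊕ ℕ) × (ℕ ⊕ ℕ)) (p : ℕ × List ℕ) =>
        (MSIMP.ref p.1 p.2 e.1, MSIMP.ref p.1 p.2 e.2)) fun e _ =>
        .prodMk (.ref (by fun_prop) (by fun_prop) _) (.ref (by fun_prop) (by fun_prop) _)

end Gadgets

variable {S T G R C F : Type} [Enc S] [Enc T] [Enc G] [Enc R] [Enc C]

theorem PT.renameRaw {tab : γ → List ℕ} {r : γ → RawInstance T G C} (htab : PT tab) (hr : PT r) :
    PT fun c => MSIMP.renameRaw (tab c) (r c) := by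
  have key : ∀ {X : Type} [Enc X] {l : γ → List (X × List ℕ)}, PT l →
      PT fun c => (l c).map fun x => (x.1, x.2.map fun u => (tab c).getD u 0) := by
    intro X _ l hl
    refine PT.map (f := fun c x => (x.1, x.2.map fun u => (tab c).getD u 0)) hl
      (.prodMk (by fun_prop) ?_)
    exact PT.map (l := fun p : γ × X × List ℕ => p.2.2) (f := fun p u => (tab p.1).getD u 0)
      (by fun_prop) (by fun_prop)
  exact .prodMk hr.fst (.prodMk (key hr.snd.fst) (key hr.snd.snd))

variable [Finite S] [Finite R]

theorem PT.envFrom {T : Type} (hS : Function.Injective (word : S → List (Sym S))) {blk : S → List T}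
    {b : γ → ℕ} {l : γ → List S} (hb : PT b) (hl : PT l) :
    PT fun c => MSIMP.envFrom blk (b c) (l c) := by
  refine PT.scanCounter (out := fun _ b s => [(s, block b (blk s).length)]) hl hb
    (.of_finite hS _) (by
      obtain ⟨W, hW⟩ := (Set.finite_range fun s : S => (blk s).length).bddAbove
      exact ⟨W, fun s => hW ⟨s, rfl⟩⟩) (PT.singleton.comp (.prodMk (by fun_prop) ?_))
  refine PT.fin_cases hS (g := fun p : γ × ℕ × S => p.2.2)
    (f := fun s p => block p.2.1 (blk s).length) (by fun_prop) fun s => ?_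
  exact PT.list_map_fixed _ (f := fun i (p : γ × ℕ × S) => p.2.1 + i) fun i _ => by fun_prop

theorem PT.gadgetList (hS : Function.Injective (word : S → List (Sym S)))
    (hR : Function.Injective (word : R → List (Sym R))) {env : γ → List (S × List ℕ)}
    {cons : γ → List (R × List ℕ)} (henv : PT env) (hcons : PT cons) :
    PT fun c => MSIMP.gadgetList (env c) (cons c) := by
  have hinl : PT (Sum.inl : S → S ⊕ R) := .of_finite hS _
  have hinr : PT (Sum.inr : R → S ⊕ R) := .of_finite hR _
  refine .append (PT.map (f := fun _ (e : S × List ℕ) => ((Sum.inl e.1 : S ⊕ R), e.2)) henv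
    (.prodMk (hinl.comp (by fun_prop)) (by fun_prop)))
    (PT.map (f := fun c (q : R × List ℕ) => ((Sum.inr q.1 : S ⊕ R), q.2.flatMap fun x =>
      ((env c).map Prod.snd).getD x [])) hcons (.prodMk (hinr.comp (by fun_prop)) ?_))
  refine PT.flatMap (l := fun p : γ × R × List ℕ => p.2.2)
    (f := fun p x => ((env p.1).map Prod.snd).getD x []) (by fun_prop) (.getD ?_ (by fun_prop)
      (.const _))
  exact PT.map (l := fun p : (γ × R × List ℕ) × ℕ => env p.1.1) (f := fun _ (e : S × List ℕ) => e.2)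
    (by fun_prop) (by fun_prop)

variable {P : S → List (F × List ℕ)} {scale : F → C → C}

theorem PT.expand (hS : Function.Injective (word : S → List (Sym S)))
    (hscale : ∀ s, ∀ t ∈ P s, PT (scale t.1)) {env : γ → List (S × List ℕ)}
    {τ : γ → C × List ℕ × List ℕ} (henv : PT env) (hτ : PT τ) :
    PT fun c => MSIMP.expand P scale (env c) (τ c) := by
  have hP : ∀ s, PT fun p : (C × List ℕ) × List ℕ × List ℕ => (P s).map fun t =>
      (scale t.1 p.1.1, p.2.1, p.1.2 ++ t.2.map fun i => p.2.2.getD i 0) := fun s =>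
    PT.list_map_fixed (P s) (f := fun t (p : (C × List ℕ) × List ℕ × List ℕ) =>
      (scale t.1 p.1.1, p.2.1, p.1.2 ++ t.2.map fun i => p.2.2.getD i 0)) fun t ht =>
        .prodMk ((hscale s t ht).comp (by fun_prop)) (.prodMk (by fun_prop)
          (.append (by fun_prop) (PT.list_map_fixed _
            (f := fun i (p : (C × List ℕ) × List ℕ × List ℕ) => p.2.2.getD i 0)
            fun i _ => by fun_prop)))
  have h := PT.list_cases (g := fun c x xs => match (env c).drop x with
    | [] => []
    | e :: _ => (P e.1).map fun t =>
        (scale t.1 (τ c).1, xs, (τ c).2.2 ++ t.2.map fun i => e.2.getD i 0))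
    (hτ.snd.fst) (PT.singleton.comp hτ) ?_
  · convert h using 2 with c
    rcases hc : τ c with ⟨k, _ | ⟨x, xs⟩, ys⟩
    · simp [MSIMP.expand]
    · rcases hx : (env c).drop x with _ | ⟨e, env'⟩ <;> simp [MSIMP.expand, hx]
  have h := PT.list_cases (l := fun p : γ × ℕ × List ℕ => (env p.1).drop p.2.1)
    (f := fun _ => ([] : List (C × List ℕ × List ℕ)))
    (g := fun p e _ => (P e.1).map fun t =>
        (scale t.1 (τ p.1).1, p.2.2, (τ p.1).2.2 ++ t.2.map fun i => e.2.getD i 0))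
    (by fun_prop) (.const _) (PT.fin_cases hS
      (g := fun q : (γ × ℕ × List ℕ) × (S × List ℕ) × List (S × List ℕ) => q.2.1.1)
      (f := fun s q => (P s).map fun t => (scale t.1 (τ q.1.1).1, q.1.2.2, (τ q.1.1).2.2 ++
        t.2.map fun i => q.2.1.2.getD i 0)) (by fun_prop) fun s =>
      PT.comp (f := fun q : (γ × ℕ × List ℕ) × (S × List ℕ) × List (S × List ℕ) =>
        (((τ q.1.1).1, (τ q.1.1).2.2), q.1.2.2, q.2.1.2)) (hP s) (by fun_prop))
  convert h using 2 with p
  rcases (env p.1).drop p.2.1 with _ | ⟨e, env'⟩ <;> rfl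

theorem PT.substTerms (hS : Function.Injective (word : S → List (Sym S)))
    (hscale : ∀ s, ∀ t ∈ P s, PT (scale t.1)) (d : ℕ) {env : γ → List (S × List ℕ)}
    {terms : γ → List (C × List ℕ)} (henv : PT env) (hterms : PT terms) :
    PT fun c => MSIMP.substTerms P scale d (env c) (terms c) := by
  have key : PT fun c => (fun l => l.flatMap (MSIMP.expand P scale (env c)))^[d]
      ((terms c).map fun t => (t.1, t.2, ([] : List ℕ))) := by
    induction d with
    | zero =>
      exact PT.map (f := fun _ (t : C × List ℕ) => (t.1, t.2, ([] : List ℕ))) hterms (by fun_prop)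
    | succ d ih =>
      simp only [Function.iterate_succ_apply']
      exact PT.flatMap (f := fun c => MSIMP.expand P scale (env c)) ih
        (.expand hS hscale (by fun_prop) (by fun_prop))
  exact PT.map (f := fun _ τ => (τ.1, τ.2.2)) key (by fun_prop)

/-- The reduction is computable in polynomial time: its loops along the input carry polynomially
bounded counters or tables of counters, and the substitution step is iterated a fixed number of
times. -/
theorem PT.reduce (hS : Function.Injective (word : S → List (Sym S)))
    (hR : Function.Injective (word : R → List (Sym R))) (blk : S → List T)
    (gad : S ⊕ R → Gadget T G) (hscale : ∀ s, ∀ t ∈ P s, PT (scale t.1)) (d : ℕ) :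
    PT fun r : RawInstance S R C => MSIMP.reduce blk gad P scale d r := by
  have hblk : PT blk := .of_finite hS _
  have henv : PT fun r : RawInstance S R C => MSIMP.envFrom blk 0 r.1 :=
    .envFrom hS (.const 0) (by fun_prop)
  have hgl : PT fun r : RawInstance S R C =>
      MSIMP.gadgetList (MSIMP.envFrom blk 0 r.1) r.2.1 := .gadgetList hS hR henv (by fun_prop)
  have hflat : PT fun r : RawInstance S R C => r.1.flatMap blk :=
    PT.flatMap (f := fun _ s => blk s) (by fun_prop) (by fun_prop)
  have hsorts : PT fun r : RawInstance S R C => r.1.flatMap blk ++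
      (MSIMP.gadgetList (MSIMP.envFrom blk 0 r.1) r.2.1).flatMap fun g => (gad g.1).bound :=
    .append hflat (PT.flatMap (f := fun _ g => (gad g.1).bound) hgl
      (PT.comp (PT.of_finite word_sum_injective fun g => (gad g).bound)
        (f := fun p : RawInstance S R C × (S ⊕ R) × List ℕ => p.2.1) (by fun_prop)))
  refine .renameRaw (.reps hsorts.length (.eqsFrom hflat.length hgl)) (.prodMk hsorts
    (.prodMk (.atomsFrom hflat.length hgl) (.substTerms hS hscale d henv (by fun_prop))))

end Typed

/-! ### Reading and writing instances -/

section Tokens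

variable {T A B : Type}

instance [Finite T] [Finite A] [Finite B] : Finite (Token T A B) := by
  let f : T ⊕ A ⊕ B ⊕ Fin 4 → Token T A B := Sum.elim .sort (Sum.elim .rel (Sum.elim .coeff
    ![.tick, .endVar, .endConstraint, .endTerm]))
  refine Finite.of_surjective f fun x => ?_
  cases x with
  | sort t => exact ⟨.inl t, rfl⟩
  | rel a => exact ⟨.inr (.inl a), rfl⟩
  | coeff b => exact ⟨.inr (.inr (.inl b)), rfl⟩
  | tick => exact ⟨.inr (.inr (.inr 0)), rfl⟩
  | endVar => exact ⟨.inr (.inr (.inr 1)), rfl⟩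
  | endConstraint => exact ⟨.inr (.inr (.inr 2)), rfl⟩
  | endTerm => exact ⟨.inr (.inr (.inr 3)), rfl⟩

/-- The tokens for a variable. -/
def varTokens (n : ℕ) : List (Token T A B) := List.replicate n .tick ++ [.endVar]

theorem varTokens_eq : (varTokens : ℕ → List (Token T A B)) =
    fun n => List.replicate n .tick ++ [.endVar] := rfl

variable {R C : Type} [Enc R] [Enc C]

/-- The tokens for the constraints of an instance. -/
def consTokens (l : List (R × List ℕ)) : List (Token T (Sym R) (Sym C)) :=
  l.flatMap fun c => (word c.1).map .rel ++ c.2.flatMap varTokens ++ [.endConstraint]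

/-- The tokens for the terms of an instance. -/
def termTokens (l : List (C × List ℕ)) : List (Token T (Sym R) (Sym C)) :=
  l.flatMap fun t => (word t.1).map .coeff ++ t.2.flatMap varTokens ++ [.endTerm]

/-- The tokens for an instance that is given by lists. -/
def rawTokens (r : RawInstance T R C) : List (Token T (Sym R) (Sym C)) :=
  r.1.map .sort ++ consTokens r.2.1 ++ termTokens r.2.2

/-- The word for a list of constraints or of terms, spelled out. -/
theorem word_varLists {X : Type} [Enc X] (l : List (X × List ℕ)) :
    (word l : List (Option (Sym X ⊕ Option Unit))) = l.flatMap fun c =>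
      (word c.1).map (fun a => some (.inl a)) ++
        c.2.flatMap (fun n => List.replicate n (some (.inr (some ()))) ++ [some (.inr none)]) ++
        [none] := by
  refine congrArg (List.flatMap · l) (funext fun c => ?_)
  have : (word c : List (Sym X ⊕ Option Unit)) = (word c.1).map .inl ++
      (c.2.flatMap fun n => (List.replicate n ()).map some ++ [none]).map .inr := rfl
  change List.map some (word c : List (Sym X ⊕ Option Unit)) ++ [none] = _
  rw [this]
  simp [List.map_flatMap]

/-- The word for an instance that is given by lists. -/
def rawWord (r : RawInstance T R C) :
    List (Option T ⊕ Option (Sym R ⊕ Option Unit) ⊕ Option (Sym C ⊕ Option Unit)) :=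
  (r.1.flatMap fun t => [some t, none]).map Sum.inl ++
    ((word r.2.1).map Sum.inl ++ (word r.2.2).map Sum.inr).map Sum.inr

theorem word_raw [Finite T] (r : RawInstance (Letter T) R C) : word r = rawWord (T := T) r := rfl

/-- The token for a letter of the word for an instance that is given by lists. -/
def tokenOf : Option T ⊕ Option (Sym R ⊕ Option Unit) ⊕ Option (Sym C ⊕ Option Unit) →
    List (Token T (Sym R) (Sym C))
  | .inl (some t) => [.sort t]
  | .inl none => []
  | .inr (.inl (some (.inl a))) => [.rel a]
  | .inr (.inl (some (.inr (some _)))) => [.tick]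
  | .inr (.inl (some (.inr none))) => [.endVar]
  | .inr (.inl none) => [.endConstraint]
  | .inr (.inr (some (.inl b))) => [.coeff b]
  | .inr (.inr (some (.inr (some _)))) => [.tick]
  | .inr (.inr (some (.inr none))) => [.endVar]
  | .inr (.inr none) => [.endTerm]

theorem rawTokens_eq (r : RawInstance T R C) : rawTokens r = (rawWord r).flatMap tokenOf := by
  simp [rawTokens, rawWord, consTokens, termTokens, varTokens_eq, word_varLists,
    List.flatMap_assoc, List.map_eq_flatMap, tokenOf, List.flatMap_replicate]

/-- The letters for a token.  As variables occur both in constraints and in terms, the letters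
depend on whether the token belongs to the terms. -/
def lettersOf (inTerms : Bool) : Token T (Sym R) (Sym C) →
    List (Option T ⊕ Option (Sym R ⊕ Option Unit) ⊕ Option (Sym C ⊕ Option Unit))
  | .sort t => [.inl (some t), .inl none]
  | .rel a => [.inr (.inl (some (.inl a)))]
  | .coeff b => [.inr (.inr (some (.inl b)))]
  | .tick => [.inr (bif inTerms then .inr (some (.inr (some ())))
      else .inl (some (.inr (some ()))))]
  | .endVar => [.inr (bif inTerms then .inr (some (.inr none)) else .inl (some (.inr none)))]
  | .endConstraint => [.inr (.inl none)]
  | .endTerm => [.inr (.inr none)]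

theorem rawWord_eq_lettersOf (r : RawInstance T R C) :
    rawWord r = (r.1.map Token.sort).flatMap (lettersOf false) ++
      (consTokens r.2.1).flatMap (lettersOf false) ++
      (termTokens r.2.2).flatMap (lettersOf true) := by
  simp [rawWord, consTokens, termTokens, varTokens, word_varLists, List.flatMap_assoc,
    List.map_eq_flatMap, lettersOf, List.flatMap_replicate]

/-- The transducer that reads the tokens from right to left.  Its state tells whether only terms
have been read. -/
def readTokens (s : Bool) (l : List (Token T (Sym R) (Sym C))) :
    List (Option T ⊕ Option (Sym R ⊕ Option Unit) ⊕ Option (Sym C ⊕ Option Unit)) :=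
  transduce (fun s x => match x with
    | .endConstraint => false
    | _ => s) (fun s x => (lettersOf s x).reverse) (fun _ => []) s l

theorem readTokens_false (l : List (Token T (Sym R) (Sym C))) :
    readTokens false l = l.flatMap fun x => (lettersOf false x).reverse := by
  induction l with
  | nil => rfl
  | cons x l ih =>
    rw [List.flatMap_cons, ← ih]
    cases x <;> rfl

theorem readTokens_true_append {l : List (Token T (Sym R) (Sym C))}
    (hl : Token.endConstraint ∉ l) (l' : List (Token T (Sym R) (Sym C))) :
    readTokens true (l ++ l') =
      (l.flatMap fun x => (lettersOf true x).reverse) ++ readTokens true l' := by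
  induction l with
  | nil => rfl
  | cons x l ih =>
    rw [List.mem_cons, not_or] at hl
    rw [List.flatMap_cons, List.append_assoc, ← ih hl.2]
    cases x <;> first | rfl | exact (hl.1 rfl).elim

/-- When the tokens are read from right to left, the last `endConstraint` separates the terms from
the constraints.  If there are no constraints, the remaining tokens are sorts, and do not depend on
the state. -/
theorem readTokens_rawTokens (r : RawInstance T R C) :
    (readTokens true (rawTokens r).reverse).reverse =
      (r.1.map Token.sort).flatMap (lettersOf false) ++
      (consTokens r.2.1).flatMap (lettersOf false) ++
      (termTokens r.2.2).flatMap (lettersOf true) := by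
  obtain ⟨sorts, cons, terms⟩ := r
  have h₁ : Token.endConstraint ∉ (termTokens (T := T) (R := R) terms).reverse := by
    simp [termTokens, varTokens]
  have h₂ : readTokens true ((sorts.map (Token.sort (A := Sym R) (B := Sym C))) ++
      consTokens cons).reverse = readTokens false ((sorts.map Token.sort) ++
      consTokens cons).reverse := by
    rcases List.eq_nil_or_concat cons with rfl | ⟨cons, c, rfl⟩
    · have h := readTokens_true_append
        (l := (sorts.map (Token.sort (A := Sym R) (B := Sym C))).reverse)
        (by simp) []
      rw [readTokens_false]
      simp only [consTokens, List.flatMap_nil, List.append_nil] at h ⊢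
      rw [h]
      simp [readTokens, transduce, List.flatMap_map, ← List.map_reverse, lettersOf]
    · simp [consTokens, readTokens, transduce, lettersOf]
  rw [rawTokens, List.reverse_append, readTokens_true_append h₁, h₂, readTokens_false,
    List.reverse_append, ← List.flatMap_append]
  simp only [List.reverse_flatMap, List.reverse_reverse, Function.comp_def]

/-- The word for an instance can be converted to its tokens. -/
theorem pTime_rawTokens [Finite T] :
    PTime word (rawTokens (T := T)) fun r : RawInstance (Letter T) R C => r := by
  refine PTime.of_transduce (A := Option T ⊕ Option (Sym R ⊕ Option Unit) ⊕
    Option (Sym C ⊕ Option Unit)) (X := Unit) (fun _ _ => ()) (fun _ => tokenOf) (fun _ => []) ()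
    fun r => ?_
  have key : ∀ w, w.flatMap tokenOf = transduce (fun _ _ => ())
      (fun _ => tokenOf (T := T) (R := R) (C := C)) (fun _ => []) () w := by
    intro w
    induction w with
    | nil => rfl
    | cons y w ih => rw [List.flatMap_cons, ih]; rfl
  exact (rawTokens_eq (T := T) r).trans ((key _).trans (congrArg _ (word_raw r).symm))

/-- The tokens of an instance can be converted to its word. -/
theorem pTime_word [Finite T] :
    PTime (rawTokens (T := T)) word fun r : RawInstance (Letter T) R C => r :=
  PTime.of_transduce_reverse (B := Option T ⊕ Option (Sym R ⊕ Option Unit) ⊕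
      Option (Sym C ⊕ Option Unit)) (X := Bool) _ _ _ true fun r =>
    (word_raw r).trans ((rawWord_eq_lettersOf (T := T) r).trans (readTokens_rawTokens r).symm)

/-- Computability of a function on words carries over to arguments that are written by the same
words. -/
theorem PTime.precomp {α β X A B : Type} {ea : α → List A} {eb : β → List B} {ex : X → List A}
    {f : α → β} {i : X → α} (hi : ∀ x, ex x = ea (i x)) (h : PTime ea eb f) :
    PTime ex eb fun x => f (i x) :=
  let ⟨h⟩ := h
  ⟨⟨h.toTM2ComputableAux, h.time, fun x => hi x ▸ h.outputsFun (i x)⟩⟩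

end Tokens

section Encode

variable {T F : Type} [Field F] {D : T → Finset F} {Γ : Set (MRel D)}

/-- Relations are written as their names. -/
@[reducible] def Naming.enc (N : Naming Γ) : Enc Γ := ⟨N.Sym, N.finite_sym, N.name⟩

instance (K : ScalarRepr F) : Enc K.Code := ⟨K.Sym, K.finite_sym, K.word⟩

theorem IMPInstance.encode_eq {K : ScalarRepr F} {d : ℕ} (N : Naming Γ) (I : IMPInstance K Γ d) :
    I.encode N = @rawTokens T Γ K.Code N.enc _ I.raw := by
  let _ := N.enc
  have hvar : ∀ {n : ℕ} (l : List (Fin n)), (l.flatMap encodeVar : List (Token T N.Sym K.Sym)) =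
      (l.map Fin.val).flatMap varTokens := by
    intro n l
    rw [List.flatMap_map]
    rfl
  simp only [IMPInstance.encode, hvar, rawTokens, IMPInstance.raw, consTokens, termTokens,
    List.flatMap_map, List.map_ofFn]
  rfl

end Encode

/-! ### The reduction between ideal membership problems -/

section Main

variable {T S F : Type} [Field F] [Finite T] [Finite S] {D : T → Finset F} {E : S → Finset F}
  {Γ : Set (MRel D)} {Δ : Set (MRel E)}

/-- A polynomial-time reduction between the lists that make up instances is a polynomial-time
reduction between ideal membership problems. -/
theorem polyTimeReducible_of_raw {K : ScalarRepr F} (NΓ : Naming Γ) (NΔ : Naming Δ) {d d' : ℕ}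
    (red : RawInstance (Letter S) Δ K.Code → RawInstance (Letter T) Γ K.Code)
    (hred : let _ := NΓ.enc; let _ := NΔ.enc; PT red)
    (hvalid : ∀ r : RawInstance S Δ K.Code, r.Valid d →
      RawInstance.Valid (T := T) (D := D) d' (red r) ∧
      (RawInstance.Yes (T := T) (D := D) K.val (red r) ↔ r.Yes K.val)) :
    PolyTimeReducible (fun I : IMPInstance K Δ d => I.encode NΔ)
      (fun I : IMPInstance K Γ d' => I.encode NΓ) IMPInstance.Yes IMPInstance.Yes := by
  let _ := NΓ.enc
  let _ := NΔ.enc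
  choose g hg using fun I : IMPInstance K Δ d => exists_raw_eq (hvalid I.raw I.valid_raw).1
  refine ⟨g, ?_, fun I => ?_⟩
  · have h₁ : PTime (fun I : IMPInstance K Δ d => I.encode NΔ) word
        (id (α := RawInstance (Letter S) Δ K.Code) ∘ IMPInstance.raw) :=
      PTime.precomp (i := IMPInstance.raw) (f := fun r : RawInstance (Letter S) Δ K.Code => r)
        (IMPInstance.encode_eq NΔ) pTime_word
    have : Finite (Sym (RawInstance (Letter S) Δ K.Code)) := finite_sym
    have : Finite NΓ.Sym := NΓ.finite_sym
    have : Finite NΔ.Sym := NΔ.finite_sym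
    have : Finite K.Sym := K.finite_sym
    exact PTime.congr (PTime.comp pTime_rawTokens (PTime.comp hred h₁))
      fun I => ((congrArg rawTokens (hg I)).symm.trans (IMPInstance.encode_eq NΓ (g I)).symm)
  · rw [IMPInstance.yes_iff_raw, IMPInstance.yes_iff_raw, hg]
    exact (hvalid I.raw I.valid_raw).2.symm

end Main

end MSIMP

theorem mainTheorem5 {F : Type} [Field F] {T S : Type} [Finite T] [Finite S]
    (D : T → Finset F) (E : S → Finset F)
    (Γ : Set (MSIMP.MRel D)) (Δ : Set (MSIMP.MRel E))
    (h : MSIMP.PPInterprets Γ Δ) :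
    ∃ c : ℕ, ∀ (K : MSIMP.ScalarRepr F),
      (∀ t, ∀ a ∈ D t, a ∈ K.scalars) → (∀ s, ∀ a ∈ E s, a ∈ K.scalars) →
      ∀ (NΓ : MSIMP.Naming Γ) (NΔ : MSIMP.Naming Δ) (d : ℕ),
        MSIMP.PolyTimeReducible
          (fun I : MSIMP.IMPInstance K Δ d => I.encode NΔ)
          (fun I : MSIMP.IMPInstance K Γ (c * d) => I.encode NΓ)
          MSIMP.IMPInstance.Yes MSIMP.IMPInstance.Yes := by
  open MSIMP in
  obtain ⟨hΔ, Fr, π, hπ, hFr, -, hQ⟩ := h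
  have hgad : ∀ g : S ⊕ Δ, ∃ G : Gadget T Γ, G.Defines (gadgetRel Δ π g) := by
    rintro (s | Q)
    · exact (hFr s).exists_gadget
    · exact (hQ Q.1 Q.2).exists_gadget
  choose gad hgad using hgad
  -- the interpolating polynomials have coefficients in the field generated by the domains
  obtain ⟨P, c, hP⟩ := exists_interpolates (π := π)
    (Subfield.closure ((⋃ t, (D t : Set F)) ∪ ⋃ s, (E s : Set F)))
    (fun t a ha => Subfield.subset_closure (.inl (Set.mem_iUnion.2 ⟨t, ha⟩)))
    (fun s a ha => Subfield.subset_closure (.inr (Set.mem_iUnion.2 ⟨s, ha⟩)))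
  refine ⟨c, fun K hD hE NΓ NΔ d => ?_⟩
  have hK : Subfield.closure ((⋃ t, (D t : Set F)) ∪ ⋃ s, (E s : Set F)) ≤ K.scalars := by
    rw [Subfield.closure_le, Set.union_subset_iff, Set.iUnion_subset_iff, Set.iUnion_subset_iff]
    exact ⟨hD, hE⟩
  have : Nonempty (K.Code → K.Code) := ⟨id⟩
  choose! scale hscale hscale' using K.exists_scale
  have : Finite Δ := hΔ
  refine polyTimeReducible_of_raw NΓ NΔ
    (reduce (S := Letter S) (T := Letter T) (fun s => (Fr s).sorts) gad P scale d) ?_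
    fun r hr => reduce_correct hπ hgad hP (fun a ha => hscale a (hK ha)) hr
  let _ := NΓ.enc
  let _ := NΔ.enc
  have : Finite (Letter S) := ‹Finite S›
  exact PT.reduce (S := Letter S) (T := Letter T) word_letter_injective NΔ.name_injective _ _
    (fun s t ht => hscale' t.1 (hK (hP.coeff_mem s t ht))) d
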